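/- Let $d\ge 1$, $T>0$, and let $Q=\{(x,t)\in\mathbb R^{d+1}: 0<t<T,\ x\in\Omega(t)\}$ be a bounded open space-time cylinder with a (possibly moving) spatial domain $\Omega(t)\subset\mathbb R^d$. Let $\Sigma,\Sigma_0,\Sigma_T$ be the parts of $\partial Q$ with $0<t<T$, $t=0$, $t=T$. Let $f\in L_2(Q)$, and let $u\in H^{1,0}_{0,\underline 0}(Q)$ be a weak solution of $\partial_t u-\Delta u=f$ in $Q$, $u=0$ on $\Sigma\cup\Sigma_0$, i.e. $$-\int_Q u\,\partial_t v\,dx\,dt+\int_Q\nabla_x u\cdot\nabla_x v\,dx\,dt=\int_Q f v\,dx\,dt\qquad\forall v\in H^{1,1}_{0,\overline 0}(Q).$$ Here $H^{1,0}_{0,\underline 0}(Q)$ consists of the $u\in L_2(Q)$ with $\nabla_x u\in L_2(Q)^d$ that are limits, in the norm of $H^{1,0}(Q)$, of smooth functions vanishing near $\Sigma\cup\Sigma_0$, and $H^{1,1}_{0,\overline 0}(Q)$ of the $v\in H^1(Q)$ that are limits in $H^1(Q)$ of smooth functions vanishing near $\Sigma\cup\Sigma_T$. Let $Q_1,\dots,Q_N\subset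 Q$ be pairwise disjoint patches with $\overline Q=\bigcup_i\overline{Q_i}$. Each patch is $Q_i=\Phi_i((0,1)^{d+1})$, where $\Phi_i$ is a B-spline or NURBS map whose tensor-product basis functions $\widehat B_{i,m}$ (Cox–de Boor recursion) are $C^1$ up to the boundary of $(0,1)^{d+1}$, and $\Phi_i$ is injective with invertible Jacobian on $[0,1]^{d+1}$. Let $\mathbb V_{h,i}=\operatorname{span}_m\{\widehat B_{i,m}\circ\Phi_i^{-1}\}\subset H^2(Q_i)$, and let $V_{0h}$ be the space of functions $v_h$ on $Q$ with $v_h|_{Q_i}\in\mathbb V_{h,i}$ for all $i$ and $v_h=0$ on $\Sigma\cup\Sigma_0$ in the sense of traces from each patch. Let $h_i$ be the largest diameter of a mesh element (image of a product of knot spans) of $Q_i$, let $\theta_i>0$, $\delta_1,\delta_2>0$, and write $\tau=\theta_ih_i$ on $Q_i$ (a patchwise constant function) and $\tau_i=\theta_ih_i$. For $i<j$ let $F_{ij}=Q\cap\partial Q_i\cap\partial Q_j$ be the interior facet, let $F_{T,i}=\partial Q_i\cap\Sigma_T$, and let $n_i=(n_{i,x},n_{i,t})$ be the outer unit normal of $Q_i$.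 On $F_{ij}$, with $w_i,w_j$ the one-sided traces of $w$, put $[\![w]\!]_x=w_in_{i,x}+w_jn_{j,x}$, $[\![w]\!]_t=w_in_{i,t}+w_jn_{j,t}$, $\{w\}=\frac12(w_i+w_j)$, and $\{w\}^{up}=w_i$ if $n_{i,t}\ge0$, $\{w\}^{up}=w_j$ otherwise. Define $$\begin{aligned}a_h(u,v_h)={}&\sum_{i}\int_{Q_i}\bigl(-u\,\partial_tv_h+\tau_i\,\partial_tu\,\partial_tv_h+\nabla_xu\cdot\nabla_xv_h-\tau_i\,\partial_t\nabla_xu\cdot\nabla_xv_h\bigr)\,dx\,dt\\ &+\sum_{i<j}\int_{F_{ij}}\{u\}^{up}[\![v_h]\!]_t\,ds+\sum_i\int_{F_{T,i}}\bigl(u\,v_h+\tau_i\nabla_xu\cdot\nabla_xv_h\bigr)\,ds\\ &+\sum_{i<j}\int_{F_{ij}}\{\nabla_xu\}^{up}\cdot[\![\tau\nabla_xv_h]\!]_t\,ds+\sum_{i<j}\int_{F_{ij}}\bigl(-\{\nabla_xu\}\cdot[\![v_h]\!]_x+\{\nabla_xv_h\}\cdot[\![u]\!]_x\bigr)\,ds\\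 &+\sum_{i<j}\int_{F_{ij}}\bigl(-\{\nabla_xu\}\cdot[\![\tau\,\partial_tv_h]\!]_x+\tau_i\{\nabla_xv_h\}\cdot[\![\partial_tu]\!]_x\bigr)\,ds\\ &+\sum_{i<j}\int_{F_{ij}}\Bigl(\frac{\delta_1}{h_i}[\![u]\!]_x\cdot[\![v_h]\!]_x+\delta_2\tau_i[\![\partial_tu]\!]_x\cdot[\![\partial_tv_h]\!]_x\Bigr)\,ds,\end{aligned}$$ $$\ell_h(v_h)=\sum_i\int_{Q_i}f\,(v_h+\theta_ih_i\,\partial_tv_h)\,dx\,dt .$$ (If $\theta_ih_i$ is the same for the two patches of a facet, it is a common factor of the facet integrals.) If $u\in H^2(Q)$, then $u$ satisfies the space-time dG-IgA consistency identity $$a_h(u,v_h)=\ell_h(v_h)\qquad\text{for all }v_h\in V_{0h}.$$ -/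

import Mathlib

open MeasureTheory Filter Topology
open scoped ContDiff ENNReal

noncomputable section

namespace SpaceTimeDG

/-- Space-time `ℝ^{d+1}`: the coordinates `0, …, d-1` are spatial, the last one is time. -/
abbrev E (d : ℕ) : Type := EuclideanSpace ℝ (Fin (d + 1))

/-- The index of the time coordinate. -/
abbrev tm (d : ℕ) : Fin (d + 1) := Fin.last d

/-- The index of the `k`-th spatial coordinate. -/
abbrev sp {d : ℕ} (k : Fin d) : Fin (d + 1) := k.castSucc

/-- Classical partial derivative of `φ` in the coordinate direction `k`. -/
def pd {d : ℕ} (k : Fin (d + 1)) (φ : E d → ℝ) (z : E d) : ℝ :=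
  fderiv ℝ φ z (EuclideanSpace.single k 1)

/-! ### Weak derivatives and Sobolev spaces on an open set `U` -/

/-- `g` is the weak partial derivative `∂_k w` on `U`. -/
def HasWeakPartial {d : ℕ} (U : Set (E d)) (k : Fin (d + 1)) (w g : E d → ℝ) : Prop :=
  LocallyIntegrableOn w U ∧ LocallyIntegrableOn g U ∧
    ∀ φ : E d → ℝ, ContDiff ℝ ∞ φ → HasCompactSupport φ → tsupport φ ⊆ U →
      ∫ z in U, w z * pd k φ z = -∫ z in U, g z * φ z

open Classical in
/-- The weak partial derivative `∂_k w` on `U` (unique up to null sets; `0` if there is none). -/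
def weakPartial {d : ℕ} (U : Set (E d)) (k : Fin (d + 1)) (w : E d → ℝ) : E d → ℝ :=
  if h : ∃ g, HasWeakPartial U k w g then h.choose else 0

/-- `w ∈ L₂(U)` has a weak derivative `∂_k w ∈ L₂(U)`. -/
def HasL2Partial {d : ℕ} (U : Set (E d)) (k : Fin (d + 1)) (w : E d → ℝ) : Prop :=
  ∃ g, MemLp g 2 (volume.restrict U) ∧ HasWeakPartial U k w g

/-- `w ∈ H¹(U)`. -/
def MemH1 {d : ℕ} (U : Set (E d)) (w : E d → ℝ) : Prop :=
  MemLp w 2 (volume.restrict U) ∧ ∀ k, HasL2Partial U k w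

/-- `w ∈ H²(U)`. -/
def MemH2 {d : ℕ} (U : Set (E d)) (w : E d → ℝ) : Prop :=
  MemH1 U w ∧ ∀ k, MemH1 U (weakPartial U k w)

/-- `φ n → w` in `L₂(μ)`. -/
def TendstoL2 {d : ℕ} (μ : Measure (E d)) (φ : ℕ → E d → ℝ) (w : E d → ℝ) : Prop :=
  Tendsto (fun n => eLpNorm (φ n - w) 2 μ) atTop (𝓝 0)

/-! ### Boundary: surface measure, outer unit normal, traces -/

/-- The surface measure of `∂U`: the `d`-dimensional Hausdorff measure, normalised to agree with
Lebesgue measure on `d`-dimensional planes. -/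
def surf {d : ℕ} (U : Set (E d)) : Measure (E d) :=
  (Measure.euclideanHausdorffMeasure d).restrict (frontier U)

/-- `n` is the outer unit normal of `U` at `y`: to first order at `y`, the set `U` lies in the half
space `⟪z - y, n⟫ ≤ 0` and the exterior of `U` lies in `⟪z - y, n⟫ ≥ 0`. -/
def IsOuterNormal {d : ℕ} (U : Set (E d)) (y n : E d) : Prop :=
  ‖n‖ = 1 ∧ ∀ ε : ℝ, 0 < ε → ∀ᶠ z in 𝓝 y,
    (z ∈ U → inner ℝ (z - y) n ≤ ε * ‖z - y‖) ∧
    (z ∉ closure U → -(ε * ‖z - y‖) ≤ inner ℝ (z - y) n)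

open Classical in
/-- The outer unit normal field of `U` (`0` where there is no normal, e.g. at edges). -/
def outerNormal {d : ℕ} (U : Set (E d)) (y : E d) : E d :=
  if h : ∃ n, IsOuterNormal U y n then h.choose else 0

/-- `g ∈ L₂(∂U)` is the trace of `w ∈ H¹(U)`: the `L₂(∂U)`-limit of the boundary values of smooth
functions that converge to `w` in `H¹(U)`. -/
def IsTrace {d : ℕ} (U : Set (E d)) (w g : E d → ℝ) : Prop :=
  MemLp g 2 (surf U) ∧
    ∃ φ : ℕ → E d → ℝ, (∀ n, ContDiff ℝ ∞ (φ n)) ∧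
      TendstoL2 (volume.restrict U) φ w ∧
      (∀ k, TendstoL2 (volume.restrict U) (fun n => pd k (φ n)) (weakPartial U k w)) ∧
      TendstoL2 (surf U) φ g

open Classical in
/-- The trace of `w` on `∂U` (unique up to surface null sets on the patches below). -/
def trace {d : ℕ} (U : Set (E d)) (w : E d → ℝ) : E d → ℝ :=
  if h : ∃ g, MemH1 U w ∧ IsTrace U w g then h.choose else 0

/-! ### The space-time cylinder and the weak problem -/

/-- `{(x, t) : x ∈ Ω(t), 0 < t < T}`. -/
def cylinder {d : ℕ} (Ω : ℝ → Set (EuclideanSpace ℝ (Fin d))) (T : ℝ) : Set (E d) :=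
  {z | 0 < z (tm d) ∧ z (tm d) < T ∧ WithLp.toLp 2 (fun k : Fin d => z (sp k)) ∈ Ω (z (tm d))}

/-- A bounded open space-time cylinder with a (possibly moving) spatial domain `Ω(t)`. -/
structure SpaceTimeDomain (d : ℕ) where
  Ω : ℝ → Set (EuclideanSpace ℝ (Fin d))
  T : ℝ
  T_pos : 0 < T
  isOpen_cylinder : IsOpen (cylinder Ω T)
  isBounded_cylinder : Bornology.IsBounded (cylinder Ω T)

namespace SpaceTimeDomain

variable {d : ℕ} (D : SpaceTimeDomain d)

/-- The space-time cylinder `Q`. -/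
def Q : Set (E d) := cylinder D.Ω D.T

/-- The lateral boundary `Σ`. -/
def lateral : Set (E d) := {z | z ∈ frontier D.Q ∧ 0 < z (tm d) ∧ z (tm d) < D.T}

/-- The bottom `Σ_0`. -/
def bottom : Set (E d) := {z | z ∈ frontier D.Q ∧ z (tm d) = 0}

/-- The top `Σ_T`. -/
def top : Set (E d) := {z | z ∈ frontier D.Q ∧ z (tm d) = D.T}

/-- The trial space `H^{1,0}(Q)` with vanishing boundary values on `Σ` and `Σ_0`: the functions
in `H^{1,0}(Q)` that are limits, in the norm of `H^{1,0}(Q)`, of smooth functions vanishing near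
`Σ ∪ Σ_0`. -/
def MemTrial (u : E d → ℝ) : Prop :=
  MemLp u 2 (volume.restrict D.Q) ∧ (∀ k : Fin d, HasL2Partial D.Q (sp k) u) ∧
    ∃ φ : ℕ → E d → ℝ, (∀ n, ContDiff ℝ ∞ (φ n)) ∧
      (∀ n, Disjoint (tsupport (φ n)) (closure (D.lateral ∪ D.bottom))) ∧
      TendstoL2 (volume.restrict D.Q) φ u ∧
      ∀ k : Fin d, TendstoL2 (volume.restrict D.Q) (fun n => pd (sp k) (φ n))
        (weakPartial D.Q (sp k) u)

/-- The test space `H^{1,1}(Q)` with vanishing boundary values on `Σ` and `Σ_T`: the functions in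
`H^{1,1}(Q) = H¹(Q)` that are limits, in the norm of `H¹(Q)`, of smooth functions vanishing near
`Σ ∪ Σ_T`. -/
def MemTest (v : E d → ℝ) : Prop :=
  MemH1 D.Q v ∧
    ∃ φ : ℕ → E d → ℝ, (∀ n, ContDiff ℝ ∞ (φ n)) ∧
      (∀ n, Disjoint (tsupport (φ n)) (closure (D.lateral ∪ D.top))) ∧
      TendstoL2 (volume.restrict D.Q) φ v ∧
      ∀ k, TendstoL2 (volume.restrict D.Q) (fun n => pd k (φ n)) (weakPartial D.Q k v)

/-- `a(u, v) = -∫_Q u ∂_t v + ∫_Q ∇_x u · ∇_x v`. -/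
def weakForm (u v : E d → ℝ) : ℝ :=
  -(∫ z in D.Q, u z * weakPartial D.Q (tm d) v z) +
    ∫ z in D.Q, ∑ k : Fin d, weakPartial D.Q (sp k) u z * weakPartial D.Q (sp k) v z

/-- `u` is a weak solution of `∂_t u - Δ u = f` in `Q`, `u = 0` on `Σ ∪ Σ_0`. -/
def IsWeakSolution (f u : E d → ℝ) : Prop :=
  D.MemTrial u ∧ ∀ v, D.MemTest v → D.weakForm u v = ∫ z in D.Q, f z * v z

end SpaceTimeDomain

/-! ### B-splines and NURBS patches -/

/-- The univariate B-spline of degree `p` (first argument) with index `i` (second argument) over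
the knots `ξ`, by the Cox--de Boor recursion, with division by zero giving zero. -/
def bspline (ξ : ℕ → ℝ) : ℕ → ℕ → ℝ → ℝ
  | 0, i, x => if ξ i ≤ x ∧ x < ξ (i + 1) then 1 else 0
  | p + 1, i, x =>
      (x - ξ i) / (ξ (i + p + 1) - ξ i) * bspline ξ p i x +
        (ξ (i + p + 2) - x) / (ξ (i + p + 2) - ξ (i + 1)) * bspline ξ p (i + 1) x

/-- A knot vector `0 = ξ 0 ≤ … ≤ ξ (n + p) = 1` of degree `p` with `n` basis functions (indexed
from `0`; only the entries `ξ 0, …, ξ (n + p)` matter). -/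
structure KnotVector where
  n : ℕ
  p : ℕ
  one_le_n : 1 ≤ n
  one_le_p : 1 ≤ p
  knot : ℕ → ℝ
  mono : MonotoneOn knot (Set.Iic (n + p))
  knot_first : knot 0 = 0
  knot_last : knot (n + p) = 1

/-- The parameter domain `(0,1)^{d+1}`. -/
def openCube (d : ℕ) : Set (E d) := {ξ | ∀ α, 0 < ξ α ∧ ξ α < 1}

/-- The closed cube `[0,1]^{d+1}`. -/
def closedCube (d : ℕ) : Set (E d) := {ξ | ∀ α, 0 ≤ ξ α ∧ ξ α ≤ 1}

/-- A tensor-product spline space: B-splines if `weights = none`, NURBS with positive weights `w`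
if `weights = some w`. -/
structure SplineSpace (d : ℕ) where
  kv : Fin (d + 1) → KnotVector
  weights : Option (((α : Fin (d + 1)) → Fin (kv α).n) → ℝ)
  weights_pos : ∀ w ∈ weights, ∀ m, 0 < w m

namespace SplineSpace

variable {d : ℕ} (S : SplineSpace d)

/-- Multi-indices of the basis functions. -/
abbrev Idx : Type := (α : Fin (d + 1)) → Fin (S.kv α).n

/-- Tensor-product B-splines. -/
def tensorB (m : S.Idx) (ξ : E d) : ℝ :=
  ∏ α, bspline (S.kv α).knot (S.kv α).p (m α) (ξ α)

/-- The basis functions in the parameter domain: `B_m` for B-splines and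
`w_m B_m / ∑_j w_j B_j` for NURBS. -/
def basis (m : S.Idx) (ξ : E d) : ℝ :=
  match S.weights with
  | none => S.tensorB m ξ
  | some w => w m * S.tensorB m ξ / ∑ j, w j * S.tensorB j ξ

end SplineSpace

/-- The spline data of one patch: the basis functions, which are continuously differentiable up to
the boundary of the parameter domain (`basisExt m` is a `C¹` function on `ℝ^{d+1}` that agrees with
the `m`-th basis function on `(0,1)^{d+1}`), and the control points. -/
structure PatchData (d : ℕ) extends SplineSpace d where
  basisExt : toSplineSpace.Idx → E d → ℝ
  contDiff_basisExt : ∀ m, ContDiff ℝ 1 (basisExt m)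
  basisExt_eq : ∀ m, Set.EqOn (basisExt m) (toSplineSpace.basis m) (openCube d)
  ctrl : toSplineSpace.Idx → E d

namespace PatchData

variable {d : ℕ} (P : PatchData d)

/-- The geometrical mapping `Φ(ξ) = ∑_m C_m B_m(ξ)`; on `[0,1]^{d+1}` it is the continuous
extension of the spline map on `(0,1)^{d+1}`. -/
def geo (ξ : E d) : E d := ∑ m, P.basisExt m ξ • P.ctrl m

/-- The patch `Φ((0,1)^{d+1})`. -/
def dom : Set (E d) := P.geo '' openCube d

/-- The basis function `B_m ∘ Φ⁻¹` on the patch. -/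
def physBasis (m : P.Idx) (z : E d) : ℝ :=
  P.basis m (Function.invFunOn P.geo (openCube d) z)

/-- The discrete space of the patch, the span of the functions `B_m ∘ Φ⁻¹`. -/
def space : Submodule ℝ (E d → ℝ) := Submodule.span ℝ (Set.range P.physBasis)

/-- The mesh element `Φ(K̂)`, where `K̂` is the product of the open knot spans
`(ξ (e α), ξ (e α + 1))`; it is empty if one of the spans is degenerate. -/
def cell (e : (α : Fin (d + 1)) → Fin ((P.kv α).n + (P.kv α).p)) : Set (E d) :=
  P.geo '' {ξ | ∀ α, (P.kv α).knot (e α) < ξ α ∧ ξ α < (P.kv α).knot (e α + 1)}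

/-- The mesh size: the largest diameter of a mesh element. -/
def meshSize : ℝ := ⨆ e, Metric.diam (P.cell e)

end PatchData

/-- A patch: the geometrical mapping is regular up to the boundary of the parameter domain, and the
discrete space is contained in `H²` of the patch. -/
structure Patch (d : ℕ) extends PatchData d where
  geo_injOn : Set.InjOn toPatchData.geo (closedCube d)
  geo_regular : ∀ ξ ∈ closedCube d, (fderiv ℝ toPatchData.geo ξ).det ≠ 0
  basis_memH2 : ∀ m, MemH2 toPatchData.dom (toPatchData.physBasis m)

/-- A decomposition of `Q` into `N` non-overlapping patches. -/
structure Multipatch {d : ℕ} (D : SpaceTimeDomain d) where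
  N : ℕ
  patch : Fin N → Patch d
  patch_subset : ∀ i, (patch i).dom ⊆ D.Q
  patch_disjoint : ∀ i j, i ≠ j → Disjoint (patch i).dom (patch j).dom
  closure_eq : closure D.Q = ⋃ i, closure (patch i).dom

namespace Multipatch

variable {d : ℕ} {D : SpaceTimeDomain d} (M : Multipatch D)

/-- The patch `Q_i`. -/
def dom (i : Fin M.N) : Set (E d) := (M.patch i).dom

/-- The mesh size `h_i`. -/
def h (i : Fin M.N) : ℝ := (M.patch i).meshSize

/-- The outer unit normal `n_i` of `Q_i`. -/
def nrm (i : Fin M.N) (y : E d) : E d := outerNormal (M.dom i) y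

/-- The weak derivative `∂_k w` on the patch `Q_i`. -/
def der (i : Fin M.N) (k : Fin (d + 1)) (w : E d → ℝ) : E d → ℝ := weakPartial (M.dom i) k w

/-- The trace on `∂Q_i` of the restriction of `w` to `Q_i`. -/
def tr (i : Fin M.N) (w : E d → ℝ) : E d → ℝ := trace (M.dom i) w

/-- The trace on `∂Q_i` of `∂_k w`, taken from inside `Q_i`. -/
def trD (i : Fin M.N) (k : Fin (d + 1)) (w : E d → ℝ) : E d → ℝ := M.tr i (M.der i k w)

/-- The interior facet `F_ij`: the part of `∂Q_i ∩ ∂Q_j` inside `Q`. -/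
def facet (i j : Fin M.N) : Set (E d) := D.Q ∩ (frontier (M.dom i) ∩ frontier (M.dom j))

/-- The facet of `Q_i` on `Σ_T`. -/
def topFacet (i : Fin M.N) : Set (E d) := frontier (M.dom i) ∩ D.top

/-- The `k`-th component of the jump `a n_i + b n_j` on `F_ij`, where `a` and `b` are the one-sided
values from `Q_i` and `Q_j`. -/
def jump (i j : Fin M.N) (k : Fin (d + 1)) (a b : E d → ℝ) (y : E d) : ℝ :=
  a y * M.nrm i y k + b y * M.nrm j y k

/-- The average of the one-sided values. -/
def avg (a b : E d → ℝ) (y : E d) : ℝ := (a y + b y) / 2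

open Classical in
/-- The upwind value in time direction. -/
def up (i : Fin M.N) (a b : E d → ℝ) (y : E d) : ℝ :=
  if 0 ≤ M.nrm i y (tm d) then a y else b y

/-- Integral over a surface `F ⊆ ℝ^{d+1}`. -/
def surfInt (F : Set (E d)) (g : E d → ℝ) : ℝ :=
  ∫ y in F, g y ∂(Measure.euclideanHausdorffMeasure d)

/-- Sum over all interior facets `F_ij`, each unordered pair of patches being listed once. -/
def sumFacets (g : Fin M.N → Fin M.N → ℝ) : ℝ := ∑ i, ∑ j ∈ Finset.Ioi i, g i j

/-- The discrete space `V_{0h}`: patchwise discrete functions that vanish on `Σ ∪ Σ_0`. -/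
def MemV0h (v : E d → ℝ) : Prop :=
  (∀ i, ∃ w ∈ (M.patch i).space, Set.EqOn v w (M.dom i)) ∧
    ∀ i, ∀ᵐ y ∂(surf (M.dom i)), y ∈ D.lateral ∪ D.bottom → M.tr i v y = 0

variable (θ : Fin M.N → ℝ) (δ₁ δ₂ : ℝ)

/-- The discrete bilinear form `a_h(u, v)`, with `τ i = θ_i h_i`. In the two facet terms that do not
vanish for a function `u` in `H²(Q)` the patchwise constant factor `τ` stands at the one-sided
values of the test function; if `τ i = τ j`, it is a common factor of the integral over `F_ij`. -/
def dgForm (u v : E d → ℝ) : ℝ :=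
  let τ : Fin M.N → ℝ := fun i => θ i * M.h i
  (∑ i, ∫ z in M.dom i,
      (-(u z * M.der i (tm d) v z) + τ i * (M.der i (tm d) u z * M.der i (tm d) v z)
        + ∑ k : Fin d, M.der i (sp k) u z * M.der i (sp k) v z
        - τ i * ∑ k : Fin d, M.der i (tm d) (M.der i (sp k) u) z * M.der i (sp k) v z))
  + M.sumFacets (fun i j => surfInt (M.facet i j) fun y =>
      M.up i (M.tr i u) (M.tr j u) y * M.jump i j (tm d) (M.tr i v) (M.tr j v) y)
  + (∑ i, surfInt (M.topFacet i) fun y => M.tr i u y * M.tr i v y)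
  + (∑ i, τ i * surfInt (M.topFacet i) fun y =>
      ∑ k : Fin d, M.trD i (sp k) u y * M.trD i (sp k) v y)
  + M.sumFacets (fun i j => surfInt (M.facet i j) fun y =>
      ∑ k : Fin d, M.up i (M.trD i (sp k) u) (M.trD j (sp k) u) y *
        M.jump i j (tm d) (τ i • M.trD i (sp k) v) (τ j • M.trD j (sp k) v) y)
  + M.sumFacets (fun i j => surfInt (M.facet i j) fun y =>
      ∑ k : Fin d,
        (-(avg (M.trD i (sp k) u) (M.trD j (sp k) u) y *
            M.jump i j (sp k) (M.tr i v) (M.tr j v) y)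
          + avg (M.trD i (sp k) v) (M.trD j (sp k) v) y *
            M.jump i j (sp k) (M.tr i u) (M.tr j u) y))
  + M.sumFacets (fun i j => surfInt (M.facet i j) fun y =>
      ∑ k : Fin d,
        (-(avg (M.trD i (sp k) u) (M.trD j (sp k) u) y *
            M.jump i j (sp k) (τ i • M.trD i (tm d) v) (τ j • M.trD j (tm d) v) y)
          + τ i * (avg (M.trD i (sp k) v) (M.trD j (sp k) v) y *
            M.jump i j (sp k) (M.trD i (tm d) u) (M.trD j (tm d) u) y)))
  + M.sumFacets (fun i j => surfInt (M.facet i j) fun y =>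
      ∑ k : Fin d,
        (δ₁ / M.h i * (M.jump i j (sp k) (M.tr i u) (M.tr j u) y *
            M.jump i j (sp k) (M.tr i v) (M.tr j v) y)
          + δ₂ * τ i * (M.jump i j (sp k) (M.trD i (tm d) u) (M.trD j (tm d) u) y *
            M.jump i j (sp k) (M.trD i (tm d) v) (M.trD j (tm d) v) y)))

/-- The discrete right-hand side `ℓ_h(v) = ∑_i ∫_{Q_i} f (v + θ_i h_i ∂_t v)`. -/
def dgRhs (f v : E d → ℝ) : ℝ :=
  ∑ i, ∫ z in M.dom i, f z * (v z + θ i * M.h i * M.der i (tm d) v z)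

end Multipatch

end SpaceTimeDG

end

open MeasureTheory Filter Topology
open scoped ContDiff ENNReal

noncomputable section

namespace SpaceTimeDG

open scoped Convolution

/-! Since `u` lies in `H²(Q)`, testing the weak formulation with smooth functions supported in `Q`
shows that `∂_t u - Δu = f` almost everywhere (`IsWeakSolution.ae_eq`). The equation may therefore
be multiplied by `v + τ ∂_t v` on each patch separately and integrated by parts there. The only
unusual term is `-τ ∂_t∇u·∇v`: it is moved to `τ ∇u·∂_t∇v` by parts in time, weak derivatives of `v`
are commuted, and a second integration by parts in space yields `-τ Δu ∂_t v`. What remains is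
`ℓ_h(v)` plus four boundary integrals per patch: `u v n_t`, `∇u·n_x v`, `τ ∇u·n_x ∂_t v` and `τ
∇u·∇v n_t` (`IsGreenDomain.integral_identity`).

These boundary integrals are then summed over the patches and split (`sum_integral_surf`). On
interior facets the two normals are opposite and the traces of `u` and of its first derivatives are
single-valued (`tr_ae_eq_tr`, `ae_facet`). So upwind values and averages of `u` reduce to the common
trace, all jumps of `u` vanish, and the facet terms of `a_h` cancel the boundary integrals exactly.
On the top the normal is the time direction: two of the integrals vanish and the other two are the
top terms of `a_h`. On `Σ ∪ Σ_0` the condition `v = 0` removes the two integrals containing `v`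
itself. The two containing derivatives of `v` cancel each other: the gradient of a function
vanishing on a surface is normal to it, so `∂_t v n_x = ∇v n_t` almost everywhere
(`CubeChart.ae_pd_mul_outerNormal`). Discrete functions are `C¹` up to the patch boundary, which
gives this relation a pointwise meaning.

Most of the work is the analysis behind these lines, because a patch is only a `C¹` image of a cube,
with edges and corners. Green's formula (`CubeChart.green`) comes from the cube: the Piola transform
of a continuous function is a continuous field whose weak divergence is known, and testing with
cutoffs that steepen at the faces produces the boundary values. The area formula identifies the
Hausdorff measure on a face with the surface element of the chart. Smooth functions are dense in
`H¹` of a patch because one can contract towards the centre in the chart and then mollify. With the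
trace inequality this gives existence and uniqueness of traces and integration by parts for `H¹`
functions (`IsGreenDomain.green_trace`). Outer normals are defined by a first-order condition at a
point, independently of charts. Hence patches that meet at a point with normals have opposite ones,
and at most two patches can meet there. -/

/-! ### Mollification -/

/-- The standard mollifier of radius `r`. -/
def bump (d : ℕ) (r : ℝ) (hr : 0 < r) : ContDiffBump (0 : E d) :=
  ⟨r / 2, r, half_pos hr, half_lt_self hr⟩

/-- The convolution of `w` with the mollifier `b`. -/
def moll {d : ℕ} (b : ContDiffBump (0 : E d)) (w : E d → ℝ) : E d → ℝ :=
  (b.normed volume) ⋆[ContinuousLinearMap.lsmul ℝ ℝ, volume] w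

variable {d : ℕ}

lemma moll_apply (b : ContDiffBump (0 : E d)) (w : E d → ℝ) (x : E d) :
    moll b w x = ∫ t, b.normed volume t * w (x - t) := by
  simp [moll, convolution_def]

lemma moll_apply' (b : ContDiffBump (0 : E d)) (w : E d → ℝ) (x : E d) :
    moll b w x = ∫ t, b.normed volume (x - t) * w t := by
  simp [moll, convolution_lsmul_swap]

lemma contDiff_moll (b : ContDiffBump (0 : E d)) {w : E d → ℝ} (hw : LocallyIntegrable w) :
    ContDiff ℝ ∞ (moll b w) :=
  (b.hasCompactSupport_normed (μ := (volume : Measure (E d)))).contDiff_convolution_left _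
    b.contDiff_normed hw

lemma pd_moll (b : ContDiffBump (0 : E d)) {w : E d → ℝ} (hw : LocallyIntegrable w)
    (k : Fin (d + 1)) (x : E d) :
    pd k (moll b w) x = ∫ t, pd k (b.normed volume) (x - t) * w t := by
  have h := (b.hasCompactSupport_normed (μ := (volume : Measure (E d)))).hasFDerivAt_convolution_left
    (ContinuousLinearMap.lsmul ℝ ℝ) (b.contDiff_normed (n := 1)) hw x
  have hi : ConvolutionExistsAt (fderiv ℝ (b.normed volume)) w x
      ((ContinuousLinearMap.lsmul ℝ ℝ).precompL (E d)) volume :=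
    ((b.hasCompactSupport_normed (μ := (volume : Measure (E d)))).fderiv ℝ).convolutionExists_left _
      ((b.contDiff_normed (n := 1)).continuous_fderiv (by simp)) hw x
  rw [pd, moll, h.fderiv, convolution_def, ContinuousLinearMap.integral_apply hi]
  simp only [ContinuousLinearMap.precompL_apply, ContinuousLinearMap.lsmul_apply, smul_eq_mul]
  rw [← integral_sub_left_eq_self _ _ x]
  simp [pd]

lemma pd_comp_const_sub {φ : E d → ℝ} (hφ : Differentiable ℝ φ) (x : E d) (k : Fin (d + 1))
    (y : E d) : pd k (fun t => φ (x - t)) y = -pd k φ (x - y) := by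
  have h := (hφ (x - y)).hasFDerivAt.comp y ((hasFDerivAt_const x y).sub (hasFDerivAt_id y))
  have : (fun t => φ (x - t)) = φ ∘ fun t => x - t := rfl
  rw [pd, this, HasFDerivAt.fderiv h]
  simp [pd]

/-- Mollification commutes with weak differentiation away from the boundary. -/
lemma HasWeakPartial.pd_moll {U : Set (E d)} (hU : MeasurableSet U) {k : Fin (d + 1)} {w g : E d → ℝ}
    (h : HasWeakPartial U k w g) (hw : LocallyIntegrable (U.indicator w))
    (b : ContDiffBump (0 : E d)) {x : E d} (hx : Metric.closedBall x b.rOut ⊆ U) :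
    pd k (moll b (U.indicator w)) x = moll b (U.indicator g) x := by
  have hts : tsupport (fun t => b.normed volume (x - t)) ⊆ Metric.closedBall x b.rOut := by
    apply closure_minimal _ Metric.isClosed_closedBall
    intro t ht
    have : x - t ∈ Function.support (b.normed volume) := ht
    rw [b.support_normed_eq] at this
    simp only [Metric.mem_ball, dist_zero_right, Metric.mem_closedBall] at this ⊢
    rw [dist_comm, dist_eq_norm]; exact this.le
  -- The reflected translate of the mollifier is an admissible test function exactly because its
  -- support lies in the ball around `x`, hence in `U`.
  have h3 := h.2.2 (fun t => b.normed volume (x - t))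
    (b.contDiff_normed.comp (contDiff_const.sub contDiff_id))
    (HasCompactSupport.of_support_subset_isCompact (isCompact_closedBall x b.rOut)
      (subset_closure.trans hts)) (hts.trans hx)
  rw [SpaceTimeDG.pd_moll b hw, moll_apply']
  have hind : ∀ a w : E d → ℝ, ∫ t, a t * U.indicator w t = ∫ t in U, a t * w t := fun a w => by
    rw [← integral_indicator hU]; congr 1; ext t
    by_cases ht : t ∈ U <;> simp [ht]
  rw [hind, hind]
  simp only [pd_comp_const_sub ((b.contDiff_normed (n := 1)).differentiable (by simp))] at h3
  have h4 : ∫ z in U, w z * -pd k (b.normed volume) (x - z)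
      = - ∫ z in U, pd k (b.normed volume) (x - z) * w z := by
    rw [← integral_neg]; congr 1; ext z; ring
  rw [h4, neg_inj] at h3
  rw [h3]; congr 1; ext z; ring

/-! ### L² estimates for mollification -/

/-- Jensen's inequality for a density of mass at most one, obtained from Cauchy–Schwarz by writing
`ρ h = ρ^{1/2} · ρ^{1/2} h`. -/
lemma lintegral_enorm_mul_sq_le {α : Type*} [MeasurableSpace α] {μ : Measure α} {ρ h : α → ℝ≥0∞}
    (hρ : AEMeasurable ρ μ) (hh : AEMeasurable h μ) (h1 : ∫⁻ a, ρ a ∂μ ≤ 1) :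
    (∫⁻ a, ρ a * h a ∂μ) ^ 2 ≤ ∫⁻ a, ρ a * h a ^ 2 ∂μ := by
  have hH := ENNReal.lintegral_mul_le_Lp_mul_Lq μ Real.HolderConjugate.two_two
    (f := fun a => ρ a ^ (1 / 2 : ℝ)) (g := fun a => ρ a ^ (1 / 2 : ℝ) * h a)
    (hρ.pow_const _) ((hρ.pow_const _).mul hh)
  have e1 : ∀ a, ρ a ^ (1 / 2 : ℝ) * (ρ a ^ (1 / 2 : ℝ) * h a) = ρ a * h a := fun a => by
    rw [← mul_assoc, ← ENNReal.rpow_add_of_nonneg _ _ (by norm_num) (by norm_num)]; norm_num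
  have e2 : ∀ a, (ρ a ^ (1 / 2 : ℝ)) ^ (2 : ℝ) = ρ a := fun a => by
    rw [← ENNReal.rpow_mul]; norm_num
  have e3 : ∀ a, (ρ a ^ (1 / 2 : ℝ) * h a) ^ (2 : ℝ) = ρ a * h a ^ 2 := fun a => by
    rw [ENNReal.mul_rpow_of_nonneg _ _ (by norm_num), e2]; norm_num
  simp only [Pi.mul_apply, e1, e2, e3] at hH
  calc (∫⁻ a, ρ a * h a ∂μ) ^ 2
      ≤ ((∫⁻ a, ρ a ∂μ) ^ (1 / 2 : ℝ) * (∫⁻ a, ρ a * h a ^ 2 ∂μ) ^ (1 / 2 : ℝ)) ^ 2 := by gcongr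
    _ ≤ (1 * (∫⁻ a, ρ a * h a ^ 2 ∂μ) ^ (1 / 2 : ℝ)) ^ 2 := by
        gcongr; exact ENNReal.rpow_le_one h1 (by norm_num)
    _ = _ := by
        rw [one_mul, ← ENNReal.rpow_natCast, ← ENNReal.rpow_mul]; norm_num

lemma eLpNorm_two_sq {α : Type*} [MeasurableSpace α] (μ : Measure α) (f : α → ℝ) :
    eLpNorm f 2 μ ^ 2 = ∫⁻ a, ‖f a‖ₑ ^ 2 ∂μ := by
  rw [eLpNorm_eq_lintegral_rpow_enorm_toReal (by simp) (by simp), ← ENNReal.rpow_natCast,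
    ← ENNReal.rpow_mul]
  norm_num

/-- Mollification is a contraction of `L²`. -/
lemma eLpNorm_moll_le (b : ContDiffBump (0 : E d)) {w : E d → ℝ} (hw : AEStronglyMeasurable w) :
    eLpNorm (moll b w) 2 volume ≤ eLpNorm w 2 volume := by
  have hρm : Measurable fun t => ‖b.normed (volume : Measure (E d)) t‖ₑ :=
    b.continuous_normed.measurable.enorm
  have hρ1 : ∫⁻ t, ‖b.normed (volume : Measure (E d)) t‖ₑ = 1 := by
    rw [← ofReal_integral_norm_eq_lintegral_enorm b.integrable_normed]
    simp only [Real.norm_of_nonneg (b.nonneg_normed _), b.integral_normed, ENNReal.ofReal_one]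
  rw [← ENNReal.pow_le_pow_left_iff (n := 2) (by norm_num), eLpNorm_two_sq, eLpNorm_two_sq]
  have hwm : AEMeasurable (fun p : E d × E d => ‖w (p.1 - p.2)‖ₑ ^ 2)
      ((volume : Measure (E d)).prod volume) :=
    ((hw.comp_quasiMeasurePreserving
      (quasiMeasurePreserving_sub_of_right_invariant volume volume)).enorm).pow_const _
  -- Jensen for the mollifier at fixed `x`, then Tonelli and translation invariance.
  calc ∫⁻ x, ‖moll b w x‖ₑ ^ 2
      ≤ ∫⁻ x, ∫⁻ t, ‖b.normed (volume : Measure (E d)) t‖ₑ * ‖w (x - t)‖ₑ ^ 2 := by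
        refine lintegral_mono fun x => ?_
        have hwx : AEStronglyMeasurable (fun t => w (x - t)) volume :=
          hw.comp_quasiMeasurePreserving (quasiMeasurePreserving_sub_left volume x)
        refine le_trans ?_ (lintegral_enorm_mul_sq_le hρm.aemeasurable hwx.enorm hρ1.le)
        gcongr
        rw [moll_apply]
        refine (enorm_integral_le_lintegral_enorm _).trans (le_of_eq ?_)
        simp only [enorm_mul]
    _ = ∫⁻ t, ∫⁻ x, ‖b.normed (volume : Measure (E d)) t‖ₑ * ‖w (x - t)‖ₑ ^ 2 := by
        refine lintegral_lintegral_swap ?_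
        exact (hρm.comp measurable_snd).aemeasurable.mul hwm
    _ = ∫⁻ t, ‖b.normed (volume : Measure (E d)) t‖ₑ * ∫⁻ x, ‖w x‖ₑ ^ 2 := by
        refine lintegral_congr fun t => ?_
        rw [lintegral_const_mul' _ _ enorm_ne_top,
          lintegral_sub_right_eq_self (fun x => ‖w x‖ₑ ^ 2) t]
    _ = ∫⁻ x, ‖w x‖ₑ ^ 2 := by
        rw [lintegral_mul_const _ hρm, hρ1, one_mul]

lemma moll_sub (b : ContDiffBump (0 : E d)) {w v : E d → ℝ} (hw : LocallyIntegrable w)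
    (hv : LocallyIntegrable v) : moll b (w - v) = moll b w - moll b v := by
  have hex : ∀ {w : E d → ℝ}, LocallyIntegrable w → ∀ x : E d,
      Integrable (fun t => b.normed volume t * w (x - t)) := fun hw x =>
    (b.hasCompactSupport_normed (μ := (volume : Measure (E d)))).convolutionExists_left
      (ContinuousLinearMap.lsmul ℝ ℝ) b.continuous_normed hw x
  ext x
  simp only [moll_apply, Pi.sub_apply, mul_sub]
  exact integral_sub (hex hw x) (hex hv x)

lemma norm_moll_sub_le (b : ContDiffBump (0 : E d)) {w : E d → ℝ} (hw : Continuous w) {x : E d}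
    {ε : ℝ} (h : ∀ y ∈ Metric.ball x b.rOut, dist (w y) (w x) ≤ ε) : |moll b w x - w x| ≤ ε := by
  have := b.dist_normed_convolution_le (μ := volume) hw.aestronglyMeasurable h
  rwa [Real.dist_eq] at this

/-- Mollification of a compactly supported continuous function converges uniformly. -/
lemma exists_forall_norm_moll_sub_le {w : E d → ℝ} (hw : Continuous w) (hc : HasCompactSupport w)
    {ε : ℝ} (hε : 0 < ε) :
    ∃ r₀ > 0, ∀ b : ContDiffBump (0 : E d), b.rOut ≤ r₀ → ∀ x, |moll b w x - w x| ≤ ε := by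
  obtain ⟨r, hr, h⟩ := Metric.uniformContinuous_iff.1 (hc.uniformContinuous_of_continuous hw) ε hε
  exact ⟨r, hr, fun b hb x => norm_moll_sub_le b hw fun y hy =>
    (h (lt_of_lt_of_le hy hb)).le⟩

lemma support_moll_subset (b : ContDiffBump (0 : E d)) (w : E d → ℝ) :
    tsupport (moll b w) ⊆ Metric.cthickening b.rOut (tsupport w) := by
  refine closure_minimal (fun x hx => ?_) Metric.isClosed_cthickening
  have := support_convolution_subset_swap (ContinuousLinearMap.lsmul ℝ ℝ) hx
  rw [b.support_normed_eq] at this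
  obtain ⟨y, hy, z, hz, rfl⟩ := this
  refine Metric.mem_cthickening_of_dist_le _ y _ _ (subset_closure hy) ?_
  simpa using (mem_ball_zero_iff.1 hz).le

/-! ### Classical partial derivatives -/

lemma pd_continuous {f : E d → ℝ} (hf : ContDiff ℝ 1 f) (k : Fin (d + 1)) : Continuous (pd k f) :=
  (hf.continuous_fderiv (by simp)).clm_apply continuous_const

lemma pd_hasCompactSupport {f : E d → ℝ} (hf : HasCompactSupport f) (k : Fin (d + 1)) :
    HasCompactSupport (pd k f) :=
  (hf.fderiv ℝ).comp_left (g := fun L : E d →L[ℝ] ℝ => L (EuclideanSpace.single k 1)) rfl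

lemma tsupport_pd_subset (f : E d → ℝ) (k : Fin (d + 1)) : tsupport (pd k f) ⊆ tsupport f :=
  (closure_mono (Function.support_comp_subset (g := fun L : E d →L[ℝ] ℝ =>
    L (EuclideanSpace.single k 1)) rfl (fderiv ℝ f))).trans (tsupport_fderiv_subset ℝ)

lemma pd_mul {f g : E d → ℝ} {z : E d} (hf : DifferentiableAt ℝ f z) (hg : DifferentiableAt ℝ g z)
    (k : Fin (d + 1)) : pd k (fun z => f z * g z) z = f z * pd k g z + g z * pd k f z := by
  simp [pd, fderiv_fun_mul hf hg]

lemma integral_mul_pd {f g : E d → ℝ} (hf : ContDiff ℝ 1 f) (hg : ContDiff ℝ 1 g)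
    (hc : HasCompactSupport g) (k : Fin (d + 1)) :
    ∫ z, f z * pd k g z = -∫ z, pd k f z * g z := by
  refine integral_mul_fderiv_eq_neg_fderiv_mul_of_integrable ?_ ?_ ?_
    (fun x _ => hf.differentiable (by simp) x) (fun x _ => hg.differentiable (by simp) x)
  · exact ((pd_continuous hf k).mul hg.continuous).integrable_of_hasCompactSupport hc.mul_left
  · exact (hf.continuous.mul (pd_continuous hg k)).integrable_of_hasCompactSupport
      (pd_hasCompactSupport hc k).mul_left
  · exact (hf.continuous.mul hg.continuous).integrable_of_hasCompactSupport hc.mul_left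

/-! ### Weak derivatives -/

/-- Classical derivatives are weak derivatives. -/
lemma hasWeakPartial_of_contDiff {f : E d → ℝ} (hf : ContDiff ℝ 1 f) (U : Set (E d))
    (k : Fin (d + 1)) : HasWeakPartial U k f (pd k f) := by
  refine ⟨hf.continuous.locallyIntegrable.locallyIntegrableOn _,
    (pd_continuous hf k).locallyIntegrable.locallyIntegrableOn _, fun φ hφ hc hs => ?_⟩
  have h := integral_mul_pd hf (hφ.of_le (by simp)) hc k
  rw [setIntegral_eq_integral_of_forall_compl_eq_zero, h,
    setIntegral_eq_integral_of_forall_compl_eq_zero]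
  · intro x hx
    rw [image_eq_zero_of_notMem_tsupport (fun h => hx (hs h)), mul_zero]
  · intro x hx
    rw [image_eq_zero_of_notMem_tsupport (fun h => hx (hs (tsupport_pd_subset φ k h))), mul_zero]

/-- The case `U = univ` of the commutation with weak derivatives, in which the distance to the
boundary plays no role. -/
lemma moll_pd (b : ContDiffBump (0 : E d)) {f : E d → ℝ} (hf : ContDiff ℝ 1 f) (k : Fin (d + 1)) :
    pd k (moll b f) = moll b (pd k f) := by
  ext x
  have := (hasWeakPartial_of_contDiff hf Set.univ k).pd_moll MeasurableSet.univ
    (by simpa using hf.continuous.locallyIntegrable) b (x := x) (Set.subset_univ _)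
  simpa using this

/-- A compactly supported `C¹` function is a `C¹`-limit of smooth functions with supports close to
its support. -/
lemma exists_smooth_approx {f : E d → ℝ} (hf : ContDiff ℝ 1 f) (hc : HasCompactSupport f) {ε : ℝ}
    (hε : 0 < ε) :
    ∃ φ : E d → ℝ, ContDiff ℝ ∞ φ ∧ tsupport φ ⊆ Metric.cthickening ε (tsupport f) ∧
      (∀ z, |φ z - f z| ≤ ε) ∧ ∀ k z, |pd k φ z - pd k f z| ≤ ε := by
  obtain ⟨r₀, hr₀, h₀⟩ := exists_forall_norm_moll_sub_le hf.continuous hc hε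
  choose r hr h using fun k => exists_forall_norm_moll_sub_le (pd_continuous hf k)
    (pd_hasCompactSupport hc k) hε
  obtain ⟨R, hR, hRr⟩ : ∃ R > 0, R ≤ r₀ ∧ R ≤ ε ∧ ∀ k, R ≤ r k := by
    refine ⟨min (min r₀ ε) (Finset.univ.inf' Finset.univ_nonempty r), ?_, ?_, ?_, ?_⟩
    · simp [hr₀, hε, hr]
    · exact (min_le_left _ _).trans (min_le_left _ _)
    · exact (min_le_left _ _).trans (min_le_right _ _)
    · exact fun k => (min_le_right _ _).trans (Finset.inf'_le _ (Finset.mem_univ k))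
  refine ⟨moll (bump d R hR) f, contDiff_moll _ hf.continuous.locallyIntegrable, ?_, ?_, ?_⟩
  · exact (support_moll_subset _ _).trans (Metric.cthickening_mono hRr.2.1 _)
  · exact h₀ _ hRr.1
  · intro k z
    rw [moll_pd _ hf]
    exact h k _ (hRr.2.2 k) z

lemma LocallyIntegrableOn.mul_test {U : Set (E d)} (hU : IsOpen U) {g φ : E d → ℝ}
    (hg : LocallyIntegrableOn g U) (hφ : Continuous φ) (hc : HasCompactSupport φ)
    (hs : tsupport φ ⊆ U) : IntegrableOn (fun z => g z * φ z) U := by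
  have : IntegrableOn (fun z => g z * φ z) (tsupport φ) :=
    (hg.integrableOn_compact_subset hs hc).mul_continuousOn hφ.continuousOn hc
  exact this.of_forall_sdiff_eq_zero hU.measurableSet fun x hx => by
    rw [image_eq_zero_of_notMem_tsupport hx.2, mul_zero]

/-- The fundamental lemma of the calculus of variations applied to the difference. -/
lemma HasWeakPartial.unique {U : Set (E d)} (hU : IsOpen U) {k : Fin (d + 1)} {w g₁ g₂ : E d → ℝ}
    (h₁ : HasWeakPartial U k w g₁) (h₂ : HasWeakPartial U k w g₂) :
    g₁ =ᵐ[volume.restrict U] g₂ := by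
  have key : ∀ᵐ x ∂(volume : Measure (E d)), x ∈ U → (g₁ - g₂) x = 0 := by
    refine hU.ae_eq_zero_of_integral_contDiff_smul_eq_zero (h₁.2.1.sub h₂.2.1) fun φ hφ hc hs => ?_
    have hi : ∀ {g : E d → ℝ}, LocallyIntegrableOn g U → IntegrableOn (fun z => g z * φ z) U :=
      fun hg => LocallyIntegrableOn.mul_test hU hg hφ.continuous hc hs
    have e := (h₁.2.2 φ hφ hc hs).symm.trans (h₂.2.2 φ hφ hc hs)
    rw [neg_inj] at e
    have e2 : ∫ x, φ x • (g₁ - g₂) x = ∫ x in U, (g₁ x * φ x - g₂ x * φ x) := by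
      rw [setIntegral_eq_integral_of_forall_compl_eq_zero]
      · congr 1; ext x; simp; ring
      · intro x hx
        rw [image_eq_zero_of_notMem_tsupport (fun h => hx (hs h))]; simp
    rw [e2, integral_sub (hi h₁.2.1) (hi h₂.2.1), e, sub_self]
  rw [Filter.EventuallyEq, ae_restrict_iff' hU.measurableSet]
  filter_upwards [key] with x hx hxU
  simpa [sub_eq_zero] using hx hxU

lemma HasWeakPartial.weakPartial {U : Set (E d)} {k : Fin (d + 1)} {w g : E d → ℝ}
    (h : HasWeakPartial U k w g) : HasWeakPartial U k w (weakPartial U k w) := by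
  have h' : ∃ g, HasWeakPartial U k w g := ⟨g, h⟩
  rw [SpaceTimeDG.weakPartial, dif_pos h']; exact h'.choose_spec

lemma HasWeakPartial.ae_eq {U : Set (E d)} (hU : IsOpen U) {k : Fin (d + 1)} {w g : E d → ℝ}
    (h : HasWeakPartial U k w g) : SpaceTimeDG.weakPartial U k w =ᵐ[volume.restrict U] g :=
  h.weakPartial.unique hU h

lemma LocallyIntegrableOn.congr_ae' {U : Set (E d)} {f g : E d → ℝ}
    (hf : LocallyIntegrableOn f U) (h : f =ᵐ[volume.restrict U] g) (hU : IsOpen U) :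
    LocallyIntegrableOn g U := by
  rw [locallyIntegrableOn_iff hU.isLocallyClosed] at hf ⊢
  intro K hK hc
  exact (hf K hK hc).congr (ae_restrict_of_ae_restrict_of_subset hK h)

lemma HasWeakPartial.congr {U : Set (E d)} (hU : IsOpen U) {k : Fin (d + 1)} {w w' g g' : E d → ℝ}
    (h : HasWeakPartial U k w g) (hw : w =ᵐ[volume.restrict U] w')
    (hg : g =ᵐ[volume.restrict U] g') : HasWeakPartial U k w' g' := by
  refine ⟨LocallyIntegrableOn.congr_ae' h.1 hw hU, LocallyIntegrableOn.congr_ae' h.2.1 hg hU,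
    fun φ hφ hc hs => ?_⟩
  have e1 : ∫ z in U, w' z * pd k φ z = ∫ z in U, w z * pd k φ z :=
    integral_congr_ae (hw.symm.mul (ae_eq_refl (pd k φ)))
  have e2 : ∫ z in U, g' z * φ z = ∫ z in U, g z * φ z :=
    integral_congr_ae (hg.symm.mul (ae_eq_refl φ))
  rw [e1, e2]
  exact h.2.2 φ hφ hc hs

lemma HasWeakPartial.mono {U V : Set (E d)} (hVU : V ⊆ U)
    {k : Fin (d + 1)} {w g : E d → ℝ} (h : HasWeakPartial U k w g) : HasWeakPartial V k w g := by
  refine ⟨h.1.mono_set hVU, h.2.1.mono_set hVU, fun φ hφ hc hs => ?_⟩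
  have e := h.2.2 φ hφ hc (hs.trans hVU)
  have e1 : ∀ {W : Set (E d)} (a ψ : E d → ℝ), tsupport ψ ⊆ W →
      ∫ z in W, a z * ψ z = ∫ z, a z * ψ z := fun {W} a ψ hW =>
    setIntegral_eq_integral_of_forall_compl_eq_zero fun x hx => by
      rw [image_eq_zero_of_notMem_tsupport (fun h => hx (hW h)), mul_zero]
  have hp := (tsupport_pd_subset φ k).trans hs
  rw [e1 w _ (hp.trans hVU), e1 g _ (hs.trans hVU)] at e
  rw [e1 w _ hp, e1 g _ hs, e]

lemma HasWeakPartial.add {U : Set (E d)} (hU : IsOpen U) {k : Fin (d + 1)} {w w' g g' : E d → ℝ}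
    (h : HasWeakPartial U k w g) (h' : HasWeakPartial U k w' g') :
    HasWeakPartial U k (w + w') (g + g') := by
  refine ⟨h.1.add h'.1, h.2.1.add h'.2.1, fun φ hφ hc hs => ?_⟩
  have hp := pd_continuous (hφ.of_le (by simp)) k
  have hpc := pd_hasCompactSupport hc k
  have hps := (tsupport_pd_subset φ k).trans hs
  simp only [Pi.add_apply, add_mul]
  rw [integral_add (LocallyIntegrableOn.mul_test hU h.1 hp hpc hps)
      (LocallyIntegrableOn.mul_test hU h'.1 hp hpc hps),
    integral_add (LocallyIntegrableOn.mul_test hU h.2.1 hφ.continuous hc hs)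
      (LocallyIntegrableOn.mul_test hU h'.2.1 hφ.continuous hc hs),
    h.2.2 φ hφ hc hs, h'.2.2 φ hφ hc hs, neg_add]

lemma HasWeakPartial.smul {U : Set (E d)} {k : Fin (d + 1)} {w g : E d → ℝ} (c : ℝ)
    (h : HasWeakPartial U k w g) : HasWeakPartial U k (c • w) (c • g) := by
  refine ⟨h.1.smul c, h.2.1.smul c, fun φ hφ hc hs => ?_⟩
  simp only [Pi.smul_apply, smul_eq_mul, mul_assoc, integral_const_mul, h.2.2 φ hφ hc hs, mul_neg]

/-- The defining identity of a weak derivative holds for `C¹` test functions. -/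
lemma HasWeakPartial.integral_mul_pd {U : Set (E d)} (hU : IsOpen U) {k : Fin (d + 1)}
    {w g : E d → ℝ} (h : HasWeakPartial U k w g) {φ : E d → ℝ} (hφ : ContDiff ℝ 1 φ)
    (hc : HasCompactSupport φ) (hs : tsupport φ ⊆ U) :
    ∫ z in U, w z * pd k φ z = -∫ z in U, g z * φ z := by
  -- All smooth approximants of `φ` will be supported in one compact thickening inside `U`. There
  -- `w` and `g` are integrable, so uniform convergence of the approximants and their derivatives
  -- suffices.
  obtain ⟨δ, hδ, hδU⟩ := hc.exists_cthickening_subset_open hU hs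
  have hK : IsCompact (Metric.cthickening δ (tsupport φ)) := hc.cthickening
  set K := Metric.cthickening δ (tsupport φ) with hKdef
  have hex : ∀ n : ℕ, ∃ ψ : E d → ℝ, ContDiff ℝ ∞ ψ ∧ tsupport ψ ⊆ K ∧
      (∀ z, |ψ z - φ z| ≤ δ / (n + 1)) ∧ ∀ k z, |pd k ψ z - pd k φ z| ≤ δ / (n + 1) := by
    intro n
    obtain ⟨ψ, h1, h2, h3, h4⟩ := exists_smooth_approx hφ hc (ε := δ / (n + 1)) (by positivity)
    refine ⟨ψ, h1, h2.trans (Metric.cthickening_mono ?_ _), h3, h4⟩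
    exact div_le_self hδ.le (by linarith [(Nat.cast_nonneg n : (0 : ℝ) ≤ n)])
  choose ψ h1 h2 h3 h4 using hex
  have hψc : ∀ n, HasCompactSupport (ψ n) := fun n => hK.of_isClosed_subset (isClosed_tsupport _) (h2 n)
  have hlim : Tendsto (fun n : ℕ => δ / ((n : ℝ) + 1)) atTop (𝓝 0) :=
    tendsto_const_nhds.div_atTop (tendsto_atTop_add_const_right _ _ tendsto_natCast_atTop_atTop)
  have hφK : tsupport φ ⊆ K := Metric.self_subset_cthickening _
  have key : ∀ (a : E d → ℝ) (α : ℕ → E d → ℝ) (β : E d → ℝ), LocallyIntegrableOn a U →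
      (∀ n, Continuous (α n)) → Continuous β → (∀ n, tsupport (α n) ⊆ K) → tsupport β ⊆ K →
      (∀ n z, |α n z - β z| ≤ δ / (n + 1)) →
      Tendsto (fun n => ∫ z in U, a z * α n z) atTop (𝓝 (∫ z in U, a z * β z)) := by
    intro a α β ha hα hβ hαK hβK hαβ
    have e1 : ∀ ψ : E d → ℝ, tsupport ψ ⊆ K → ∫ z in U, a z * ψ z = ∫ z in K, a z * ψ z := by
      intro ψ hψ
      have z0 : ∀ {W : Set (E d)}, tsupport ψ ⊆ W →
          ∫ z in W, a z * ψ z = ∫ z, a z * ψ z := fun {W} hW =>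
        setIntegral_eq_integral_of_forall_compl_eq_zero fun x hx => by
          rw [image_eq_zero_of_notMem_tsupport (fun h => hx (hW h)), mul_zero]
      rw [z0 hψ, z0 (hψ.trans hδU)]
    have haK : IntegrableOn a K := ha.integrableOn_compact_subset hδU hK
    have hi : ∀ {ψ : E d → ℝ}, Continuous ψ → IntegrableOn (fun z => a z * ψ z) K := fun hψ =>
      haK.mul_continuousOn hψ.continuousOn hK
    rw [e1 β hβK, tendsto_iff_dist_tendsto_zero]
    have hb : ∀ n : ℕ, dist (∫ z in U, a z * α n z) (∫ z in K, a z * β z)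
        ≤ δ / (n + 1) * ∫ z in K, |a z| := by
      intro n
      rw [e1 _ (hαK n), dist_eq_norm, ← integral_sub (hi (hα n)) (hi hβ), ← integral_const_mul]
      refine norm_integral_le_of_norm_le (haK.abs.const_mul _) (Eventually.of_forall fun z => ?_)
      rw [← mul_sub, Real.norm_eq_abs, abs_mul, mul_comm]
      gcongr; exact hαβ n z
    refine squeeze_zero (fun _ => dist_nonneg) hb ?_
    simpa using hlim.mul_const (∫ z in K, |a z|)
  have l1 := key w (fun n => pd k (ψ n)) (pd k φ) h.1
    (fun n => pd_continuous ((h1 n).of_le (by simp)) k)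
    (pd_continuous hφ k) (fun n => (tsupport_pd_subset _ k).trans (h2 n))
    ((tsupport_pd_subset _ k).trans hφK) (fun n z => h4 n k z)
  have l2 := key g ψ φ h.2.1 (fun n => (h1 n).continuous) hφ.continuous h2 hφK h3
  refine tendsto_nhds_unique (l1.congr fun n => ?_) l2.neg
  exact h.2.2 (ψ n) (h1 n) (hψc n) ((h2 n).trans hδU)

/-- Product rule for a weak derivative and a `C¹` factor. -/
lemma HasWeakPartial.mul_contDiff {U : Set (E d)} (hU : IsOpen U) {k : Fin (d + 1)}
    {w g : E d → ℝ} (h : HasWeakPartial U k w g) {ψ : E d → ℝ} (hψ : ContDiff ℝ 1 ψ) :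
    HasWeakPartial U k (fun z => w z * ψ z) (fun z => g z * ψ z + w z * pd k ψ z) := by
  have hli : ∀ {a ψ : E d → ℝ}, LocallyIntegrableOn a U → Continuous ψ →
      LocallyIntegrableOn (fun z => a z * ψ z) U := by
    intro a ψ ha hψ
    rw [locallyIntegrableOn_iff hU.isLocallyClosed] at ha ⊢
    exact fun K hK hc => (ha K hK hc).mul_continuousOn hψ.continuousOn hc
  have h1 := hli h.1 hψ.continuous
  have h2 := hli h.2.1 hψ.continuous
  have h3 := hli h.1 (pd_continuous hψ k)
  refine ⟨h1, h2.add h3, fun φ hφ hc hs => ?_⟩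
  have hφ1 : ContDiff ℝ 1 φ := hφ.of_le (by simp)
  -- The function to test with is `ψ φ`, which is only `C¹`; this is why the weak identity had to be
  -- extended beyond smooth test functions.
  have e := h.integral_mul_pd hU (φ := fun z => ψ z * φ z) (hψ.mul hφ1) hc.mul_left
    ((tsupport_mul_subset_right).trans hs)
  have e1 : ∀ z, w z * pd k (fun z => ψ z * φ z) z
      = w z * ψ z * pd k φ z + w z * pd k ψ z * φ z := fun z => by
    rw [pd_mul (hψ.differentiable (by simp) z) (hφ1.differentiable (by simp) z)]; ring
  have i1 := LocallyIntegrableOn.mul_test hU h1 (pd_continuous hφ1 k) (pd_hasCompactSupport hc k)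
    ((tsupport_pd_subset φ k).trans hs)
  have i2 := LocallyIntegrableOn.mul_test hU h2 hφ.continuous hc hs
  have i3 := LocallyIntegrableOn.mul_test hU h3 hφ.continuous hc hs
  simp only [e1, add_mul, ← mul_assoc] at e ⊢
  rw [integral_add i1 i3] at e
  rw [integral_add i2 i3]
  linarith

/-! ### The area formula for `C¹` parametrised hypersurfaces -/

/-- The hypothesis says that `f ∘ g⁻¹` is well defined and `K`-Lipschitz on `g '' A`. With `f`, `g`
a map and its derivative, in either order, it compares a curved image with a flat one. -/
lemma hausdorff_image_le_of_dist_le {X Y Z : Type*} [MetricSpace X] [MeasurableSpace X]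
    [BorelSpace X] [MetricSpace Y] [MeasurableSpace Y] [BorelSpace Y] {f : Z → X} {g : Z → Y}
    {A : Set Z} {K : NNReal} (n : ℕ)
    (h : ∀ a ∈ A, ∀ b ∈ A, dist (f a) (f b) ≤ K * dist (g a) (g b)) :
    Measure.euclideanHausdorffMeasure n (f '' A)
      ≤ (K : ℝ≥0∞) ^ n * Measure.euclideanHausdorffMeasure n (g '' A) := by
  rcases A.eq_empty_or_nonempty with rfl | ⟨a₀, ha₀⟩
  · simp
  have : Nonempty Z := ⟨a₀⟩
  set F : Y → X := fun y => f (Function.invFunOn g A y)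
  have hF : f '' A ⊆ F '' (g '' A) := by
    rintro _ ⟨a, ha, rfl⟩
    refine ⟨g a, ⟨a, ha, rfl⟩, ?_⟩
    have hm : Function.invFunOn g A (g a) ∈ A := Function.invFunOn_mem ⟨a, ha, rfl⟩
    have he : g (Function.invFunOn g A (g a)) = g a := Function.invFunOn_eq ⟨a, ha, rfl⟩
    have := h _ hm a ha
    rw [he, dist_self, mul_zero] at this
    exact dist_le_zero.1 this
  have hL : LipschitzOnWith K F (g '' A) := by
    refine LipschitzOnWith.of_dist_le_mul ?_
    rintro _ ⟨a, ha, rfl⟩ _ ⟨b, hb, rfl⟩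
    have hma : Function.invFunOn g A (g a) ∈ A := Function.invFunOn_mem ⟨a, ha, rfl⟩
    have hea : g (Function.invFunOn g A (g a)) = g a := Function.invFunOn_eq ⟨a, ha, rfl⟩
    have hmb : Function.invFunOn g A (g b) ∈ A := Function.invFunOn_mem ⟨b, hb, rfl⟩
    have heb : g (Function.invFunOn g A (g b)) = g b := Function.invFunOn_eq ⟨b, hb, rfl⟩
    have := h _ hma _ hmb
    rwa [hea, heb] at this
  refine (measure_mono hF).trans ?_
  have := hL.hausdorffMeasure_image_le (d := n) (by positivity)
  simp only [Measure.euclideanHausdorffMeasure_def, Measure.smul_apply, ENNReal.smul_def,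
    smul_eq_mul]
  rw [ENNReal.rpow_natCast] at this
  calc _ ≤ _ := mul_le_mul_right this _
    _ = _ := by ring

variable {m : ℕ}

/-- Local form of the area formula, up to a factor `c > 1`. -/
lemma area_local {ψ : EuclideanSpace ℝ (Fin m) → E d} {J : EuclideanSpace ℝ (Fin m) → ℝ}
    {y₀ : EuclideanSpace ℝ (Fin m)}
    {L : EuclideanSpace ℝ (Fin m) →L[ℝ] E d} (hψ : HasStrictFDerivAt ψ L y₀)
    (hL : Function.Injective L) (hJ : ContinuousAt J y₀) (hJ0 : 0 < J y₀)
    (hJL : J y₀ = (L : EuclideanSpace ℝ (Fin m) →ₗ[ℝ] E d).normDet)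
    {c : NNReal} (hc : 1 < c) :
    ∃ V, IsOpen V ∧ y₀ ∈ V ∧ ∀ A ⊆ V, MeasurableSet A →
      Measure.euclideanHausdorffMeasure m (ψ '' A) ≤ c * ∫⁻ y in A, ENNReal.ofReal (J y) ∧
      ∫⁻ y in A, ENNReal.ofReal (J y) ≤ c * Measure.euclideanHausdorffMeasure m (ψ '' A) := by
  obtain ⟨K, hK, hKL⟩ : ∃ K > 0, AntilipschitzWith K L :=
    (L : EuclideanSpace ℝ (Fin m) →ₗ[ℝ] E d).exists_antilipschitzWith (LinearMap.ker_eq_bot.2 hL)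
  -- One factor `1 + ε` pays for the oscillation of `J`; the `m`-th powers of `1 + ε` and `(1 -
  -- ε)⁻¹` pay for the distortion of distances between `ψ` and its linearisation, in the two
  -- directions.
  obtain ⟨ε, hε0, hε1, hεc, hεc'⟩ : ∃ ε : ℝ, 0 < ε ∧ ε < 1 ∧ (1 + ε) ^ (m + 1) ≤ c ∧
      ((1 - ε)⁻¹) ^ m * (1 + ε) ≤ c := by
    have t1 : Tendsto (fun ε : ℝ => (1 + ε) ^ (m + 1)) (𝓝[>] 0) (𝓝 ((1 + 0) ^ (m + 1))) :=
      (Continuous.tendsto (by fun_prop) 0).mono_left nhdsWithin_le_nhds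
    have t2 : Tendsto (fun ε : ℝ => ((1 - ε)⁻¹) ^ m * (1 + ε)) (𝓝[>] 0)
        (𝓝 (((1 - 0)⁻¹) ^ m * (1 + 0))) := by
      refine Tendsto.mono_left ?_ nhdsWithin_le_nhds
      refine ((((continuous_const.sub continuous_id).tendsto 0).inv₀ (by simp)).pow m).mul ?_
      exact Continuous.tendsto (by fun_prop) 0
    have hc' : (1 : ℝ) < c := by exact_mod_cast hc
    obtain ⟨ε, h1, h2, h3, h4⟩ := ((t1.eventually_lt_const (by simpa only [add_zero, one_pow, sub_zero, inv_one, one_mul] using hc')).and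
      ((t2.eventually_lt_const (by simpa only [add_zero, one_pow, sub_zero, inv_one, one_mul] using hc')).and
      ((eventually_mem_nhdsWithin (a := (0 : ℝ)) (s := Set.Ioi 0)).and ((eventually_lt_nhds zero_lt_one).filter_mono
        nhdsWithin_le_nhds)))).exists
    exact ⟨ε, h3, h4, h1.le, h2.le⟩
  set ε' : NNReal := ⟨ε, hε0.le⟩ with hε'
  -- Dividing by the antilipschitz constant of `L` turns the linearisation error into at most `ε`
  -- times the distance of the images under `L`.
  obtain ⟨V₁, hV₁, hV₁L⟩ := hψ.approximates_deriv_on_nhds (c := ε' / K)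
    (Or.inr (div_pos (by exact_mod_cast hε0) hK))
  have hV₂ : ∀ᶠ y in 𝓝 y₀, J y < (1 + ε) * J y₀ ∧ J y₀ / (1 + ε) < J y :=
    (hJ.eventually_lt_const (by nlinarith)).and
      (hJ.eventually_const_lt (by rw [div_lt_iff₀ (by positivity)]; nlinarith))
  obtain ⟨V, hVs, hVo, hyV⟩ := mem_nhds_iff.1 (inter_mem hV₁ hV₂)
  refine ⟨V, hVo, hyV, fun A hA hAm => ?_⟩
  have hd : ∀ a ∈ A, ∀ b ∈ A, ‖ψ a - ψ b - L (a - b)‖ ≤ ε * dist (L a) (L b) := by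
    intro a ha b hb
    refine (hV₁L a (hVs (hA ha)).1 b (hVs (hA hb)).1).trans ?_
    have h1 := hKL.le_mul_dist a b
    rw [dist_eq_norm] at h1
    have hKpos : (0 : ℝ) < K := hK
    calc ((ε' / K : NNReal) : ℝ) * ‖a - b‖ ≤ (ε / K) * (K * dist (L a) (L b)) := by
          push_cast [hε']
          exact mul_le_mul_of_nonneg_left h1 (by positivity)
      _ = ε * dist (L a) (L b) := by field_simp
  have hvol : Measure.euclideanHausdorffMeasure m (L '' A) = ENNReal.ofReal (J y₀) * volume A := by
    have := (L : EuclideanSpace ℝ (Fin m) →ₗ[ℝ] E d).euclideanHausdorffMeasure_image_eq_normDet_mul_volume A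
    rw [finrank_euclideanSpace_fin, ← hJL] at this
    exact this
  have h1 : Measure.euclideanHausdorffMeasure m (ψ '' A)
      ≤ ((1 + ε' : NNReal) : ℝ≥0∞) ^ m * (ENNReal.ofReal (J y₀) * volume A) := by
    rw [← hvol]
    refine hausdorff_image_le_of_dist_le m fun a ha b hb => ?_
    have := hd a ha b hb
    have t : ‖ψ a - ψ b‖ ≤ ‖ψ a - ψ b - L (a - b)‖ + ‖L (a - b)‖ := by
      simpa using norm_add_le (ψ a - ψ b - L (a - b)) (L (a - b))
    rw [map_sub, ← dist_eq_norm, ← dist_eq_norm (L a)] at t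
    rw [map_sub] at this
    push_cast [hε']; change _ ≤ (1 + ε) * _; linarith
  set η : NNReal := ⟨(1 - ε)⁻¹, inv_nonneg.2 (by linarith)⟩ with hη
  have h2 : ENNReal.ofReal (J y₀) * volume A
      ≤ (η : ℝ≥0∞) ^ m *
        Measure.euclideanHausdorffMeasure m (ψ '' A) := by
    rw [← hvol]
    refine hausdorff_image_le_of_dist_le m fun a ha b hb => ?_
    have := hd a ha b hb
    have t : ‖L (a - b)‖ ≤ ‖ψ a - ψ b - L (a - b)‖ + ‖ψ a - ψ b‖ := by
      rw [← norm_neg (ψ a - ψ b - L (a - b))]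
      simpa using norm_add_le (-(ψ a - ψ b - L (a - b))) (ψ a - ψ b)
    rw [map_sub, ← dist_eq_norm, ← dist_eq_norm (ψ a)] at t
    rw [map_sub] at this
    have h0 : 0 < 1 - ε := by linarith
    change _ ≤ (1 - ε)⁻¹ * _
    rw [inv_mul_eq_div, le_div_iff₀ h0]; linarith
  have hJA : ∀ y ∈ A, ENNReal.ofReal (J y) ≤ ENNReal.ofReal (1 + ε) * ENNReal.ofReal (J y₀) ∧
      ENNReal.ofReal (J y₀) ≤ ENNReal.ofReal (1 + ε) * ENNReal.ofReal (J y) := by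
    intro y hy
    have := (hVs (hA hy)).2
    rw [← ENNReal.ofReal_mul (by positivity), ← ENNReal.ofReal_mul (by positivity)]
    refine ⟨ENNReal.ofReal_le_ofReal this.1.le, ENNReal.ofReal_le_ofReal ?_⟩
    have := this.2; rw [div_lt_iff₀ (by positivity)] at this; linarith
  have h3 : ∫⁻ y in A, ENNReal.ofReal (J y)
      ≤ ENNReal.ofReal (1 + ε) * (ENNReal.ofReal (J y₀) * volume A) := by
    rw [← mul_assoc, ← setLIntegral_const]
    exact setLIntegral_mono' hAm fun y hy => (hJA y hy).1
  have h4 : ENNReal.ofReal (J y₀) * volume A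
      ≤ ENNReal.ofReal (1 + ε) * ∫⁻ y in A, ENNReal.ofReal (J y) := by
    rw [← setLIntegral_const, ← lintegral_const_mul' _ _ ENNReal.ofReal_ne_top]
    exact setLIntegral_mono' hAm fun y hy => (hJA y hy).2
  have e1 : ENNReal.ofReal (1 + ε) = ((1 + ε' : NNReal) : ℝ≥0∞) := by
    rw [ENNReal.ofReal, ENNReal.coe_inj]; ext; push_cast [hε']
    rw [Real.coe_toNNReal _ (by positivity)]; rfl
  rw [e1] at h3 h4
  constructor
  · refine h1.trans ((mul_le_mul_right h4 _).trans ?_)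
    rw [← mul_assoc, ← pow_succ]
    gcongr
    rw [← ENNReal.coe_pow, ENNReal.coe_le_coe, ← NNReal.coe_le_coe]
    push_cast [hε']; exact hεc
  · refine h3.trans ((mul_le_mul_right h2 _).trans ?_)
    rw [← mul_assoc]
    gcongr
    rw [← ENNReal.coe_pow, ← ENNReal.coe_mul, ENNReal.coe_le_coe, ← NNReal.coe_le_coe]
    push_cast [hε', hη]; rw [mul_comm]; exact hεc'

/-- The area formula for injective `C¹` maps from `ℝᵐ`. -/
theorem area_formula {ψ : EuclideanSpace ℝ (Fin m) → E d} {J : EuclideanSpace ℝ (Fin m) → ℝ}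
    {S : Set (EuclideanSpace ℝ (Fin m))} (hψ : ContDiff ℝ 1 ψ) (hinj : Set.InjOn ψ S)
    (hL : ∀ y ∈ S, Function.Injective (fderiv ℝ ψ y)) (hJ : Continuous J)
    (hJL : ∀ y ∈ S, J y = (fderiv ℝ ψ y : EuclideanSpace ℝ (Fin m) →ₗ[ℝ] E d).normDet)
    (hS : MeasurableSet S) :
    Measure.euclideanHausdorffMeasure m (ψ '' S) = ∫⁻ y in S, ENNReal.ofReal (J y) := by
  have hpos : ∀ y ∈ S, 0 < J y := by
    intro y hy
    rw [hJL y hy]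
    refine lt_of_le_of_ne (LinearMap.normDet_nonneg _) (Ne.symm ?_)
    rw [Ne, LinearMap.normDet_eq_zero_iff_ker_ne_bot, not_not]
    exact LinearMap.ker_eq_bot.2 (hL y hy)
  have main : ∀ c : NNReal, 1 < c →
      Measure.euclideanHausdorffMeasure m (ψ '' S) ≤ c * ∫⁻ y in S, ENNReal.ofReal (J y) ∧
      ∫⁻ y in S, ENNReal.ofReal (J y) ≤ c * Measure.euclideanHausdorffMeasure m (ψ '' S) := by
    intro c hc
    -- The local estimate holds near each point with the same factor `c`. A countable subcover made
    -- disjoint lets it be summed, injectivity keeping the images disjoint.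
    choose! V hVo hyV hV using fun y (hy : y ∈ S) =>
      area_local (hψ.hasStrictFDerivAt (x := y) (by simp)) (hL y hy)
        hJ.continuousAt (hpos y hy) (hJL y hy) hc
    obtain ⟨T, hTS, hTc, hT⟩ := TopologicalSpace.countable_cover_nhdsWithin
      (f := V) (s := S) fun y hy => mem_nhdsWithin_of_mem_nhds ((hVo y hy).mem_nhds (hyV y hy))
    rcases S.eq_empty_or_nonempty with rfl | hne
    · simp
    have hTne : T.Nonempty := by
      by_contra h
      rw [Set.not_nonempty_iff_eq_empty] at h
      obtain ⟨y, hy⟩ := hne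
      have := hT hy
      simp [h] at this
    obtain ⟨t, ht⟩ := hTc.exists_eq_range hTne
    set W : ℕ → Set (EuclideanSpace ℝ (Fin m)) := fun n => S ∩ disjointed (fun n => V (t n)) n
    have htS : ∀ n, t n ∈ S := fun n => hTS (ht ▸ Set.mem_range_self n)
    have hWm : ∀ n, MeasurableSet (W n) := fun n =>
      hS.inter (MeasurableSet.disjointed (fun n => (hVo _ (htS n)).measurableSet) n)
    have hWV : ∀ n, W n ⊆ V (t n) := fun n => Set.inter_subset_right.trans (disjointed_subset _ n)
    have hWd : Pairwise (Function.onFun Disjoint W) := fun i j hij =>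
      ((disjoint_disjointed _) hij).mono Set.inter_subset_right Set.inter_subset_right
    have hWU : ⋃ n, W n = S := by
      rw [← Set.inter_iUnion, iUnion_disjointed]
      refine Set.inter_eq_left.2 (hT.trans ?_)
      rw [ht, Set.biUnion_range]
    have i1 : ∫⁻ y in S, ENNReal.ofReal (J y) = ∑' n, ∫⁻ y in W n, ENNReal.ofReal (J y) := by
      rw [← hWU, lintegral_iUnion hWm hWd]
    have i2 : Measure.euclideanHausdorffMeasure m (ψ '' S)
        = ∑' n, Measure.euclideanHausdorffMeasure m (ψ '' W n) := by
      rw [← measure_iUnion, ← Set.image_iUnion, hWU]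
      · intro i j hij
        refine Set.disjoint_image_image fun a ha b hb hab => ?_
        have := hinj ha.1 hb.1 hab
        exact Set.disjoint_left.1 (hWd hij) ha (this ▸ hb)
      · intro n
        exact (hWm n).image_of_continuousOn_injOn hψ.continuous.continuousOn
          (hinj.mono Set.inter_subset_left)
    rw [i1, i2, ← ENNReal.tsum_mul_left, ← ENNReal.tsum_mul_left]
    exact ⟨ENNReal.tsum_le_tsum fun n => (hV _ (htS n) _ (hWV n) (hWm n)).1,
      ENNReal.tsum_le_tsum fun n => (hV _ (htS n) _ (hWV n) (hWm n)).2⟩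
  -- Letting `c` decrease to one; multiplication is continuous in `c` only against a finite `b`,
  -- hence the separate infinite case.
  have lim : ∀ a b : ℝ≥0∞, (∀ c : NNReal, 1 < c → a ≤ c * b) → a ≤ b := by
    intro a b h
    rcases eq_or_ne b ⊤ with rfl | hb
    · exact le_top
    have t : Tendsto (fun c : NNReal => (c : ℝ≥0∞) * b) (𝓝[>] 1) (𝓝 (((1 : NNReal) : ℝ≥0∞) * b)) :=
      (ENNReal.Tendsto.mul_const (ENNReal.continuous_coe.tendsto 1) (Or.inr hb)).mono_left
        nhdsWithin_le_nhds
    have := ge_of_tendsto t (eventually_nhdsWithin_of_forall h)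
    simpa using this
  exact le_antisymm (lim _ _ fun c hc => (main c hc).1) (lim _ _ fun c hc => (main c hc).2)

/-! ### Faces of the unit cube -/

/-- The open unit cube in `ℝᵐ`. -/
def ucube (m : ℕ) : Set (EuclideanSpace ℝ (Fin m)) := {y | ∀ i, 0 < y i ∧ y i < 1}

/-- The closed unit cube in `ℝᵐ`. -/
def ccube (m : ℕ) : Set (EuclideanSpace ℝ (Fin m)) := {y | ∀ i, 0 ≤ y i ∧ y i ≤ 1}

/-- The point with `α`-th coordinate `s` and remaining coordinates `y`. -/
def face (α : Fin (d + 1)) (s : ℝ) (y : EuclideanSpace ℝ (Fin d)) : E d :=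
  WithLp.toLp 2 (α.insertNth (α := fun _ => ℝ) s y.ofLp)

@[simp] lemma face_same (α : Fin (d + 1)) (s : ℝ) (y : EuclideanSpace ℝ (Fin d)) :
    face α s y α = s := by simp [face]

@[simp] lemma face_succAbove (α : Fin (d + 1)) (s : ℝ) (y : EuclideanSpace ℝ (Fin d)) (i : Fin d) :
    face α s y (α.succAbove i) = y i := by simp [face]

/-- The linear part of `face α s`. -/
def faceLin (α : Fin (d + 1)) : EuclideanSpace ℝ (Fin d) →L[ℝ] E d :=
  LinearMap.toContinuousLinearMap
    { toFun := face α 0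
      map_add' := fun x y => by
        ext k; refine Fin.succAboveCases α ?_ (fun i => ?_) k <;> simp
      map_smul' := fun c y => by
        ext k; refine Fin.succAboveCases α ?_ (fun i => ?_) k <;> simp }

lemma faceLin_apply (α : Fin (d + 1)) (y : EuclideanSpace ℝ (Fin d)) : faceLin α y = face α 0 y := rfl

lemma face_eq (α : Fin (d + 1)) (s : ℝ) (y : EuclideanSpace ℝ (Fin d)) :
    face α s y = s • EuclideanSpace.single α 1 + faceLin α y := by
  ext k; rw [faceLin_apply]
  refine Fin.succAboveCases α ?_ (fun i => ?_) k <;> simp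

lemma faceLin_single (α : Fin (d + 1)) (i : Fin d) :
    faceLin α (EuclideanSpace.single i 1) = EuclideanSpace.single (α.succAbove i) 1 := by
  ext k; rw [faceLin_apply]
  refine Fin.succAboveCases α ?_ (fun j => ?_) k
  · simp
  · simp

lemma faceLin_injective (α : Fin (d + 1)) : Function.Injective (faceLin α) := by
  intro x y h
  ext i
  have := congrArg (fun z : E d => z (α.succAbove i)) h
  simpa [faceLin_apply] using this

lemma contDiff_face {n : WithTop ℕ∞} (α : Fin (d + 1)) (s : ℝ) : ContDiff ℝ n (face α s) := by
  have : face α s = fun y => s • EuclideanSpace.single α 1 + faceLin α y := funext (face_eq α s)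
  rw [this]; exact contDiff_const.add (faceLin α).contDiff

lemma continuous_face_uncurry (α : Fin (d + 1)) :
    Continuous fun p : ℝ × EuclideanSpace ℝ (Fin d) => face α p.1 p.2 := by
  simp only [face_eq]; fun_prop

lemma hasFDerivAt_face (α : Fin (d + 1)) (s : ℝ) (y : EuclideanSpace ℝ (Fin d)) :
    HasFDerivAt (face α s) (faceLin α) y := by
  have : face α s = fun y => s • EuclideanSpace.single α 1 + faceLin α y := funext (face_eq α s)
  rw [this]; exact (faceLin α).hasFDerivAt.const_add _

lemma face_mem_openCube {α : Fin (d + 1)} {s : ℝ} {y : EuclideanSpace ℝ (Fin d)} :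
    face α s y ∈ openCube d ↔ s ∈ Set.Ioo (0 : ℝ) 1 ∧ y ∈ ucube d := by
  simp [openCube, ucube, Fin.forall_iff_succAbove α]

lemma face_mem_closedCube {α : Fin (d + 1)} {s : ℝ} {y : EuclideanSpace ℝ (Fin d)} :
    face α s y ∈ closedCube d ↔ s ∈ Set.Icc (0 : ℝ) 1 ∧ y ∈ ccube d := by
  simp [closedCube, ccube, Fin.forall_iff_succAbove α]

lemma isOpen_ucube (m : ℕ) : IsOpen (ucube m) := by
  simp only [ucube, Set.ofPred_forall]
  refine isOpen_iInter_of_finite fun i => ?_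
  have hc : Continuous fun y : EuclideanSpace ℝ (Fin m) => y i := by fun_prop
  exact (isOpen_lt continuous_const hc).and (isOpen_lt hc continuous_const)

lemma isOpen_openCube (d : ℕ) : IsOpen (openCube d) := isOpen_ucube (d + 1)

lemma isClosed_ccube (m : ℕ) : IsClosed (ccube m) := by
  simp only [ccube, Set.ofPred_forall]
  refine isClosed_iInter fun i => ?_
  have hc : Continuous fun y : EuclideanSpace ℝ (Fin m) => y i := by fun_prop
  exact (isClosed_le continuous_const hc).inter (isClosed_le hc continuous_const)

lemma isCompact_ccube (m : ℕ) : IsCompact (ccube m) := by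
  refine Metric.isCompact_of_isClosed_isBounded (isClosed_ccube m) ?_
  refine (Metric.isBounded_iff_subset_closedBall 0).2 ⟨Real.sqrt m, fun y hy => ?_⟩
  rw [mem_closedBall_zero_iff, EuclideanSpace.norm_eq]
  refine Real.sqrt_le_sqrt ?_
  calc ∑ i, ‖y i‖ ^ 2 ≤ ∑ i : Fin m, (1 : ℝ) := Finset.sum_le_sum fun i _ => by
        rw [Real.norm_eq_abs, sq_abs]; nlinarith [hy i]
    _ = m := by simp

lemma isCompact_closedCube (d : ℕ) : IsCompact (closedCube d) := isCompact_ccube (d + 1)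

lemma ucube_subset_ccube (m : ℕ) : ucube m ⊆ ccube m := fun _ h i => ⟨(h i).1.le, (h i).2.le⟩

lemma openCube_subset_closedCube (d : ℕ) : openCube d ⊆ closedCube d := ucube_subset_ccube (d + 1)

lemma volume_ucube_lt_top (m : ℕ) : volume (ucube m) < ⊤ :=
  (measure_mono (ucube_subset_ccube m)).trans_lt (isCompact_ccube m).measure_lt_top

/-- The closed cube differs from the open cube by a null set. -/
lemma volume_ccube_diff_ucube (m : ℕ) : volume (ccube m \ ucube m) = 0 := by
  have h1 : ucube m = (@WithLp.ofLp 2 (Fin m → ℝ)) ⁻¹' (Set.univ.pi fun _ => Set.Ioo (0 : ℝ) 1) := by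
    ext y; simp [ucube]
  have h2 : ccube m = (@WithLp.ofLp 2 (Fin m → ℝ)) ⁻¹' (Set.univ.pi fun _ => Set.Icc (0 : ℝ) 1) := by
    ext y; simp [ccube, forall_and, Pi.le_def]
  rw [h1, h2, ← Set.preimage_sdiff, (PiLp.volume_preserving_ofLp (Fin m)).measure_preimage]
  · rw [← ae_le_set, volume_pi]
    have := (Measure.univ_pi_Ioo_ae_eq_Icc (μ := fun _ : Fin m => (volume : Measure ℝ))
      (f := fun _ => 0) (g := fun _ => 1)).symm.le
    rwa [← Set.pi_univ_Icc] at this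
  · exact ((MeasurableSet.univ_pi fun _ => measurableSet_Icc).diff
      (MeasurableSet.univ_pi fun _ => measurableSet_Ioo)).nullMeasurableSet

/-! ### Fubini along one coordinate of the cube -/

lemma measurePreserving_face (α : Fin (d + 1)) :
    MeasurePreserving (fun p : ℝ × EuclideanSpace ℝ (Fin d) => face α p.1 p.2) := by
  have h1 := (MeasurePreserving.id (volume : Measure ℝ)).prod (PiLp.volume_preserving_ofLp (Fin d))
  have h2 := (volume_preserving_piFinSuccAbove (fun _ : Fin (d + 1) => ℝ) α).symm
  exact ((PiLp.volume_preserving_toLp (Fin (d + 1))).comp h2).comp h1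

lemma measurableEmbedding_face (α : Fin (d + 1)) :
    MeasurableEmbedding (fun p : ℝ × EuclideanSpace ℝ (Fin d) => face α p.1 p.2) := by
  refine (continuous_face_uncurry α).measurableEmbedding ?_
  rintro ⟨s, y⟩ ⟨s', y'⟩ h
  have h1 := congrArg (fun z : E d => z α) h
  have h2 : y = y' := by
    ext i
    simpa using congrArg (fun z : E d => z (α.succAbove i)) h
  simp only [face_same] at h1
  rw [h1, h2]

lemma face_preimage_openCube (α : Fin (d + 1)) :
    (fun p : ℝ × EuclideanSpace ℝ (Fin d) => face α p.1 p.2) ⁻¹' openCube d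
      = Set.Ioo 0 1 ×ˢ ucube d := by
  ext p; simp only [Set.mem_preimage, face_mem_openCube, Set.mem_prod]

lemma setIntegral_openCube (α : Fin (d + 1)) {f : E d → ℝ} (hf : IntegrableOn f (openCube d)) :
    ∫ ξ in openCube d, f ξ = ∫ y in ucube d, ∫ s in Set.Ioo (0 : ℝ) 1, f (face α s y) := by
  rw [← (measurePreserving_face α).setIntegral_preimage_emb (measurableEmbedding_face α),
    face_preimage_openCube]
  have h2 : IntegrableOn (fun p : ℝ × EuclideanSpace ℝ (Fin d) => f (face α p.1 p.2))
      (Set.Ioo 0 1 ×ˢ ucube d) := by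
    rw [← face_preimage_openCube α]
    exact ((measurePreserving_face α).integrableOn_comp_preimage (measurableEmbedding_face α)).2 hf
  have h3 : (volume : Measure (ℝ × EuclideanSpace ℝ (Fin d))).restrict (Set.Ioo 0 1 ×ˢ ucube d)
      = ((volume.restrict (Set.Ioo (0 : ℝ) 1)).prod (volume.restrict (ucube d))) := by
    rw [Measure.prod_restrict]; rfl
  rw [IntegrableOn, h3] at h2
  rw [h3, integral_prod_symm _ h2]

lemma setLIntegral_openCube (α : Fin (d + 1)) {f : E d → ℝ≥0∞} (hf : Measurable f) :
    ∫⁻ ξ in openCube d, f ξ = ∫⁻ y in ucube d, ∫⁻ s in Set.Ioo (0 : ℝ) 1, f (face α s y) := by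
  rw [← (measurePreserving_face α).setLIntegral_comp_preimage_emb (measurableEmbedding_face α),
    face_preimage_openCube]
  have h3 : (volume : Measure (ℝ × EuclideanSpace ℝ (Fin d))).restrict (Set.Ioo 0 1 ×ˢ ucube d)
      = ((volume.restrict (Set.Ioo (0 : ℝ) 1)).prod (volume.restrict (ucube d))) := by
    rw [Measure.prod_restrict]; rfl
  rw [h3, lintegral_prod_symm]
  exact (hf.comp (continuous_face_uncurry α).measurable).aemeasurable

lemma hasDerivAt_comp_face {G : E d → ℝ} (α : Fin (d + 1)) (s : ℝ) (y : EuclideanSpace ℝ (Fin d))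
    (hG : DifferentiableAt ℝ G (face α s y)) :
    HasDerivAt (fun s => G (face α s y)) (pd α G (face α s y)) s := by
  have h : HasDerivAt (fun s => face α s y) (EuclideanSpace.single α 1) s := by
    simp only [face_eq]
    simpa using ((hasDerivAt_id s).smul_const (EuclideanSpace.single α (1 : ℝ))).add_const
      (faceLin α y)
  exact hG.hasFDerivAt.comp_hasDerivAt s h

/-- The surface element of a parametrised face: if `R` is a left inverse of `L`, then `L` restricted
to the hyperplane orthogonal to the `α`-th coordinate direction scales `d`-dimensional volume by
`|det L| ‖Rᵀ e_α‖`. -/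
lemma normDet_comp_faceLin {L R : E d →L[ℝ] E d} (h : R ∘L L = ContinuousLinearMap.id ℝ (E d))
    (α : Fin (d + 1)) :
    ((L ∘L faceLin α : EuclideanSpace ℝ (Fin d) →L[ℝ] E d) :
        EuclideanSpace ℝ (Fin d) →ₗ[ℝ] E d).normDet
      = |L.det| * Real.sqrt (∑ k, (R (EuclideanSpace.single k 1) α) ^ 2) := by
  set b := EuclideanSpace.basisFun (Fin (d + 1)) ℝ with hb
  set M := LinearMap.toMatrix b.toBasis b.toBasis (L : E d →ₗ[ℝ] E d) with hM
  set N := LinearMap.toMatrix b.toBasis b.toBasis (R : E d →ₗ[ℝ] E d) with hN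
  have hNM : N * M = 1 := by
    rw [hM, hN, ← LinearMap.toMatrix_comp, ← LinearMap.toMatrix_id b.toBasis]
    congr 1
    exact congrArg (fun T : E d →L[ℝ] E d => (T : E d →ₗ[ℝ] E d)) h
  have hdet : L.det = M.det := (LinearMap.det_toMatrix b.toBasis (L : E d →ₗ[ℝ] E d)).symm
  have hMij : ∀ i j, M i j = L (EuclideanSpace.single j 1) i := fun i j => by
    simp [hM, LinearMap.toMatrix_apply, hb]
  have hNij : ∀ i j, N i j = R (EuclideanSpace.single j 1) i := fun i j => by
    simp [hN, LinearMap.toMatrix_apply, hb]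
  have hsq := LinearMap.normDet_sq_eq_det_gram
    ((L ∘L faceLin α : EuclideanSpace ℝ (Fin d) →L[ℝ] E d) : EuclideanSpace ℝ (Fin d) →ₗ[ℝ] E d)
    (EuclideanSpace.basisFun (Fin d) ℝ)
  -- The Gram matrix of the columns of `L` other than the `α`-th is `MᵀM` with row and column `α`
  -- deleted. Its determinant is thus a diagonal entry of the adjugate of `MᵀM`, which equals `(det
  -- M)² N Nᵀ` since `N` is the inverse of `M`; the diagonal entry of `N Nᵀ` is the squared length
  -- of a row of `N`.
  have hgram : Matrix.gram ℝ (fun i => ((L ∘L faceLin α : EuclideanSpace ℝ (Fin d) →L[ℝ] E d) :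
      EuclideanSpace ℝ (Fin d) →ₗ[ℝ] E d) (EuclideanSpace.basisFun (Fin d) ℝ i))
      = (M.transpose * M).submatrix α.succAbove α.succAbove := by
    ext i j
    simp only [Matrix.gram_apply, Matrix.submatrix_apply, Matrix.mul_apply, Matrix.transpose_apply,
      hMij, EuclideanSpace.basisFun_apply, ContinuousLinearMap.coe_coe,
      ContinuousLinearMap.comp_apply, faceLin_single, PiLp.inner_apply]
    exact Finset.sum_congr rfl fun k _ => by simp [mul_comm]
  have hadj := Matrix.adjugate_fin_succ_eq_det_submatrix (M.transpose * M) α α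
  have hinv : (M.transpose * M).adjugate = M.det ^ 2 • (N * N.transpose) := by
    have h1 : (N * N.transpose) * (M.transpose * M) = 1 := by
      have : M * N = 1 := mul_eq_one_comm.1 hNM
      rw [Matrix.mul_assoc, ← Matrix.mul_assoc N.transpose, ← Matrix.transpose_mul, this,
        Matrix.transpose_one, Matrix.one_mul, hNM]
    have h2 : (M.transpose * M) * (M.transpose * M).adjugate = M.det ^ 2 • 1 := by
      rw [Matrix.mul_adjugate, Matrix.det_mul, Matrix.det_transpose, sq]
    calc (M.transpose * M).adjugate
        = (N * N.transpose) * (M.transpose * M) * (M.transpose * M).adjugate := by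
          rw [h1, Matrix.one_mul]
      _ = _ := by rw [Matrix.mul_assoc, h2, Matrix.mul_smul, Matrix.mul_one]
  rw [hgram] at hsq
  rw [hinv, Even.neg_one_pow ⟨(α : ℕ), rfl⟩, one_mul] at hadj
  rw [← hadj] at hsq
  have hval : (M.det ^ 2 • (N * N.transpose)) α α
      = (|L.det| * Real.sqrt (∑ k, (R (EuclideanSpace.single k 1) α) ^ 2)) ^ 2 := by
    rw [mul_pow, sq_abs, Real.sq_sqrt (Finset.sum_nonneg fun _ _ => sq_nonneg _), hdet]
    simp [Matrix.mul_apply, hNij, sq]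
  rw [hval] at hsq
  exact (sq_eq_sq₀ (LinearMap.normDet_nonneg _) (by positivity)).1 (by exact_mod_cast hsq)

/-! ### Cutoff functions on the unit interval -/

/-- Smooth step from `0` on `(-∞, 1]` to `1` on `[2, ∞)`. -/
def step (x : ℝ) : ℝ := Real.smoothTransition (x - 1)

lemma contDiff_step : ContDiff ℝ 1 step :=
  (Real.smoothTransition.contDiff (n := 1)).comp (contDiff_id.sub contDiff_const)

lemma step_zero {x : ℝ} (h : x ≤ 1) : step x = 0 :=
  Real.smoothTransition.zero_of_nonpos (by linarith)

lemma step_one {x : ℝ} (h : 2 ≤ x) : step x = 1 :=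
  Real.smoothTransition.one_of_one_le (by linarith)

lemma step_mono : Monotone step := fun x y h => Real.smoothTransition.monotone (by linarith)

lemma deriv_step_nonneg (x : ℝ) : 0 ≤ deriv step x := step_mono.deriv_nonneg

lemma deriv_step_eq_zero {x : ℝ} (h : x < 1 ∨ 2 < x) : deriv step x = 0 := by
  rcases h with h | h
  · have : step =ᶠ[𝓝 x] fun _ => 0 := by
      filter_upwards [Iio_mem_nhds h] with y hy using step_zero (le_of_lt hy)
    rw [this.deriv_eq, deriv_const]
  · have : step =ᶠ[𝓝 x] fun _ => 1 := by
      filter_upwards [Ioi_mem_nhds h] with y hy using step_one (le_of_lt hy)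
    rw [this.deriv_eq, deriv_const]

/-- Cutoff function of width `e` on the unit interval. -/
def cutoff (e t : ℝ) : ℝ := step (t / e) - step ((t - 1) / e + 3)

lemma contDiff_cutoff (e : ℝ) : ContDiff ℝ 1 (cutoff e) :=
  (contDiff_step.comp (contDiff_id.div_const e)).sub
    (contDiff_step.comp (((contDiff_id.sub contDiff_const).div_const e).add contDiff_const))

/-- The first ramp occupies `[e, 2e]`, and the shift by `3` places the second on `[1 - 2e, 1 - e]`.
The second argument stays below the first exactly when `3e ≤ 1`. -/
lemma cutoff_mem_Icc {e : ℝ} (he : 0 < e) (he' : e ≤ 1 / 3) (t : ℝ) :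
    cutoff e t ∈ Set.Icc (0 : ℝ) 1 := by
  have h1 : step ((t - 1) / e + 3) ≤ step (t / e) := step_mono (by
    rw [← sub_nonneg]
    have : t / e - ((t - 1) / e + 3) = (1 - 3 * e) / e := by field_simp; ring
    rw [this]; exact div_nonneg (by linarith) he.le)
  have h2 : 0 ≤ step ((t - 1) / e + 3) := Real.smoothTransition.nonneg _
  have h3 : step (t / e) ≤ 1 := Real.smoothTransition.le_one _
  exact ⟨by rw [cutoff]; linarith, by rw [cutoff]; linarith⟩

lemma cutoff_support {e : ℝ} (he : 0 < e) (he' : e ≤ 1 / 3) :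
    Function.support (cutoff e) ⊆ Set.Icc e (1 - e) := by
  intro t ht
  by_contra h
  rw [Set.mem_Icc, not_and_or, not_le, not_le] at h
  apply ht
  rcases h with h | h
  · have h1 : t / e ≤ 1 := by rw [div_le_one he]; exact h.le
    have h2 : (t - 1) / e + 3 ≤ 1 := by
      have : (t - 1) / e ≤ -2 := by rw [div_le_iff₀ he]; linarith
      linarith
    rw [cutoff, step_zero h1, step_zero h2, sub_zero]
  · have h1 : 2 ≤ t / e := by rw [le_div_iff₀ he]; linarith
    have h2 : 2 ≤ (t - 1) / e + 3 := by
      have : -1 ≤ (t - 1) / e := by rw [le_div_iff₀ he]; linarith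
      linarith
    rw [cutoff, step_one h1, step_one h2, sub_self]

lemma cutoff_eq_one {e t : ℝ} (he : 0 < e) (h1 : 2 * e ≤ t) (h2 : t ≤ 1 - 2 * e) :
    cutoff e t = 1 := by
  have h3 : 2 ≤ t / e := by rw [le_div_iff₀ he]; linarith
  have h4 : (t - 1) / e + 3 ≤ 1 := by
    have : (t - 1) / e ≤ -2 := by rw [div_le_iff₀ he]; linarith
    linarith
  rw [cutoff, step_one h3, step_zero h4, sub_zero]

lemma hasDerivAt_step_comp {f : ℝ → ℝ} {f' t : ℝ} (hf : HasDerivAt f f' t) :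
    HasDerivAt (fun t => step (f t)) (deriv step (f t) * f') t := by
  have := HasDerivAt.comp t (contDiff_step.differentiable (by simp) (f t)).hasDerivAt hf
  exact this

lemma hasDerivAt_cutoff_left (e t : ℝ) :
    HasDerivAt (fun t => step (t / e)) (deriv step (t / e) * (1 / e)) t :=
  hasDerivAt_step_comp (f := fun t => t / e) ((hasDerivAt_id' t).div_const e)

lemma hasDerivAt_cutoff_right (e t : ℝ) :
    HasDerivAt (fun t => step ((t - 1) / e + 3)) (deriv step ((t - 1) / e + 3) * (1 / e)) t :=
  hasDerivAt_step_comp (f := fun t => (t - 1) / e + 3)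
    ((((hasDerivAt_id' t).sub_const 1).div_const e).add_const 3)

lemma deriv_cutoff (e t : ℝ) :
    deriv (cutoff e) t = deriv step (t / e) / e - deriv step ((t - 1) / e + 3) / e := by
  have : cutoff e = fun t => step (t / e) - step ((t - 1) / e + 3) := rfl
  rw [this, ((hasDerivAt_cutoff_left e t).fun_sub (hasDerivAt_cutoff_right e t)).deriv]; ring

/-- A kernel of mass one averages `g`, so only the values of `g` where the kernel does not vanish
matter. This serves both for uniform bounds and for concentration at an endpoint. -/
lemma abs_integral_kernel_le {k g : ℝ → ℝ} {η : ℝ} (hk : Continuous k) (hk0 : ∀ t, 0 ≤ k t)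
    (hk1 : ∫ t in Set.Ioo (0 : ℝ) 1, k t = 1)
    (hg : ∀ t ∈ Set.Ioo (0 : ℝ) 1, k t ≠ 0 → |g t| ≤ η) :
    |∫ t in Set.Ioo (0 : ℝ) 1, k t * g t| ≤ η := by
  have hi : IntegrableOn k (Set.Ioo 0 1) :=
    (hk.integrableOn_Icc (a := 0) (b := 1)).mono_set Set.Ioo_subset_Icc_self
  calc |∫ t in Set.Ioo (0 : ℝ) 1, k t * g t| ≤ ∫ t in Set.Ioo (0 : ℝ) 1, k t * η := by
        rw [← Real.norm_eq_abs]
        refine norm_integral_le_of_norm_le (hi.mul_const η) ?_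
        refine (ae_restrict_iff' measurableSet_Ioo).2 (Eventually.of_forall fun t ht => ?_)
        rw [norm_mul, Real.norm_of_nonneg (hk0 t)]
        by_cases h : k t = 0
        · simp [h]
        · exact mul_le_mul_of_nonneg_left (hg t ht h) (hk0 t)
    _ = η := by rw [integral_mul_const, hk1, one_mul]

lemma integral_Ioo_deriv {F : ℝ → ℝ} (hF : ContDiff ℝ 1 F) :
    ∫ t in Set.Ioo (0 : ℝ) 1, deriv F t = F 1 - F 0 := by
  have hi : IntervalIntegrable (deriv F) volume 0 1 :=
    (hF.continuous_deriv (by simp)).intervalIntegrable _ _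
  rw [← integral_Ioc_eq_integral_Ioo, ← intervalIntegral.integral_of_le zero_le_one]
  exact intervalIntegral.integral_deriv_eq_sub (fun t _ => hF.differentiable (by simp) t) hi

/-- The two pieces of the derivative of the cutoff are kernels of mass one. -/
lemma integral_cutoff_kernels {e : ℝ} (he : 0 < e) (he' : e ≤ 1 / 3) :
    (∫ t in Set.Ioo (0 : ℝ) 1, deriv step (t / e) / e = 1) ∧
      ∫ t in Set.Ioo (0 : ℝ) 1, deriv step ((t - 1) / e + 3) / e = 1 := by
  have h3 : 3 ≤ 1 / e := by rw [le_div_iff₀ he]; linarith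
  constructor
  · have : (fun t => deriv step (t / e) / e) = deriv fun t => step (t / e) := by
      ext t
      rw [(hasDerivAt_cutoff_left e t).deriv]; ring
    have hc : ContDiff ℝ 1 fun t => step (t / e) := contDiff_step.comp (contDiff_id.div_const e)
    rw [this, integral_Ioo_deriv hc,
      step_one (by linarith), step_zero (by simp), sub_zero]
  · have : (fun t => deriv step ((t - 1) / e + 3) / e) = deriv fun t => step ((t - 1) / e + 3) := by
      ext t
      rw [(hasDerivAt_cutoff_right e t).deriv]; ring
    have hc : ContDiff ℝ 1 fun t => step ((t - 1) / e + 3) := contDiff_step.comp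
        (((contDiff_id.sub contDiff_const).div_const e).add contDiff_const)
    rw [this, integral_Ioo_deriv hc,
      step_one (by simp; norm_num), step_zero, sub_zero]
    have : (0 - 1) / e = -(1 / e) := by ring
    rw [this]; linarith

lemma integral_deriv_cutoff_mul {e : ℝ} {g : ℝ → ℝ} (hg : Continuous g) :
    ∫ t in Set.Ioo (0 : ℝ) 1, deriv (cutoff e) t * g t
      = (∫ t in Set.Ioo (0 : ℝ) 1, deriv step (t / e) / e * g t)
        - ∫ t in Set.Ioo (0 : ℝ) 1, deriv step ((t - 1) / e + 3) / e * g t := by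
  have hd : Continuous (deriv step) := contDiff_step.continuous_deriv (by simp)
  have hi : ∀ {f : ℝ → ℝ}, Continuous f → IntegrableOn f (Set.Ioo 0 1) := fun hf =>
    (hf.integrableOn_Icc (a := 0) (b := 1)).mono_set Set.Ioo_subset_Icc_self
  rw [← integral_sub]
  · congr 1; ext t; rw [deriv_cutoff]; ring
  · exact hi (((hd.comp (continuous_id.div_const e)).div_const e).mul hg)
  · exact hi (((hd.comp (((continuous_id.sub continuous_const).div_const e).add
      continuous_const)).div_const e).mul hg)

/-- The bound is uniform in `e`, although the derivative has size `1 / e`, because each of its two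
pieces has mass one. It provides the dominating function in `cube_divergence`. -/
lemma abs_integral_deriv_cutoff_mul_le {e : ℝ} (he : 0 < e) (he' : e ≤ 1 / 3) {g : ℝ → ℝ}
    (hg : Continuous g) {M : ℝ} (hM : ∀ t ∈ Set.Ioo (0 : ℝ) 1, |g t| ≤ M) :
    |∫ t in Set.Ioo (0 : ℝ) 1, deriv (cutoff e) t * g t| ≤ 2 * M := by
  have hd : Continuous (deriv step) := contDiff_step.continuous_deriv (by simp)
  rw [integral_deriv_cutoff_mul hg]
  have h1 := abs_integral_kernel_le (k := fun t => deriv step (t / e) / e) (g := g)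
    ((hd.comp (continuous_id.div_const e)).div_const e)
    (fun t => div_nonneg (deriv_step_nonneg _) he.le) (integral_cutoff_kernels he he').1
    (fun t ht _ => hM t ht)
  have h2 := abs_integral_kernel_le (k := fun t => deriv step ((t - 1) / e + 3) / e) (g := g)
    ((hd.comp (((continuous_id.sub continuous_const).div_const e).add continuous_const)).div_const e)
    (fun t => div_nonneg (deriv_step_nonneg _) he.le) (integral_cutoff_kernels he he').2
    (fun t ht _ => hM t ht)
  exact (abs_sub _ _).trans (by linarith)

/-- The rising ramp concentrates to a unit mass at `0` and the falling one to a negative unit mass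
at `1`. -/
lemma tendsto_integral_deriv_cutoff_mul {g : ℝ → ℝ} (hg : Continuous g) {e : ℕ → ℝ}
    (he : ∀ n, 0 < e n) (he' : ∀ n, e n ≤ 1 / 3) (h0 : Tendsto e atTop (𝓝 0)) :
    Tendsto (fun n => ∫ t in Set.Ioo (0 : ℝ) 1, deriv (cutoff (e n)) t * g t) atTop
      (𝓝 (g 0 - g 1)) := by
  have hd : Continuous (deriv step) := contDiff_step.continuous_deriv (by simp)
  have hi : ∀ {f : ℝ → ℝ}, Continuous f → IntegrableOn f (Set.Ioo 0 1) := fun hf =>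
    (hf.integrableOn_Icc (a := 0) (b := 1)).mono_set Set.Ioo_subset_Icc_self
  have hk1 : ∀ n, Continuous fun t => deriv step (t / e n) / e n := fun n =>
    (hd.comp (continuous_id.div_const (e n))).div_const (e n)
  have hk2 : ∀ n, Continuous fun t => deriv step ((t - 1) / e n + 3) / e n := fun n =>
    (hd.comp (((continuous_id.sub continuous_const).div_const (e n)).add continuous_const)).div_const _
  simp only [integral_deriv_cutoff_mul hg]
  have key : ∀ (a : ℝ) (k : ℕ → ℝ → ℝ), (∀ n, Continuous (k n)) → (∀ n t, 0 ≤ k n t) →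
      (∀ n, ∫ t in Set.Ioo (0 : ℝ) 1, k n t = 1) → (∀ n t, k n t ≠ 0 → |t - a| ≤ 2 * e n) →
      Tendsto (fun n => ∫ t in Set.Ioo (0 : ℝ) 1, k n t * g t) atTop (𝓝 (g a)) := by
    intro a k hk hk0 hk1 hka
    rw [Metric.tendsto_atTop']
    intro η hη
    obtain ⟨δ, hδ, hδg⟩ := Metric.continuous_iff.1 hg a (η / 2) (half_pos hη)
    obtain ⟨N, hN⟩ := Metric.tendsto_atTop'.1 h0 (δ / 2) (half_pos hδ)
    refine ⟨N, fun n hn => ?_⟩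
    have hen := hN n hn
    rw [Real.dist_eq, sub_zero, abs_of_pos (he n)] at hen
    have hb := abs_integral_kernel_le (g := fun t => g t - g a) (η := η / 2) (hk n) (hk0 n) (hk1 n)
      (fun t _ hkt => (hδg t (lt_of_le_of_lt (hka n t hkt) (by linarith))).le)
    have heq : ∫ t in Set.Ioo (0 : ℝ) 1, k n t * (g t - g a)
        = (∫ t in Set.Ioo (0 : ℝ) 1, k n t * g t) - g a := by
      simp only [mul_sub]
      have i1 : IntegrableOn (fun t => k n t * g t) (Set.Ioo 0 1) := hi ((hk n).mul hg)
      have i2 : IntegrableOn (fun t => k n t * g a) (Set.Ioo 0 1) :=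
        hi ((hk n).mul continuous_const)
      rw [integral_sub i1 i2, integral_mul_const, hk1 n, one_mul]
    rw [heq] at hb
    rw [Real.dist_eq]; linarith
  refine (key 0 _ hk1 (fun n t => div_nonneg (deriv_step_nonneg _) (he n).le)
    (fun n => (integral_cutoff_kernels (he n) (he' n)).1) ?_).sub
    (key 1 _ hk2 (fun n t => div_nonneg (deriv_step_nonneg _) (he n).le)
    (fun n => (integral_cutoff_kernels (he n) (he' n)).2) ?_)
  · intro n t ht
    have : ¬ (t / e n < 1 ∨ 2 < t / e n) := fun h => ht (by rw [deriv_step_eq_zero h, zero_div])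
    rw [not_or, not_lt, not_lt, le_div_iff₀ (he n), div_le_iff₀ (he n)] at this
    rw [abs_le]; constructor <;> linarith [he n]
  · intro n t ht
    have : ¬ ((t - 1) / e n + 3 < 1 ∨ 2 < (t - 1) / e n + 3) := fun h =>
      ht (by rw [deriv_step_eq_zero h, zero_div])
    rw [not_or, not_lt, not_lt, ← sub_le_iff_le_add, ← le_sub_iff_add_le, le_div_iff₀ (he n),
      div_le_iff₀ (he n)] at this
    rw [abs_le]; constructor <;> linarith [he n]

/-! ### The divergence theorem on the cube for continuous fields with a weak divergence -/

/-- Tensor product of cutoff functions. -/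
def cubeCutoff (e : ℝ) (ξ : E d) : ℝ := ∏ α, cutoff e (ξ α)

lemma contDiff_cubeCutoff (e : ℝ) : ContDiff ℝ 1 (cubeCutoff (d := d) e) :=
  contDiff_prod fun α _ => (contDiff_cutoff e).comp (contDiff_piLp_apply (p := 2) (i := α))

lemma cubeCutoff_mem_Icc {e : ℝ} (he : 0 < e) (he' : e ≤ 1 / 3) (ξ : E d) :
    cubeCutoff e ξ ∈ Set.Icc (0 : ℝ) 1 :=
  ⟨Finset.prod_nonneg fun _ _ => (cutoff_mem_Icc he he' _).1,
    Finset.prod_le_one (fun _ _ => (cutoff_mem_Icc he he' _).1)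
      fun _ _ => (cutoff_mem_Icc he he' _).2⟩

lemma tsupport_cubeCutoff {e : ℝ} (he : 0 < e) (he' : e ≤ 1 / 3) :
    tsupport (cubeCutoff (d := d) e) ⊆ openCube d := by
  have h1 : tsupport (cubeCutoff (d := d) e) ⊆ {ξ | ∀ α, ξ α ∈ Set.Icc e (1 - e)} := by
    refine closure_minimal (fun ξ hξ α => cutoff_support he he' fun h => hξ
      (Finset.prod_eq_zero (Finset.mem_univ α) h)) ?_
    simp only [Set.ofPred_forall]
    exact isClosed_iInter fun α => isClosed_Icc.preimage (by fun_prop)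
  exact h1.trans fun ξ hξ α => ⟨by linarith [(hξ α).1], by linarith [(hξ α).2]⟩

lemma hasCompactSupport_cubeCutoff {e : ℝ} (he : 0 < e) (he' : e ≤ 1 / 3) :
    HasCompactSupport (cubeCutoff (d := d) e) :=
  (isCompact_closedCube d).of_isClosed_subset (isClosed_tsupport _)
    ((tsupport_cubeCutoff he he').trans (openCube_subset_closedCube d))

lemma pd_cubeCutoff_face (e : ℝ) (α : Fin (d + 1)) (s : ℝ) (y : EuclideanSpace ℝ (Fin d)) :
    pd α (cubeCutoff e) (face α s y) = deriv (cutoff e) s * ∏ i, cutoff e (y i) := by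
  have h := hasDerivAt_comp_face α s y ((contDiff_cubeCutoff e).differentiable (by simp) _)
  rw [← h.deriv]
  have : (fun s => cubeCutoff e (face α s y)) = fun s => cutoff e s * ∏ i, cutoff e (y i) := by
    ext s; rw [cubeCutoff, Fin.prod_univ_succAbove _ α]; simp
  rw [this, deriv_mul_const ((contDiff_cutoff e).differentiable (by simp) s)]

/-- Testing with a product of cutoffs that tends to one inside the cube, the derivative in direction
`α` concentrates on the two faces orthogonal to it, where continuity of the field supplies its
values. No differentiability of the individual components is needed. -/
theorem cube_divergence {V : Fin (d + 1) → E d → ℝ} {D : E d → ℝ} (hV : ∀ α, Continuous (V α))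
    (hD : IntegrableOn D (openCube d))
    (h : ∀ ζ : E d → ℝ, ContDiff ℝ 1 ζ → HasCompactSupport ζ → tsupport ζ ⊆ openCube d →
      ∫ ξ in openCube d, ∑ α, V α ξ * pd α ζ ξ = -∫ ξ in openCube d, D ξ * ζ ξ) :
    ∫ ξ in openCube d, D ξ
      = ∑ α, ((∫ y in ucube d, V α (face α 1 y)) - ∫ y in ucube d, V α (face α 0 y)) := by
  -- The offset `3` keeps the width at most `1/3`, so that the two ramps of each cutoff stay in
  -- order.
  set e : ℕ → ℝ := fun n => 1 / ((n : ℝ) + 3) with hedef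
  have he : ∀ n, 0 < e n := fun n => by positivity
  have he' : ∀ n, e n ≤ 1 / 3 := fun n =>
    one_div_le_one_div_of_le (by norm_num) (by linarith [(Nat.cast_nonneg n : (0 : ℝ) ≤ n)])
  have h0 : Tendsto e atTop (𝓝 0) :=
    tendsto_const_nhds.div_atTop (tendsto_atTop_add_const_right _ _ tendsto_natCast_atTop_atTop)
  have hcut1 : ∀ t ∈ Set.Ioo (0 : ℝ) 1, ∀ᶠ n in atTop, cutoff (e n) t = 1 := by
    intro t ht
    have h2 : Tendsto (fun n => 2 * e n) atTop (𝓝 0) := by simpa using h0.const_mul 2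
    filter_upwards [h2.eventually_lt_const ht.1, h2.eventually_lt_const (sub_pos.2 ht.2)]
      with n h3 h4 using cutoff_eq_one (he n) h3.le (by linarith)
  have l1 : Tendsto (fun n => ∫ ξ in openCube d, D ξ * cubeCutoff (e n) ξ) atTop
      (𝓝 (∫ ξ in openCube d, D ξ)) := by
    refine tendsto_integral_of_dominated_convergence (fun ξ => ‖D ξ‖) (fun n => ?_) hD.norm
      (fun n => ?_) ?_
    · exact hD.aestronglyMeasurable.mul (contDiff_cubeCutoff (e n)).continuous.aestronglyMeasurable
    · refine Eventually.of_forall fun ξ => ?_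
      rw [norm_mul]
      have := cubeCutoff_mem_Icc (he n) (he' n) ξ
      refine mul_le_of_le_one_right (norm_nonneg _) ?_
      rw [Real.norm_of_nonneg this.1]; exact this.2
    · refine (ae_restrict_iff' (isOpen_openCube d).measurableSet).2
        (Eventually.of_forall fun ξ hξ => ?_)
      have : ∀ᶠ n in atTop, ∀ α, cutoff (e n) (ξ α) = 1 :=
        eventually_all.2 fun α => hcut1 (ξ α) (hξ α)
      refine tendsto_const_nhds.congr' ?_
      filter_upwards [this] with n hn
      simp [cubeCutoff, hn]
  have l2 : ∀ α, Tendsto (fun n => ∫ ξ in openCube d, V α ξ * pd α (cubeCutoff (e n)) ξ) atTop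
      (𝓝 ((∫ y in ucube d, V α (face α 0 y)) - ∫ y in ucube d, V α (face α 1 y))) := by
    intro α
    have hc0 : ∀ s, Continuous fun y => V α (face α s y) := fun s =>
      (hV α).comp (contDiff_face (n := 1) α s).continuous
    have hcI : ∀ {f : EuclideanSpace ℝ (Fin d) → ℝ}, Continuous f → IntegrableOn f (ucube d) :=
      fun hf => (hf.continuousOn.integrableOn_compact (isCompact_ccube d)).mono_set
        (ucube_subset_ccube d)
    obtain ⟨M, hM⟩ := (isCompact_closedCube d).exists_bound_of_continuousOn (hV α).continuousOn
    have e1 : ∀ n, ∫ ξ in openCube d, V α ξ * pd α (cubeCutoff (e n)) ξ = ∫ y in ucube d,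
        (∏ i, cutoff (e n) (y i)) *
          ∫ s in Set.Ioo (0 : ℝ) 1, deriv (cutoff (e n)) s * V α (face α s y) := by
      intro n
      rw [setIntegral_openCube α]
      · simp only [pd_cubeCutoff_face, ← integral_const_mul]
        congr 1; ext y; congr 1; ext s; ring
      · exact (((hV α).mul (pd_continuous (contDiff_cubeCutoff (e n)) α)).continuousOn.integrableOn_compact
          (isCompact_closedCube d)).mono_set (openCube_subset_closedCube d)
    simp only [e1]
    rw [← integral_sub (hcI (hc0 0)) (hcI (hc0 1))]
    refine tendsto_integral_of_dominated_convergence (fun _ => 2 * M) (fun n => ?_) ?_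
      (fun n => ?_) ?_
    · refine (Continuous.aestronglyMeasurable ?_).mul ?_
      · exact continuous_finsetProd _ fun i _ =>
          (contDiff_cutoff (e n)).continuous.comp (by fun_prop)
      · have : StronglyMeasurable (Function.uncurry fun (y : EuclideanSpace ℝ (Fin d)) (s : ℝ) =>
            deriv (cutoff (e n)) s * V α (face α s y)) := by
          refine Continuous.stronglyMeasurable ?_
          exact (((contDiff_cutoff (e n)).continuous_deriv (by simp)).comp continuous_snd).mul
            ((hV α).comp ((continuous_face_uncurry α).comp continuous_swap))
        exact this.integral_prod_right.aestronglyMeasurable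
    · exact integrableOn_const (volume_ucube_lt_top d).ne
    · refine (ae_restrict_iff' (isOpen_ucube d).measurableSet).2
        (Eventually.of_forall fun y hy => ?_)
      rw [norm_mul, Real.norm_eq_abs, Real.norm_eq_abs]
      have h1 := abs_integral_deriv_cutoff_mul_le (he n) (he' n)
        (g := fun s => V α (face α s y)) (M := M)
        ((hV α).comp ((continuous_face_uncurry α).comp (continuous_id.prodMk continuous_const)))
        (fun t ht => hM _ (openCube_subset_closedCube d (face_mem_openCube.2 ⟨ht, hy⟩)))
      have h2 : |∏ i, cutoff (e n) (y i)| ≤ 1 := by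
        rw [Finset.abs_prod]
        refine Finset.prod_le_one (fun _ _ => abs_nonneg _) fun i _ => ?_
        have := cutoff_mem_Icc (he n) (he' n) (y i)
        rw [abs_of_nonneg this.1]; exact this.2
      exact (mul_le_of_le_one_left (abs_nonneg _) h2).trans h1
    · refine (ae_restrict_iff' (isOpen_ucube d).measurableSet).2
        (Eventually.of_forall fun y hy => ?_)
      have h1 := tendsto_integral_deriv_cutoff_mul (g := fun s => V α (face α s y))
        ((hV α).comp ((continuous_face_uncurry α).comp (continuous_id.prodMk continuous_const))) he he' h0
      refine h1.congr' ?_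
      have : ∀ᶠ n in atTop, ∀ i, cutoff (e n) (y i) = 1 :=
        eventually_all.2 fun i => hcut1 (y i) (hy i)
      filter_upwards [this] with n hn
      simp [hn]
  have l3 := tendsto_finsetSum Finset.univ fun α _ => l2 α
  have l4 := tendsto_nhds_unique (l3.congr fun n => ?_) l1.neg
  · rw [← neg_eq_iff_eq_neg] at l4
    rw [← l4, ← Finset.sum_neg_distrib]
    exact Finset.sum_congr rfl fun α _ => by ring
  · rw [← h _ (contDiff_cubeCutoff (e n)) (hasCompactSupport_cubeCutoff (he n) (he' n))
      (tsupport_cubeCutoff (he n) (he' n)), integral_finsetSum]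
    intro α _
    exact (((hV α).mul (pd_continuous (contDiff_cubeCutoff (e n)) α)).continuousOn.integrableOn_compact
      (isCompact_closedCube d)).mono_set (openCube_subset_closedCube d)

/-! ### Trace inequality on the cube -/

/-- The fundamental theorem of calculus bounds `g s` by `g t` plus the integral of `|g'|` over the
unit interval. Squaring, averaging over `t` and Cauchy–Schwarz finish; the constant is the one in
`(a + b)² ≤ 2(a² + b²)`. -/
lemma enorm_sq_le_lintegral {g g' : ℝ → ℝ} (hg : ∀ t, HasDerivAt g (g' t) t) (hg' : Continuous g')
    {s : ℝ} (hs : s ∈ Set.Icc (0 : ℝ) 1) :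
    ‖g s‖ₑ ^ 2 ≤ 2 * ∫⁻ t in Set.Ioo (0 : ℝ) 1, (‖g t‖ₑ ^ 2 + ‖g' t‖ₑ ^ 2) := by
  have hgc : Continuous g := continuous_iff_continuousAt.2 fun t => (hg t).continuousAt
  set I := ∫⁻ t in Set.Ioo (0 : ℝ) 1, ‖g' t‖ₑ with hI
  have h1 : ∀ t ∈ Set.Ioo (0 : ℝ) 1, ‖g s‖ₑ ≤ ‖g t‖ₑ + I := by
    intro t ht
    have e : g s = g t + ∫ x in t..s, g' x := by
      rw [intervalIntegral.integral_eq_sub_of_hasDerivAt (fun x _ => hg x)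
        (hg'.intervalIntegrable _ _)]; ring
    rw [e]
    refine (enorm_add_le _ _).trans (add_le_add_right ?_ _)
    rw [intervalIntegral.intervalIntegral_eq_integral_uIoc, enorm_smul]
    have : ‖(if t ≤ s then (1 : ℝ) else -1)‖ₑ = 1 := by split_ifs <;> simp
    rw [this, one_mul]
    refine (enorm_integral_le_lintegral_enorm _).trans ?_
    rw [hI, ← setLIntegral_congr (Ioo_ae_eq_Ioc (a := (0 : ℝ)) (b := 1)).symm]
    refine lintegral_mono_set ?_
    rw [Set.uIoc]
    exact Set.Ioc_subset_Ioc (le_min ht.1.le hs.1) (max_le ht.2.le hs.2)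
  have h2 : I ^ 2 ≤ ∫⁻ t in Set.Ioo (0 : ℝ) 1, ‖g' t‖ₑ ^ 2 := by
    have := lintegral_enorm_mul_sq_le (μ := volume.restrict (Set.Ioo (0 : ℝ) 1))
      (ρ := fun _ => 1) (h := fun t => ‖g' t‖ₑ) aemeasurable_const
      hg'.measurable.enorm.aemeasurable (by simp)
    simpa using this
  calc ‖g s‖ₑ ^ 2 = ∫⁻ t in Set.Ioo (0 : ℝ) 1, ‖g s‖ₑ ^ 2 := by simp
    _ ≤ ∫⁻ t in Set.Ioo (0 : ℝ) 1, 2 * (‖g t‖ₑ ^ 2 + I ^ 2) := by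
        refine setLIntegral_mono' measurableSet_Ioo fun t ht => ?_
        refine (pow_le_pow_left₀ zero_le (h1 t ht) 2).trans ?_
        have := ENNReal.rpow_add_le_mul_rpow_add_rpow (‖g t‖ₑ) I (p := 2) (by norm_num)
        norm_num at this
        exact this
    _ = 2 * ((∫⁻ t in Set.Ioo (0 : ℝ) 1, ‖g t‖ₑ ^ 2) + I ^ 2) := by
        rw [lintegral_const_mul _ (by fun_prop), lintegral_add_right _ measurable_const]
        simp
    _ ≤ _ := by
        rw [lintegral_add_left (by fun_prop)]
        gcongr

lemma cube_trace_ineq {G : E d → ℝ} (hG : ContDiff ℝ 1 G) (α : Fin (d + 1)) {s : ℝ}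
    (hs : s ∈ Set.Icc (0 : ℝ) 1) :
    ∫⁻ y in ucube d, ‖G (face α s y)‖ₑ ^ 2
      ≤ 2 * ∫⁻ ξ in openCube d, (‖G ξ‖ₑ ^ 2 + ‖pd α G ξ‖ₑ ^ 2) := by
  have hm : Measurable fun ξ => ‖G ξ‖ₑ ^ 2 + ‖pd α G ξ‖ₑ ^ 2 :=
    (hG.continuous.measurable.enorm.pow_const 2).add
      ((pd_continuous hG α).measurable.enorm.pow_const 2)
  rw [setLIntegral_openCube α hm, ← lintegral_const_mul' _ _ (by simp)]
  refine lintegral_mono fun y => ?_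
  exact enorm_sq_le_lintegral (g := fun s => G (face α s y))
    (fun t => hasDerivAt_comp_face α t y (hG.differentiable (by simp) _))
    ((pd_continuous hG α).comp ((continuous_face_uncurry α).comp (continuous_id.prodMk continuous_const))) hs

/-! ### Outer normals -/

/-- Near a point with outer normal `n`, every ray entering the half space `⟪·, n⟫ < 0` stays in the
closure of the set. -/
lemma IsOuterNormal.eventually_mem_closure {U : Set (E d)} {y n w : E d} (h : IsOuterNormal U y n)
    (hw : inner ℝ w n < 0) : ∀ᶠ s in 𝓝[>] (0 : ℝ), ∀ᶠ z in 𝓝 (y + s • w), z ∈ closure U := by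
  have hw0 : w ≠ 0 := by rintro rfl; simp at hw
  have hwn : 0 < ‖w‖ := norm_pos_iff.2 hw0
  -- At `y + s • w` the allowed deviation is then only a quarter of `|⟪s • w, n⟫|`, so the exterior
  -- condition fails strictly, and hence on a whole neighbourhood.
  set ε := -inner ℝ w n / (4 * ‖w‖) with hε
  have hε0 : 0 < ε := by have := neg_pos.2 hw; positivity
  have hεw : ε * ‖w‖ = -inner ℝ w n / 4 := by rw [hε]; field_simp
  have h1 := eventually_eventually_nhds.2 (h.2 ε hε0)
  have hc : Tendsto (fun s : ℝ => y + s • w) (𝓝[>] 0) (𝓝 y) := by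
    have : Tendsto (fun s : ℝ => y + s • w) (𝓝 0) (𝓝 (y + (0 : ℝ) • w)) :=
      Continuous.tendsto (by fun_prop) 0
    rw [zero_smul, add_zero] at this
    exact this.mono_left nhdsWithin_le_nhds
  filter_upwards [hc.eventually h1, self_mem_nhdsWithin] with s hs hs0
  have hs0' : (0 : ℝ) < s := hs0
  have hc1 : Continuous fun z : E d => inner ℝ (z - y) n + ε * ‖z - y‖ := by fun_prop
  have h2 : ∀ᶠ z in 𝓝 (y + s • w), inner ℝ (z - y) n + ε * ‖z - y‖ < 0 := by
    refine hc1.continuousAt.eventually_lt_const ?_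
    beta_reduce
    rw [add_sub_cancel_left, inner_smul_left, norm_smul, Real.norm_of_nonneg hs0'.le]
    have : ε * (s * ‖w‖) = s * (-inner ℝ w n / 4) := by rw [← hεw]; ring
    rw [this]
    simp only [conj_trivial]
    nlinarith
  filter_upwards [hs, h2] with z hz hz2
  by_contra hzU
  have := hz.2 hzU
  linarith

/-- Near a point with outer normal `n`, every ray entering the half space `⟪·, n⟫ > 0` stays away
from the set. -/
lemma IsOuterNormal.eventually_notMem {U : Set (E d)} {y n w : E d} (h : IsOuterNormal U y n)
    (hw : 0 < inner ℝ w n) : ∀ᶠ s in 𝓝[>] (0 : ℝ), ∀ᶠ z in 𝓝 (y + s • w), z ∉ U := by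
  have hw0 : w ≠ 0 := by rintro rfl; simp at hw
  have hwn : 0 < ‖w‖ := norm_pos_iff.2 hw0
  set ε := inner ℝ w n / (4 * ‖w‖) with hε
  have hε0 : 0 < ε := by positivity
  have hεw : ε * ‖w‖ = inner ℝ w n / 4 := by rw [hε]; field_simp
  have h1 := eventually_eventually_nhds.2 (h.2 ε hε0)
  have hc : Tendsto (fun s : ℝ => y + s • w) (𝓝[>] 0) (𝓝 y) := by
    have : Tendsto (fun s : ℝ => y + s • w) (𝓝 0) (𝓝 (y + (0 : ℝ) • w)) :=
      Continuous.tendsto (by fun_prop) 0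
    rw [zero_smul, add_zero] at this
    exact this.mono_left nhdsWithin_le_nhds
  filter_upwards [hc.eventually h1, self_mem_nhdsWithin] with s hs hs0
  have hs0' : (0 : ℝ) < s := hs0
  have hc1 : Continuous fun z : E d => inner ℝ (z - y) n - ε * ‖z - y‖ := by fun_prop
  have h2 : ∀ᶠ z in 𝓝 (y + s • w), 0 < inner ℝ (z - y) n - ε * ‖z - y‖ := by
    refine hc1.continuousAt.eventually_const_lt ?_
    beta_reduce
    rw [add_sub_cancel_left, inner_smul_left, norm_smul, Real.norm_of_nonneg hs0'.le]
    have : ε * (s * ‖w‖) = s * (inner ℝ w n / 4) := by rw [← hεw]; ring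
    rw [this]
    simp only [conj_trivial]
    nlinarith
  filter_upwards [hs, h2] with z hz hz2 hzU
  have := hz.1 hzU
  linarith

/-- Two distinct unit vectors are separated by some direction. -/
lemma exists_inner_neg_of_ne {n m : E d} (hn : ‖n‖ = 1) (hm : ‖m‖ = 1) (h : n ≠ m) :
    ∃ w : E d, inner ℝ w n < 0 ∧ 0 < inner ℝ w m := by
  have h1 : inner ℝ n m < (1 : ℝ) := by
    refine lt_of_le_of_ne ?_ fun h' => h ((inner_eq_one_iff_of_norm_eq_one hn hm).1 h')
    simpa [hn, hm] using real_inner_le_norm n m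
  refine ⟨m - n, ?_, ?_⟩
  · rw [inner_sub_left, real_inner_self_eq_norm_sq, hn, real_inner_comm]; linarith
  · rw [inner_sub_left, real_inner_self_eq_norm_sq, hm]; linarith

/-- Along a direction pointing inward for one normal and outward for the other, nearby points would
have a neighbourhood in the closure of `U` and one avoiding `U`. -/
lemma IsOuterNormal.unique {U : Set (E d)} {y n m : E d} (hn : IsOuterNormal U y n)
    (hm : IsOuterNormal U y m) : n = m := by
  by_contra h
  obtain ⟨w, h1, h2⟩ := exists_inner_neg_of_ne hn.1 hm.1 h
  obtain ⟨s, hs1, hs2⟩ := ((hn.eventually_mem_closure h1).and (hm.eventually_notMem h2)).exists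
  exact (mem_closure_iff_frequently.1 hs1.self_of_nhds) hs2

lemma IsOuterNormal.outerNormal_eq {U : Set (E d)} {y n : E d} (hn : IsOuterNormal U y n) :
    outerNormal U y = n := by
  have h : ∃ n, IsOuterNormal U y n := ⟨n, hn⟩
  rw [outerNormal, dif_pos h]
  exact h.choose_spec.unique hn

/-- Disjoint open sets have opposite outer normals at a common point. -/
lemma IsOuterNormal.eq_neg {U V : Set (E d)} {y n m : E d} (hUV : Disjoint U V) (hU : IsOpen U)
    (hn : IsOuterNormal U y n) (hm : IsOuterNormal V y m) : m = -n := by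
  by_contra h
  have hne : m ≠ -n := h
  obtain ⟨w, h1, h2⟩ := exists_inner_neg_of_ne hm.1 (by rw [norm_neg]; exact hn.1) hne
  rw [inner_neg_right, neg_pos] at h2
  obtain ⟨s, hs1, hs2⟩ :=
    ((hn.eventually_mem_closure h2).and (hm.eventually_mem_closure h1)).exists
  have h3 := (mem_closure_iff_frequently.1 hs1.self_of_nhds).and_eventually hs2
  obtain ⟨z, hzU, hzV⟩ := h3.exists
  exact Set.disjoint_left.1 (hUV.closure_right hU) hzU hzV

/-- The outer normal at a point on a hyperplane bounding the open set. -/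
lemma IsOuterNormal.eq_of_halfspace {U : Set (E d)} {y n m : E d} (hn : IsOuterNormal U y n)
    (hm : ‖m‖ = 1) (h : ∀ z ∈ U, inner ℝ (z - y) m ≤ 0) : n = m := by
  by_contra hne
  obtain ⟨w, h1, h2⟩ := exists_inner_neg_of_ne hn.1 hm hne
  obtain ⟨s, hs1, hs2⟩ :=
    ((hn.eventually_mem_closure h1).and self_mem_nhdsWithin).exists
  have hcl : ∀ z ∈ closure U, inner ℝ (z - y) m ≤ 0 := by
    intro z hz
    have hclosed : IsClosed {z : E d | inner ℝ (z - y) m ≤ 0} :=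
      isClosed_le (by fun_prop) continuous_const
    exact closure_minimal (fun z hz => h z hz) hclosed hz
  have := hcl _ hs1.self_of_nhds
  rw [add_sub_cancel_left, inner_smul_left] at this
  have hs0 : (0 : ℝ) < s := hs2
  simp only [conj_trivial] at this
  nlinarith

/-- A set is absent from the outer side of its boundary. -/
lemma IsOuterNormal.frequently_notMem_closure {U : Set (E d)} {y n : E d}
    (hn : IsOuterNormal U y n) : ∃ᶠ z in 𝓝 y, z ∉ closure U := by
  have h1 : 0 < inner ℝ n n := by rw [real_inner_self_eq_norm_sq, hn.1]; norm_num
  have h2 := hn.eventually_notMem h1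
  have hc : Tendsto (fun s : ℝ => y + s • n) (𝓝[>] 0) (𝓝 y) := by
    have : Tendsto (fun s : ℝ => y + s • n) (𝓝 0) (𝓝 (y + (0 : ℝ) • n)) :=
      Continuous.tendsto (by fun_prop) 0
    rw [zero_smul, add_zero] at this
    exact this.mono_left nhdsWithin_le_nhds
  refine hc.frequently (Eventually.frequently ?_)
  filter_upwards [h2] with s hs hcl
  exact (mem_closure_iff_frequently.1 hcl) hs

/-! ### Charts of curved cubes -/

/-- A `C¹` parametrisation of a curved cube, regular up to the boundary, with a globally defined
`C¹` extension `Θ` of its inverse and a cutoff function `χ`. -/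
structure CubeChart (d : ℕ) where
  Φ : E d → E d
  Θ : E d → E d
  χ : E d → ℝ
  O : Set (E d)
  contDiff_Φ : ContDiff ℝ 1 Φ
  contDiff_Θ : ContDiff ℝ 1 Θ
  contDiff_χ : ContDiff ℝ 1 χ
  isOpen_O : IsOpen O
  cube_subset : closedCube d ⊆ O
  left_inv : ∀ ξ ∈ O, Θ (Φ ξ) = ξ
  χ_eq_one : ∀ ξ ∈ closedCube d, χ (Φ ξ) = 1
  χ_support : Function.support χ ⊆ Φ '' O

namespace CubeChart

variable (c : CubeChart d)

/-- The curved cube. -/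
def dom : Set (E d) := c.Φ '' openCube d

lemma fderiv_comp {ξ : E d} (hξ : ξ ∈ c.O) :
    (fderiv ℝ c.Θ (c.Φ ξ)) ∘L (fderiv ℝ c.Φ ξ) = ContinuousLinearMap.id ℝ (E d) := by
  have h1 : HasFDerivAt (c.Θ ∘ c.Φ) ((fderiv ℝ c.Θ (c.Φ ξ)) ∘L (fderiv ℝ c.Φ ξ)) ξ :=
    (c.contDiff_Θ.differentiable (by simp) _).hasFDerivAt.comp ξ
      (c.contDiff_Φ.differentiable (by simp) _).hasFDerivAt
  have h2 : HasFDerivAt (c.Θ ∘ c.Φ) (ContinuousLinearMap.id ℝ (E d)) ξ := by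
    refine (hasFDerivAt_id ξ).congr_of_eventuallyEq ?_
    filter_upwards [c.isOpen_O.mem_nhds hξ] with z hz using c.left_inv z hz
  exact h1.unique h2

lemma fderiv_Φ_injective {ξ : E d} (hξ : ξ ∈ c.O) : Function.Injective (fderiv ℝ c.Φ ξ) :=
  Function.LeftInverse.injective (g := fderiv ℝ c.Θ (c.Φ ξ)) fun w =>
    congrArg (fun T : E d →L[ℝ] E d => T w) (c.fderiv_comp hξ)

lemma fderiv_Φ_surjective {ξ : E d} (hξ : ξ ∈ c.O) : Function.Surjective (fderiv ℝ c.Φ ξ) :=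
  LinearMap.surjective_of_injective (f := (fderiv ℝ c.Φ ξ : E d →ₗ[ℝ] E d)) (c.fderiv_Φ_injective hξ)

lemma det_ne_zero {ξ : E d} (hξ : ξ ∈ c.O) : (fderiv ℝ c.Φ ξ).det ≠ 0 := by
  intro h
  have h1 := congrArg (fun T : E d →L[ℝ] E d => LinearMap.det (T : E d →ₗ[ℝ] E d)) (c.fderiv_comp hξ)
  have h2 : LinearMap.det (fderiv ℝ c.Φ ξ : E d →ₗ[ℝ] E d) = 0 := h
  simp [h2, LinearMap.det_comp] at h1

lemma injOn : Set.InjOn c.Φ c.O := fun x hx y hy h => by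
  rw [← c.left_inv x hx, h, c.left_inv y hy]

lemma right_inv {z : E d} (hz : z ∈ c.Φ '' c.O) : c.Φ (c.Θ z) = z := by
  obtain ⟨ξ, hξ, rfl⟩ := hz; rw [c.left_inv ξ hξ]

/-- Surjectivity of the strict derivative makes `Φ` open at every point of `O`. -/
lemma isOpen_image {V : Set (E d)} (hV : IsOpen V) (hVO : V ⊆ c.O) : IsOpen (c.Φ '' V) := by
  rw [isOpen_iff_mem_nhds]
  rintro _ ⟨ξ, hξ, rfl⟩
  have h := (c.contDiff_Φ.hasStrictFDerivAt (x := ξ) (by simp)).map_nhds_eq_of_surj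
    (LinearMap.range_eq_top.2 (c.fderiv_Φ_surjective (hVO hξ)))
  rw [← h]
  exact image_mem_map (hV.mem_nhds hξ)

lemma openCube_subset : openCube d ⊆ c.O := (openCube_subset_closedCube d).trans c.cube_subset

lemma isOpen_dom : IsOpen c.dom := c.isOpen_image (isOpen_openCube d) c.openCube_subset

lemma mem_dom_iff {z : E d} (hz : z ∈ c.Φ '' c.O) : z ∈ c.dom ↔ c.Θ z ∈ openCube d := by
  constructor
  · rintro ⟨ξ, hξ, rfl⟩; rwa [c.left_inv ξ (c.openCube_subset hξ)]
  · intro h; exact ⟨c.Θ z, h, c.right_inv hz⟩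

lemma dom_subset : c.dom ⊆ c.Φ '' closedCube d := Set.image_mono (openCube_subset_closedCube d)

lemma isCompact_image : IsCompact (c.Φ '' closedCube d) :=
  (isCompact_closedCube d).image c.contDiff_Φ.continuous

lemma closedCube_subset_closure : closedCube d ⊆ closure (openCube d) := by
  intro ξ hξ
  set p : E d := WithLp.toLp 2 fun _ => (1 / 2 : ℝ) with hp
  have hp2 : ∀ α, p α = 1 / 2 := fun _ => rfl
  refine mem_closure_of_tendsto (b := 𝓝[>] (0 : ℝ)) (f := fun t : ℝ => ξ + t • (p - ξ)) ?_ ?_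
  · have : Tendsto (fun t : ℝ => ξ + t • (p - ξ)) (𝓝 0) (𝓝 (ξ + (0 : ℝ) • (p - ξ))) :=
      Continuous.tendsto (by fun_prop) 0
    rw [zero_smul, add_zero] at this
    exact this.mono_left nhdsWithin_le_nhds
  · have h1 : ∀ᶠ t : ℝ in 𝓝[>] 0, t < 1 :=
      (eventually_lt_nhds zero_lt_one).filter_mono nhdsWithin_le_nhds
    filter_upwards [self_mem_nhdsWithin, h1] with t ht ht1 α
    have ht0 : (0 : ℝ) < t := ht
    have := hξ α
    simp only [PiLp.add_apply, PiLp.smul_apply, PiLp.sub_apply, smul_eq_mul, hp2]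
    constructor <;> nlinarith

lemma closure_dom : closure c.dom = c.Φ '' closedCube d := by
  refine (closure_minimal c.dom_subset c.isCompact_image.isClosed).antisymm ?_
  exact (Set.image_mono (closedCube_subset_closure)).trans
    (image_closure_subset_closure_image c.contDiff_Φ.continuous)

lemma isBounded_dom : Bornology.IsBounded c.dom := c.isCompact_image.isBounded.subset c.dom_subset

lemma frontier_dom : frontier c.dom = c.Φ '' (closedCube d \ openCube d) := by
  rw [c.isOpen_dom.frontier_eq, c.closure_dom, dom, (c.injOn.mono c.cube_subset).image_sdiff_subset
    (openCube_subset_closedCube d)]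

lemma volume_frontier : volume (frontier c.dom) = 0 := by
  rw [c.frontier_dom]
  exact addHaar_image_eq_zero_of_differentiableOn_of_addHaar_eq_zero _
    (c.contDiff_Φ.differentiable (by simp)).differentiableOn (volume_ccube_diff_ucube (d + 1))

lemma setIntegral_dom (F : E d → ℝ) :
    ∫ z in c.dom, F z = ∫ ξ in openCube d, |(fderiv ℝ c.Φ ξ).det| * F (c.Φ ξ) :=
  integral_image_eq_integral_abs_det_fderiv_smul volume (isOpen_openCube d).measurableSet
    (fun ξ _ => (c.contDiff_Φ.differentiable (by simp) ξ).hasFDerivAt.hasFDerivWithinAt)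
    (c.injOn.mono c.openCube_subset) F

lemma integrableOn_dom {F : E d → ℝ} : IntegrableOn F c.dom ↔
    IntegrableOn (fun ξ => |(fderiv ℝ c.Φ ξ).det| * F (c.Φ ξ)) (openCube d) :=
  integrableOn_image_iff_integrableOn_abs_det_fderiv_smul volume (isOpen_openCube d).measurableSet
    (fun ξ _ => (c.contDiff_Φ.differentiable (by simp) ξ).hasFDerivAt.hasFDerivWithinAt)
    (c.injOn.mono c.openCube_subset) F

lemma setLIntegral_image {V : Set (E d)} (hV : MeasurableSet V) (hVO : V ⊆ c.O) (F : E d → ℝ≥0∞) :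
    ∫⁻ z in c.Φ '' V, F z
      = ∫⁻ ξ in V, ENNReal.ofReal |(fderiv ℝ c.Φ ξ).det| * F (c.Φ ξ) :=
  lintegral_image_eq_lintegral_abs_det_fderiv_mul volume hV
    (fun ξ _ => (c.contDiff_Φ.differentiable (by simp) ξ).hasFDerivAt.hasFDerivWithinAt)
    (c.injOn.mono hVO) F

lemma continuous_det : Continuous fun ξ => (fderiv ℝ c.Φ ξ).det :=
  ContinuousLinearMap.continuous_det.comp (c.contDiff_Φ.continuous_fderiv (by simp))

end CubeChart

/-- The coordinate value of a face of the cube: `1` for `true` and `0` for `false`. -/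
def faceVal (b : Bool) : ℝ := if b then 1 else 0

/-- The sign of the outer normal on a face of the cube. -/
def faceSign (b : Bool) : ℝ := if b then 1 else -1

lemma faceVal_mem (b : Bool) : faceVal b ∈ Set.Icc (0 : ℝ) 1 := by cases b <;> simp [faceVal]

lemma faceVal_notMem (b : Bool) : faceVal b ∉ Set.Ioo (0 : ℝ) 1 := by cases b <;> simp [faceVal]

lemma faceVal_injective : Function.Injective faceVal := by
  intro a b; cases a <;> cases b <;> simp [faceVal]

namespace CubeChart

variable (c : CubeChart d)

/-- The gradient of the `α`-th component of the inverse chart. -/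
def grad (α : Fin (d + 1)) (z : E d) : E d :=
  WithLp.toLp 2 fun k => fderiv ℝ c.Θ z (EuclideanSpace.single k 1) α

@[simp] lemma grad_apply (α k : Fin (d + 1)) (z : E d) :
    c.grad α z k = fderiv ℝ c.Θ z (EuclideanSpace.single k 1) α := rfl

lemma hasFDerivAt_Θ_apply (α : Fin (d + 1)) (z : E d) :
    HasFDerivAt (fun z => c.Θ z α) ((EuclideanSpace.proj α : E d →L[ℝ] ℝ) ∘L fderiv ℝ c.Θ z) z :=
  (EuclideanSpace.proj (𝕜 := ℝ) α).hasFDerivAt.comp z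
    (c.contDiff_Θ.differentiable (by simp) z).hasFDerivAt

lemma inner_grad (α : Fin (d + 1)) (z w : E d) : inner ℝ w (c.grad α z) = fderiv ℝ c.Θ z w α := by
  have hw : w = ∑ k, w k • EuclideanSpace.single k (1 : ℝ) := by
    ext j; simp [Finset.sum_apply, Pi.single_apply]
  conv_rhs => rw [hw]
  rw [map_sum, PiLp.inner_apply]
  simp [mul_comm]

lemma continuous_grad (α : Fin (d + 1)) : Continuous (c.grad α) := by
  refine (PiLp.continuous_toLp 2 _).comp (continuous_pi fun k => ?_)
  exact (PiLp.continuous_apply 2 _ α).comp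
    ((c.contDiff_Θ.continuous_fderiv (by simp)).clm_apply continuous_const)

/-- The pairing of this gradient with the image of the `α`-th coordinate vector under the derivative
of `Φ` is one. -/
lemma grad_ne_zero (α : Fin (d + 1)) {ξ : E d} (hξ : ξ ∈ c.O) : c.grad α (c.Φ ξ) ≠ 0 := by
  intro h
  have h1 := c.inner_grad α (c.Φ ξ) (fderiv ℝ c.Φ ξ (EuclideanSpace.single α 1))
  have h2 := congrArg (fun T : E d →L[ℝ] E d => T (EuclideanSpace.single α 1)) (c.fderiv_comp hξ)
  simp only [ContinuousLinearMap.comp_apply, ContinuousLinearMap.id_apply] at h2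
  rw [h, h2] at h1
  simp at h1

/-- Parametrisation of a boundary face. -/
def bface (α : Fin (d + 1)) (b : Bool) (y : EuclideanSpace ℝ (Fin d)) : E d :=
  c.Φ (face α (faceVal b) y)

/-- A boundary face without its edges. -/
def bset (α : Fin (d + 1)) (b : Bool) : Set (E d) := c.bface α b '' ucube d

/-- The surface element of a boundary face. -/
def jac (α : Fin (d + 1)) (b : Bool) (y : EuclideanSpace ℝ (Fin d)) : ℝ :=
  |(fderiv ℝ c.Φ (face α (faceVal b) y)).det| * ‖c.grad α (c.bface α b y)‖

lemma face_mem {α : Fin (d + 1)} {b : Bool} {y : EuclideanSpace ℝ (Fin d)} (hy : y ∈ ccube d) :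
    face α (faceVal b) y ∈ closedCube d := face_mem_closedCube.2 ⟨faceVal_mem b, hy⟩

lemma face_mem_O {α : Fin (d + 1)} {b : Bool} {y : EuclideanSpace ℝ (Fin d)} (hy : y ∈ ccube d) :
    face α (faceVal b) y ∈ c.O := c.cube_subset (face_mem hy)

lemma contDiff_bface (α : Fin (d + 1)) (b : Bool) : ContDiff ℝ 1 (c.bface α b) :=
  c.contDiff_Φ.comp (contDiff_face α _)

lemma fderiv_bface (α : Fin (d + 1)) (b : Bool) (y : EuclideanSpace ℝ (Fin d)) :
    fderiv ℝ (c.bface α b) y = fderiv ℝ c.Φ (face α (faceVal b) y) ∘L faceLin α :=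
  ((c.contDiff_Φ.differentiable (by simp) _).hasFDerivAt.comp y (hasFDerivAt_face α _ y)).fderiv

lemma injOn_bface (α : Fin (d + 1)) (b : Bool) : Set.InjOn (c.bface α b) (ccube d) := by
  intro x hx y hy h
  have h1 := c.injOn (c.face_mem_O hx) (c.face_mem_O hy) h
  ext i
  simpa using congrArg (fun z : E d => z (α.succAbove i)) h1

lemma continuous_jac (α : Fin (d + 1)) (b : Bool) : Continuous (c.jac α b) :=
  ((c.continuous_det.comp (contDiff_face (n := 1) α _).continuous).abs).mul
    ((c.continuous_grad α).comp (c.contDiff_bface α b).continuous).norm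

lemma jac_eq (α : Fin (d + 1)) (b : Bool) {y : EuclideanSpace ℝ (Fin d)} (hy : y ∈ ccube d) :
    c.jac α b y
      = (fderiv ℝ (c.bface α b) y : EuclideanSpace ℝ (Fin d) →ₗ[ℝ] E d).normDet := by
  rw [fderiv_bface, normDet_comp_faceLin (c.fderiv_comp (c.face_mem_O hy)), jac,
    EuclideanSpace.norm_eq]
  simp [bface]

lemma jac_pos (α : Fin (d + 1)) (b : Bool) {y : EuclideanSpace ℝ (Fin d)} (hy : y ∈ ccube d) :
    0 < c.jac α b y :=
  mul_pos (abs_pos.2 (c.det_ne_zero (c.face_mem_O hy)))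
    (norm_pos_iff.2 (c.grad_ne_zero α (c.face_mem_O hy)))

lemma jac_nonneg (α : Fin (d + 1)) (b : Bool) (y : EuclideanSpace ℝ (Fin d)) : 0 ≤ c.jac α b y := by
  rw [jac]; positivity

lemma hausdorff_bface (α : Fin (d + 1)) (b : Bool) {S : Set (EuclideanSpace ℝ (Fin d))}
    (hS : MeasurableSet S) (hSc : S ⊆ ccube d) :
    Measure.euclideanHausdorffMeasure d (c.bface α b '' S)
      = ∫⁻ y in S, ENNReal.ofReal (c.jac α b y) := by
  refine area_formula (c.contDiff_bface α b) ((c.injOn_bface α b).mono hSc) (fun y hy => ?_)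
    (c.continuous_jac α b) (fun y hy => c.jac_eq α b (hSc hy)) hS
  rw [fderiv_bface]
  exact (c.fderiv_Φ_injective (c.face_mem_O (hSc hy))).comp (faceLin_injective α)

lemma measurableSet_bset (α : Fin (d + 1)) (b : Bool) : MeasurableSet (c.bset α b) :=
  (isOpen_ucube d).measurableSet.image_of_continuousOn_injOn
    (c.contDiff_bface α b).continuous.continuousOn
    ((c.injOn_bface α b).mono (ucube_subset_ccube d))

/-- The area formula on every measurable piece of a face says that the surface measure is the
push-forward of the density `jac`; integrals and null sets can then be handled in the parameter
cube. -/
lemma restrict_bset (α : Fin (d + 1)) (b : Bool) :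
    (Measure.euclideanHausdorffMeasure d).restrict (c.bset α b)
      = ((volume.restrict (ucube d)).withDensity fun y => ENNReal.ofReal (c.jac α b y)).map
        (c.bface α b) := by
  have hm : Measurable (c.bface α b) := (c.contDiff_bface α b).continuous.measurable
  ext B hB
  rw [Measure.map_apply hm hB, Measure.restrict_apply hB, withDensity_apply _ (hm hB),
    Measure.restrict_restrict (hm hB),
    ← c.hausdorff_bface α b ((hm hB).inter (isOpen_ucube d).measurableSet)
      (Set.inter_subset_right.trans (ucube_subset_ccube d)), Set.image_preimage_inter]
  rfl

lemma lintegral_bset (α : Fin (d + 1)) (b : Bool) {f : E d → ℝ≥0∞} (hf : Measurable f) :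
    ∫⁻ z in c.bset α b, f z ∂(Measure.euclideanHausdorffMeasure d)
      = ∫⁻ y in ucube d, ENNReal.ofReal (c.jac α b y) * f (c.bface α b y) := by
  have hm : Measurable (c.bface α b) := (c.contDiff_bface α b).continuous.measurable
  rw [restrict_bset, lintegral_map hf hm]
  exact lintegral_withDensity_eq_lintegral_mul _
    (c.continuous_jac α b).measurable.ennreal_ofReal (hf.comp hm)

lemma integral_bset (α : Fin (d + 1)) (b : Bool) {f : E d → ℝ} (hf : Measurable f) :
    ∫ z in c.bset α b, f z ∂(Measure.euclideanHausdorffMeasure d)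
      = ∫ y in ucube d, c.jac α b y * f (c.bface α b y) := by
  have hm : Measurable (c.bface α b) := (c.contDiff_bface α b).continuous.measurable
  rw [restrict_bset, integral_map hm.aemeasurable hf.aestronglyMeasurable,
    integral_withDensity_eq_integral_toReal_smul (c.continuous_jac α b).measurable.ennreal_ofReal
      (Eventually.of_forall fun _ => ENNReal.ofReal_lt_top)]
  simp only [ENNReal.toReal_ofReal (c.jac_nonneg α b _), smul_eq_mul]

/-- Almost everywhere statements on a boundary face can be checked in the parameter domain. -/
lemma ae_bset_iff (α : Fin (d + 1)) (b : Bool) {p : E d → Prop} :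
    (∀ᵐ z ∂(Measure.euclideanHausdorffMeasure d).restrict (c.bset α b), p z)
      ↔ ∀ᵐ y ∂(volume.restrict (ucube d)), p (c.bface α b y) := by
  have hm : Measurable (c.bface α b) := (c.contDiff_bface α b).continuous.measurable
  have hjac : ∀ᵐ y ∂(volume.restrict (ucube d)), ENNReal.ofReal (c.jac α b y) ≠ 0 :=
    (ae_restrict_iff' (isOpen_ucube d).measurableSet).2 (Eventually.of_forall fun y hy => by
      simpa using c.jac_pos α b (ucube_subset_ccube d hy))
  have hW : ∀ {q : EuclideanSpace ℝ (Fin d) → Prop}, (∀ᵐ y ∂((volume.restrict (ucube d)).withDensity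
      fun y => ENNReal.ofReal (c.jac α b y)), q y) ↔ ∀ᵐ y ∂(volume.restrict (ucube d)), q y := by
    intro q
    rw [ae_withDensity_iff (c.continuous_jac α b).measurable.ennreal_ofReal]
    constructor
    · intro h; filter_upwards [h, hjac] with y h1 h2 using h1 h2
    · intro h; filter_upwards [h] with y h1 _ using h1
  constructor
  · intro h
    rw [restrict_bset] at h
    exact hW.1 (ae_of_ae_map hm.aemeasurable h)
  · intro h
    rw [ae_restrict_iff' (c.measurableSet_bset α b), ae_iff]
    rw [ae_restrict_iff' (isOpen_ucube d).measurableSet, ae_iff] at h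
    -- The exceptional set need not be measurable, so it is enlarged to a measurable null set, whose
    -- image is null by the area formula.
    obtain ⟨N, hN, hNm, hN0⟩ := exists_measurable_superset_of_null h
    refine measure_mono_null (t := c.bface α b '' (N ∩ ucube d)) ?_ ?_
    · intro z hz
      simp only [Set.mem_ofPred_eq, Classical.not_imp] at hz
      obtain ⟨⟨y, hy, rfl⟩, hpz⟩ := hz
      exact ⟨y, ⟨hN (by simp only [Set.mem_ofPred_eq, Classical.not_imp]; exact ⟨hy, hpz⟩), hy⟩, rfl⟩
    · rw [c.hausdorff_bface α b (hNm.inter (isOpen_ucube d).measurableSet)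
        (Set.inter_subset_right.trans (ucube_subset_ccube d))]
      exact setLIntegral_measure_zero _ _ (measure_mono_null Set.inter_subset_left hN0)

lemma exists_face_eq {ξ : E d} (hξ : ξ ∈ closedCube d \ openCube d) :
    ∃ α b, ∃ y ∈ ccube d, ξ = face α (faceVal b) y := by
  obtain ⟨hc, ho⟩ := hξ
  have : ∃ α, ¬ (0 < ξ α ∧ ξ α < 1) := by
    by_contra h; push Not at h; exact ho h
  obtain ⟨α, hα⟩ := this
  have hξ : ξ = face α (ξ α) (WithLp.toLp 2 fun i => ξ (α.succAbove i)) := by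
    ext k; refine Fin.succAboveCases α ?_ (fun i => ?_) k <;> simp
  have hb : ∃ b, ξ α = faceVal b := by
    have := hc α
    rw [not_and_or, not_lt, not_lt] at hα
    rcases hα with h | h
    · exact ⟨false, by simp [faceVal]; linarith⟩
    · exact ⟨true, by simp [faceVal]; linarith⟩
  obtain ⟨b, hb⟩ := hb
  rw [hb] at hξ
  exact ⟨α, b, _, fun i => hc _, hξ⟩

lemma frontier_eq_iUnion :
    frontier c.dom = ⋃ p : Fin (d + 1) × Bool, c.bface p.1 p.2 '' ccube d := by
  rw [c.frontier_dom]
  ext z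
  simp only [Set.mem_iUnion, Set.mem_image]
  constructor
  · rintro ⟨ξ, hξ, rfl⟩
    obtain ⟨α, b, y, hy, rfl⟩ := exists_face_eq hξ
    exact ⟨(α, b), y, hy, rfl⟩
  · rintro ⟨⟨α, b⟩, y, hy, rfl⟩
    exact ⟨_, ⟨face_mem hy, fun h => faceVal_notMem b (face_mem_openCube.1 h).1⟩, rfl⟩

lemma bset_subset_frontier (α : Fin (d + 1)) (b : Bool) : c.bset α b ⊆ frontier c.dom := by
  rw [c.frontier_eq_iUnion]
  exact (Set.image_mono (ucube_subset_ccube d)).trans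
    (Set.subset_iUnion (fun p : Fin (d + 1) × Bool => c.bface p.1 p.2 '' ccube d) (α, b))

lemma disjoint_bset : Pairwise (Function.onFun Disjoint
    fun p : Fin (d + 1) × Bool => c.bset p.1 p.2) := by
  rintro ⟨α, b⟩ ⟨α', b'⟩ hne
  refine Set.disjoint_left.2 ?_
  rintro _ ⟨y, hy, rfl⟩ ⟨y', hy', h⟩
  have h1 := c.injOn (c.face_mem_O (ucube_subset_ccube d hy'))
    (c.face_mem_O (ucube_subset_ccube d hy)) h
  by_cases hα : α = α'
  · subst hα
    have := congrArg (fun z : E d => z α) h1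
    simp only [face_same] at this
    exact hne (by rw [faceVal_injective this])
  · obtain ⟨i, hi⟩ := Fin.exists_succAbove_eq hα
    have := congrArg (fun z : E d => z α) h1
    rw [← hi] at this
    simp only [face_succAbove] at this
    rw [hi, face_same] at this
    exact faceVal_notMem b (this ▸ hy' i)

/-- The part of the boundary missed by the open faces is covered by images of `ccube d \ ucube d`,
which the area formula shows to be null. Edges can thus be ignored and the faces are disjoint. -/
lemma surf_dom : surf c.dom
    = (Measure.euclideanHausdorffMeasure d).restrict (⋃ p : Fin (d + 1) × Bool, c.bset p.1 p.2) := by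
  refine Measure.restrict_congr_set ?_
  have h1 : (⋃ p : Fin (d + 1) × Bool, c.bset p.1 p.2) ⊆ frontier c.dom :=
    Set.iUnion_subset fun p => c.bset_subset_frontier p.1 p.2
  refine Filter.EventuallyLE.antisymm ?_ h1.eventuallyLE
  rw [ae_le_set]
  refine measure_mono_null (t := ⋃ p : Fin (d + 1) × Bool, c.bface p.1 p.2 '' (ccube d \ ucube d)) ?_ ?_
  · rintro z ⟨hz, hz'⟩
    rw [c.frontier_eq_iUnion, Set.mem_iUnion] at hz
    obtain ⟨p, y, hy, rfl⟩ := hz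
    refine Set.mem_iUnion.2 ⟨p, y, ⟨hy, fun h => hz' (Set.mem_iUnion.2 ⟨p, y, h, rfl⟩)⟩, rfl⟩
  · rw [measure_iUnion_null_iff]
    intro p
    rw [c.hausdorff_bface p.1 p.2 ((isClosed_ccube d).measurableSet.diff
      (isOpen_ucube d).measurableSet) Set.sdiff_subset]
    exact setLIntegral_measure_zero _ _ (volume_ccube_diff_ucube d)

lemma ae_surf_iff {p : E d → Prop} :
    (∀ᵐ z ∂(surf c.dom), p z)
      ↔ ∀ α b, ∀ᵐ y ∂(volume.restrict (ucube d)), p (c.bface α b y) := by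
  rw [surf_dom, ae_restrict_iUnion_iff]
  simp only [c.ae_bset_iff, Prod.forall]

lemma surf_univ_lt_top : surf c.dom Set.univ < ⊤ := by
  rw [surf, Measure.restrict_apply_univ, c.frontier_eq_iUnion]
  refine (measure_iUnion_fintype_le _ _).trans_lt (ENNReal.sum_lt_top.2 fun p _ => ?_)
  rw [c.hausdorff_bface p.1 p.2 (isClosed_ccube d).measurableSet le_rfl]
  have : IntegrableOn (c.jac p.1 p.2) (ccube d) :=
    (c.continuous_jac p.1 p.2).continuousOn.integrableOn_compact (isCompact_ccube d)
  exact this.lintegral_lt_top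

/-- The normal field on a boundary face. -/
def faceNormal (α : Fin (d + 1)) (b : Bool) (z : E d) : E d :=
  (faceSign b * ‖c.grad α z‖⁻¹) • c.grad α z

/-- Near an inner point of a face the other chart coordinates stay strictly between `0` and `1`, so
membership is decided by the side on which the `α`-th chart coordinate lies. Its first-order
expansion gives the half space orthogonal to the gradient. -/
lemma isOuterNormal_bface (α : Fin (d + 1)) (b : Bool) {y : EuclideanSpace ℝ (Fin d)}
    (hy : y ∈ ucube d) :
    IsOuterNormal c.dom (c.bface α b y) (c.faceNormal α b (c.bface α b y)) := by
  set ξ := face α (faceVal b) y with hξ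
  have hξO : ξ ∈ c.O := c.face_mem_O (ucube_subset_ccube d hy)
  set z₀ := c.bface α b y with hz₀
  have hΘ : c.Θ z₀ = ξ := c.left_inv ξ hξO
  have hg : 0 < ‖c.grad α z₀‖ := norm_pos_iff.2 (c.grad_ne_zero α hξO)
  have hsq : faceSign b * faceSign b = 1 := by cases b <;> simp [faceSign]
  have habs : |faceSign b| = 1 := by cases b <;> simp [faceSign]
  refine ⟨?_, fun ε hε => ?_⟩
  · rw [faceNormal, norm_smul, norm_mul, norm_inv, norm_norm, Real.norm_eq_abs, habs, one_mul,
      inv_mul_cancel₀ hg.ne']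
  have h1 := (c.hasFDerivAt_Θ_apply α z₀).isLittleO.def (mul_pos hε hg)
  have h2 : ∀ᶠ z in 𝓝 z₀, z ∈ c.Φ '' c.O :=
    (c.isOpen_image c.isOpen_O subset_rfl).mem_nhds ⟨ξ, hξO, rfl⟩
  have h3 : ∀ᶠ z in 𝓝 z₀, ∀ i, c.Θ z (α.succAbove i) ∈ Set.Ioo (0 : ℝ) 1 := by
    refine eventually_all.2 fun i => ?_
    refine (c.hasFDerivAt_Θ_apply (α.succAbove i) z₀).continuousAt.eventually_mem
      (Ioo_mem_nhds ?_ ?_) <;> rw [hΘ, hξ, face_succAbove]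
    exacts [(hy i).1, (hy i).2]
  -- This window excludes the opposite face, so a point outside the closed cube must have left
  -- through the face under consideration.
  have h4 : ∀ᶠ z in 𝓝 z₀, c.Θ z α ∈ Set.Ioo (faceVal b - 1) (faceVal b + 1) := by
    refine (c.hasFDerivAt_Θ_apply α z₀).continuousAt.eventually_mem
      (Ioo_mem_nhds ?_ ?_) <;> rw [hΘ, hξ, face_same] <;> linarith
  filter_upwards [h1, h2, h3, h4] with z hz1 hz2 hz3 hz4
  have hin : inner ℝ (z - z₀) (c.faceNormal α b z₀)
      = (faceSign b * inner ℝ (z - z₀) (c.grad α z₀)) * ‖c.grad α z₀‖⁻¹ := by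
    rw [faceNormal, inner_smul_right]; ring
  have e1 : c.Θ z₀ α = faceVal b := by rw [hΘ, hξ, face_same]
  rw [Real.norm_eq_abs, ContinuousLinearMap.comp_apply] at hz1
  change |c.Θ z α - c.Θ z₀ α - (fderiv ℝ c.Θ z₀ (z - z₀)) α| ≤ _ at hz1
  rw [← c.inner_grad, e1, ← one_mul |_|, ← habs, ← abs_mul] at hz1
  have hz1' := abs_le.1 hz1
  have e2 : faceSign b * (c.Θ z α - faceVal b - inner ℝ (z - z₀) (c.grad α z₀))
      = faceSign b * (c.Θ z α - faceVal b) - faceSign b * inner ℝ (z - z₀) (c.grad α z₀) := by ring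
  rw [e2] at hz1'
  rw [hin, ← div_eq_mul_inv, div_le_iff₀ hg, le_div_iff₀ hg]
  constructor
  · intro hzU
    have := (c.mem_dom_iff hz2).1 hzU α
    have : faceSign b * (c.Θ z α - faceVal b) ≤ 0 := by
      cases b <;> simp [faceSign, faceVal] <;> linarith
    linarith [hz1'.1]
  · intro hzU
    have : c.Θ z ∉ closedCube d := fun h => hzU (by
      rw [c.closure_dom]; exact ⟨_, h, c.right_inv hz2⟩)
    have h5 : ¬ (0 ≤ c.Θ z α ∧ c.Θ z α ≤ 1) := fun h => this (by
      simp only [closedCube, Set.mem_ofPred_eq, Fin.forall_iff_succAbove α]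
      exact ⟨h, fun i => ⟨(hz3 i).1.le, (hz3 i).2.le⟩⟩)
    have : 0 ≤ faceSign b * (c.Θ z α - faceVal b) := by
      rw [not_and_or, not_le, not_le] at h5
      have h6 := hz4.1
      have h7 := hz4.2
      cases b <;> simp [faceSign, faceVal] at h6 h7 ⊢ <;> rcases h5 with h | h <;> linarith
    linarith [hz1'.2]

lemma outerNormal_bface (α : Fin (d + 1)) (b : Bool) {y : EuclideanSpace ℝ (Fin d)}
    (hy : y ∈ ucube d) :
    outerNormal c.dom (c.bface α b y) = c.faceNormal α b (c.bface α b y) :=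
  (c.isOuterNormal_bface α b hy).outerNormal_eq

lemma ae_isOuterNormal : ∀ᵐ z ∂(surf c.dom), IsOuterNormal c.dom z (outerNormal c.dom z) := by
  refine c.ae_surf_iff.2 fun α b => (ae_restrict_iff' (isOpen_ucube d).measurableSet).2
    (Eventually.of_forall fun y hy => ?_)
  rw [c.outerNormal_bface α b hy]
  exact c.isOuterNormal_bface α b hy

lemma measurable_faceNormal (α : Fin (d + 1)) (b : Bool) (k : Fin (d + 1)) :
    Measurable fun z => c.faceNormal α b z k := by
  have h1 := (c.continuous_grad α).norm.measurable
  have h2 : Measurable fun z => c.grad α z k :=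
    ((PiLp.continuous_apply 2 _ k).comp (c.continuous_grad α)).measurable
  simp only [faceNormal, PiLp.smul_apply, smul_eq_mul]
  exact ((h1.inv).const_mul _).mul h2

lemma aestronglyMeasurable_outerNormal (k : Fin (d + 1)) :
    AEStronglyMeasurable (fun z => outerNormal c.dom z k) (surf c.dom) := by
  rw [surf_dom, aestronglyMeasurable_iUnion_iff]
  rintro ⟨α, b⟩
  refine (c.measurable_faceNormal α b k).aestronglyMeasurable.congr ?_
  refine (c.ae_bset_iff α b).2 ((ae_restrict_iff' (isOpen_ucube d).measurableSet).2
    (Eventually.of_forall fun y hy => ?_))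
  beta_reduce
  rw [c.outerNormal_bface α b hy]

end CubeChart

/-- The default value zero keeps the bound true where no normal exists. -/
lemma abs_outerNormal_le (U : Set (E d)) (z : E d) (k : Fin (d + 1)) :
    ‖outerNormal U z k‖ ≤ 1 := by
  refine (PiLp.norm_apply_le (outerNormal U z) k).trans ?_
  rw [outerNormal]
  split_ifs with h
  · exact h.choose_spec.1.le
  · simp

namespace CubeChart

variable (c : CubeChart d)

/-! ### Green's formula and the trace inequality -/

lemma pd_pullback {ζ : E d → ℝ} (hζ : ContDiff ℝ 1 ζ) (k : Fin (d + 1)) (z : E d) :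
    pd k (fun z => ζ (c.Θ z)) z = ∑ α, pd α ζ (c.Θ z) * c.grad α z k := by
  have h1 : HasFDerivAt (fun z => ζ (c.Θ z)) (fderiv ℝ ζ (c.Θ z) ∘L fderiv ℝ c.Θ z) z :=
    (hζ.differentiable (by simp) _).hasFDerivAt.comp z
      (c.contDiff_Θ.differentiable (by simp) z).hasFDerivAt
  rw [pd, h1.fderiv, ContinuousLinearMap.comp_apply]
  set w := fderiv ℝ c.Θ z (EuclideanSpace.single k 1) with hw
  have hw' : w = ∑ α, w α • EuclideanSpace.single α (1 : ℝ) := by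
    ext j; simp [Finset.sum_apply, Pi.single_apply]
  conv_lhs => rw [hw']
  rw [map_sum]
  refine Finset.sum_congr rfl fun α _ => ?_
  rw [map_smul, smul_eq_mul, mul_comm]; rfl

/-- The pull-back of a test function on the cube to a test function on the curved cube. -/
def pushTest (ζ : E d → ℝ) (z : E d) : ℝ := c.χ z * ζ (c.Θ z)

lemma pushTest_eq {ζ : E d → ℝ} {z : E d} (hz : z ∈ c.dom) : c.pushTest ζ z = ζ (c.Θ z) := by
  obtain ⟨ξ, hξ, rfl⟩ := hz
  rw [pushTest, c.χ_eq_one ξ (openCube_subset_closedCube d hξ), one_mul]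

lemma contDiff_pushTest {ζ : E d → ℝ} (hζ : ContDiff ℝ 1 ζ) : ContDiff ℝ 1 (c.pushTest ζ) :=
  c.contDiff_χ.mul (hζ.comp c.contDiff_Θ)

/-- Away from `Φ '' O` the extension `Θ` is not an inverse and `ζ ∘ Θ` may be nonzero; the cutoff
`χ` removes those values. -/
lemma support_pushTest (ζ : E d → ℝ) : Function.support (c.pushTest ζ) ⊆ c.Φ '' tsupport ζ := by
  intro z hz
  have h1 : c.χ z ≠ 0 := left_ne_zero_of_mul hz
  have h2 : ζ (c.Θ z) ≠ 0 := right_ne_zero_of_mul hz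
  exact ⟨c.Θ z, subset_tsupport _ h2, c.right_inv (c.χ_support h1)⟩

lemma tsupport_pushTest {ζ : E d → ℝ} (hζ : HasCompactSupport ζ) :
    tsupport (c.pushTest ζ) ⊆ c.Φ '' tsupport ζ :=
  closure_minimal (c.support_pushTest ζ)
    (hζ.isCompact.image c.contDiff_Φ.continuous).isClosed

lemma hasCompactSupport_pushTest {ζ : E d → ℝ} (hζ : HasCompactSupport ζ) :
    HasCompactSupport (c.pushTest ζ) :=
  (hζ.isCompact.image c.contDiff_Φ.continuous).of_isClosed_subset (isClosed_tsupport _)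
    (c.tsupport_pushTest hζ)

lemma pd_pushTest {ζ : E d → ℝ} (hζ : ContDiff ℝ 1 ζ) (k : Fin (d + 1)) {z : E d}
    (hz : z ∈ c.dom) : pd k (c.pushTest ζ) z = ∑ α, pd α ζ (c.Θ z) * c.grad α z k := by
  rw [← c.pd_pullback hζ, pd, pd]
  congr 1
  refine Filter.EventuallyEq.fderiv_eq ?_
  filter_upwards [c.isOpen_dom.mem_nhds hz] with x hx using c.pushTest_eq hx

/-- The Piola transform of a function in the direction `k`. -/
def piola (k : Fin (d + 1)) (W : E d → ℝ) (α : Fin (d + 1)) (ξ : E d) : ℝ :=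
  |(fderiv ℝ c.Φ ξ).det| * (W (c.Φ ξ) * c.grad α (c.Φ ξ) k)

lemma continuous_piola (k : Fin (d + 1)) {W : E d → ℝ} (hW : Continuous W) (α : Fin (d + 1)) :
    Continuous (c.piola k W α) :=
  c.continuous_det.abs.mul ((hW.comp c.contDiff_Φ.continuous).mul
    ((PiLp.continuous_apply 2 _ k).comp ((c.continuous_grad α).comp c.contDiff_Φ.continuous)))

/-- The gradient of the `α`-th chart coordinate is a multiple of the normal on the face, and its
length times the Jacobian determinant is the surface element. So the flux of the Piola field through
a face of the cube is the flux through the curved face. -/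
lemma piola_face (k : Fin (d + 1)) (W : E d → ℝ) (α : Fin (d + 1)) (b : Bool)
    {y : EuclideanSpace ℝ (Fin d)} (hy : y ∈ ucube d) :
    faceSign b * c.piola k W α (face α (faceVal b) y)
      = c.jac α b y * (W (c.bface α b y) * c.faceNormal α b (c.bface α b y) k) := by
  have h : ‖c.grad α (c.bface α b y)‖ ≠ 0 :=
    norm_ne_zero_iff.2 (c.grad_ne_zero α (c.face_mem_O (ucube_subset_ccube d hy)))
  rw [piola, jac, faceNormal, PiLp.smul_apply, smul_eq_mul]
  change _ * (_ * (W (c.bface α b y) * c.grad α (c.bface α b y) k)) = _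
  field_simp

lemma integral_surf_mul_outerNormal {W : E d → ℝ} (hW : Continuous W) (k : Fin (d + 1)) :
    ∫ z, W z * outerNormal c.dom z k ∂(surf c.dom)
      = ∑ α, ((∫ y in ucube d, c.piola k W α (face α 1 y))
        - ∫ y in ucube d, c.piola k W α (face α 0 y)) := by
  have hnm := c.aestronglyMeasurable_outerNormal k
  have hfin : IsFiniteMeasure (surf c.dom) := ⟨c.surf_univ_lt_top⟩
  have hK : IsCompact (frontier c.dom) :=
    c.isCompact_image.of_isClosed_subset isClosed_frontier
      (frontier_subset_closure.trans c.closure_dom.subset)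
  obtain ⟨B, hB⟩ := hK.exists_bound_of_continuousOn hW.continuousOn
  have hint : Integrable (fun z => W z * outerNormal c.dom z k) (surf c.dom) := by
    refine Integrable.of_bound (hW.aestronglyMeasurable.mul hnm) (B * 1) ?_
    refine (ae_restrict_iff' isClosed_frontier.measurableSet).2 (Eventually.of_forall fun z hz => ?_)
    rw [norm_mul]
    exact mul_le_mul (hB z hz) (abs_outerNormal_le _ _ _) (norm_nonneg _)
      ((norm_nonneg _).trans (hB z hz))
  rw [c.surf_dom] at hint ⊢
  rw [integral_iUnion_fintype (fun p => c.measurableSet_bset p.1 p.2) c.disjoint_bset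
    (fun p => hint.mono_measure (Measure.restrict_mono (Set.subset_iUnion (fun p : Fin (d + 1) × Bool => c.bset p.1 p.2) p) le_rfl))]
  have key : ∀ α b, ∫ z in c.bset α b, W z * outerNormal c.dom z k ∂(Measure.euclideanHausdorffMeasure d)
      = faceSign b * ∫ y in ucube d, c.piola k W α (face α (faceVal b) y) := by
    intro α b
    have h1 : (fun z => W z * outerNormal c.dom z k)
        =ᵐ[(Measure.euclideanHausdorffMeasure d).restrict (c.bset α b)]
        fun z => W z * c.faceNormal α b z k := by
      refine (c.ae_bset_iff α b).2 ((ae_restrict_iff' (isOpen_ucube d).measurableSet).2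
        (Eventually.of_forall fun y hy => ?_))
      beta_reduce
      rw [c.outerNormal_bface α b hy]
    have h2 : Measurable fun z => W z * c.faceNormal α b z k :=
      hW.measurable.mul (c.measurable_faceNormal α b k)
    rw [integral_congr_ae h1, c.integral_bset α b h2, ← integral_const_mul]
    exact setIntegral_congr_fun (isOpen_ucube d).measurableSet
      fun y hy => (c.piola_face k W α b hy).symm
  rw [Fintype.sum_prod_type]
  refine Finset.sum_congr rfl fun α _ => ?_
  rw [Fintype.sum_bool, key, key]
  simp [faceSign, faceVal, sub_eq_add_neg]

/-- The Piola field of `W e_k` is merely continuous because `Φ` is only `C¹`. Its weak divergence is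
nevertheless `|det Φ'| (g ∘ Φ)`, as one sees by transporting test functions from the cube to the
patch and changing variables; `cube_divergence` then applies. -/
theorem green {W w g : E d → ℝ} {k : Fin (d + 1)} (hW : Continuous W)
    (hwW : Set.EqOn w W c.dom) (hw : HasWeakPartial c.dom k w g) (hg : IntegrableOn g c.dom) :
    ∫ z in c.dom, g z = ∫ z, W z * outerNormal c.dom z k ∂(surf c.dom) := by
  rw [c.integral_surf_mul_outerNormal hW, c.setIntegral_dom]
  refine cube_divergence (fun α => c.continuous_piola k hW α) (c.integrableOn_dom.1 hg)
    fun ζ hζ hζc hζs => ?_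
  have hsub : tsupport (c.pushTest ζ) ⊆ c.dom :=
    (c.tsupport_pushTest hζc).trans (Set.image_mono hζs)
  have h := hw.integral_mul_pd c.isOpen_dom (c.contDiff_pushTest hζ) (c.hasCompactSupport_pushTest hζc) hsub
  rw [c.setIntegral_dom, c.setIntegral_dom] at h
  have hm := (isOpen_openCube d).measurableSet
  refine (setIntegral_congr_fun hm fun ξ hξ => ?_).trans (h.trans
    (congrArg Neg.neg (setIntegral_congr_fun hm fun ξ hξ => ?_)))
  · have hz : c.Φ ξ ∈ c.dom := ⟨ξ, hξ, rfl⟩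
    beta_reduce
    rw [hwW hz, c.pd_pushTest hζ k hz, c.left_inv ξ (c.openCube_subset hξ), Finset.mul_sum,
      Finset.mul_sum]
    refine Finset.sum_congr rfl fun α _ => ?_
    rw [piola]; ring
  · have hz : c.Φ ξ ∈ c.dom := ⟨ξ, hξ, rfl⟩
    beta_reduce
    rw [c.pushTest_eq hz, c.left_inv ξ (c.openCube_subset hξ), mul_assoc]

lemma setLIntegral_openCube_comp_le : ∃ C : ℝ≥0∞, C ≠ ⊤ ∧ ∀ F : E d → ℝ≥0∞,
    ∫⁻ ξ in openCube d, F (c.Φ ξ) ≤ C * ∫⁻ z in c.dom, F z := by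
  obtain ⟨ξ₀, hξ₀, hmin⟩ := (isCompact_closedCube d).exists_isMinOn
    (⟨0, fun α => by simp⟩ : (closedCube d).Nonempty) c.continuous_det.abs.continuousOn
  set m := |(fderiv ℝ c.Φ ξ₀).det| with hm
  have hm0 : 0 < m := abs_pos.2 (c.det_ne_zero (c.cube_subset hξ₀))
  refine ⟨(ENNReal.ofReal m)⁻¹, by simpa using hm0, fun F => ?_⟩
  have h0 : ENNReal.ofReal m ≠ 0 := by simpa using hm0
  rw [← ENNReal.div_eq_inv_mul, ENNReal.le_div_iff_mul_le (Or.inl h0) (Or.inl ENNReal.ofReal_ne_top),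
    mul_comm, dom, c.setLIntegral_image (isOpen_openCube d).measurableSet c.openCube_subset,
    ← lintegral_const_mul' _ _ ENNReal.ofReal_ne_top]
  refine setLIntegral_mono' (isOpen_openCube d).measurableSet fun ξ hξ => ?_
  gcongr
  exact hmin (openCube_subset_closedCube d hξ)

lemma lintegral_surf_le : ∃ C : ℝ≥0∞, C ≠ ⊤ ∧ ∀ F : E d → ℝ≥0∞, Measurable F →
    ∫⁻ z, F z ∂(surf c.dom)
      ≤ C * ∑ p : Fin (d + 1) × Bool, ∫⁻ y in ucube d, F (c.bface p.1 p.2 y) := by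
  have h1 : ∀ p : Fin (d + 1) × Bool, ∃ B : ℝ, ∀ y ∈ ccube d, c.jac p.1 p.2 y ≤ B := fun p => by
    obtain ⟨B, hB⟩ := (isCompact_ccube d).exists_bound_of_continuousOn
      (c.continuous_jac p.1 p.2).continuousOn
    exact ⟨B, fun y hy => (le_abs_self _).trans (hB y hy)⟩
  choose B hB using h1
  set M := ∑ p, ENNReal.ofReal (B p) with hM
  refine ⟨M, by simp [hM], fun F hF => ?_⟩
  rw [surf_dom, lintegral_iUnion (s := fun p : Fin (d + 1) × Bool => c.bset p.1 p.2)
    (fun p => c.measurableSet_bset p.1 p.2) c.disjoint_bset,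
    tsum_fintype, Finset.mul_sum]
  refine Finset.sum_le_sum fun p _ => ?_
  rw [c.lintegral_bset p.1 p.2 hF, ← lintegral_const_mul' _ _ (by simp [hM])]
  refine setLIntegral_mono' (isOpen_ucube d).measurableSet fun y hy => ?_
  gcongr
  exact (ENNReal.ofReal_le_ofReal (hB p y (ucube_subset_ccube d hy))).trans
    (Finset.single_le_sum (f := fun p => ENNReal.ofReal (B p)) (fun _ _ => zero_le)
      (Finset.mem_univ p))

lemma enorm_sq_pd_comp_le : ∃ C : ℝ≥0∞, C ≠ ⊤ ∧ ∀ φ : E d → ℝ, ContDiff ℝ 1 φ →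
    ∀ ξ ∈ closedCube d, ∀ α, ‖pd α (fun ξ => φ (c.Φ ξ)) ξ‖ₑ ^ 2
      ≤ C * ∑ k, ‖pd k φ (c.Φ ξ)‖ₑ ^ 2 := by
  obtain ⟨B, hB⟩ := (isCompact_closedCube d).exists_bound_of_continuousOn
    (c.contDiff_Φ.continuous_fderiv (by simp)).continuousOn
  refine ⟨ENNReal.ofReal (B ^ 2), by simp, fun φ hφ ξ hξ α => ?_⟩
  set w := fderiv ℝ c.Φ ξ (EuclideanSpace.single α 1) with hw
  have h1 : pd α (fun ξ => φ (c.Φ ξ)) ξ = fderiv ℝ φ (c.Φ ξ) w := by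
    have := ((hφ.differentiable (by simp) _).hasFDerivAt.comp ξ
      (c.contDiff_Φ.differentiable (by simp) ξ).hasFDerivAt).fderiv
    rw [pd]
    exact congrArg (fun T : E d →L[ℝ] ℝ => T (EuclideanSpace.single α 1)) this
  have hw' : w = ∑ k, w k • EuclideanSpace.single k (1 : ℝ) := by
    ext j; simp [Finset.sum_apply, Pi.single_apply]
  have h2 : fderiv ℝ φ (c.Φ ξ) w = ∑ k, w k * pd k φ (c.Φ ξ) := by
    conv_lhs => rw [hw']
    rw [map_sum]
    exact Finset.sum_congr rfl fun k _ => by rw [map_smul, smul_eq_mul]; rfl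
  have h3 : ‖w‖ ≤ B := by
    refine ((fderiv ℝ c.Φ ξ).le_opNorm _).trans ?_
    simpa using hB ξ hξ
  have h4 : ∑ k, w k ^ 2 ≤ B ^ 2 := by
    have := EuclideanSpace.real_norm_sq_eq w
    rw [← this]
    exact pow_le_pow_left₀ (norm_nonneg _) h3 2
  have e : ∀ x : ℝ, ‖x‖ₑ ^ 2 = ENNReal.ofReal (x ^ 2) := fun x => by
    rw [Real.enorm_eq_ofReal_abs, ← ENNReal.ofReal_pow (abs_nonneg _), sq_abs]
  simp only [e]
  rw [← ENNReal.ofReal_sum_of_nonneg (fun _ _ => sq_nonneg _), ← ENNReal.ofReal_mul (sq_nonneg _)]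
  refine ENNReal.ofReal_le_ofReal ?_
  rw [h1, h2]
  refine (Finset.sum_mul_sq_le_sq_mul_sq _ _ _).trans ?_
  exact mul_le_mul_of_nonneg_right h4 (Finset.sum_nonneg fun _ _ => sq_nonneg _)

/-- In the chart, volume, surface element and gradients change only by factors bounded on the closed
cube, so the estimate reduces to the faces of the cube. -/
theorem trace_ineq : ∃ C : ℝ≥0∞, C ≠ ⊤ ∧ ∀ φ : E d → ℝ, ContDiff ℝ 1 φ →
    ∫⁻ z, ‖φ z‖ₑ ^ 2 ∂(surf c.dom)
      ≤ C * ((∫⁻ z in c.dom, ‖φ z‖ₑ ^ 2) + ∑ k, ∫⁻ z in c.dom, ‖pd k φ z‖ₑ ^ 2) := by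
  obtain ⟨C₁, hC₁, h₁⟩ := c.setLIntegral_openCube_comp_le
  obtain ⟨C₂, hC₂, h₂⟩ := c.lintegral_surf_le
  obtain ⟨C₃, hC₃, h₃⟩ := c.enorm_sq_pd_comp_le
  have hN : (Fintype.card (Fin (d + 1) × Bool) : ℝ≥0∞) ≠ ⊤ := ENNReal.natCast_ne_top _
  refine ⟨C₂ * (Fintype.card (Fin (d + 1) × Bool) * (2 * ((1 + C₃) * C₁))), ?_, fun φ hφ => ?_⟩
  · exact ENNReal.mul_ne_top hC₂ (ENNReal.mul_ne_top hN (ENNReal.mul_ne_top (by simp)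
      (ENNReal.mul_ne_top (by simpa using hC₃) hC₁)))
  have hmp : ∀ k, Measurable fun z => ‖pd k φ z‖ₑ ^ 2 := fun k =>
    (pd_continuous hφ k).measurable.enorm.pow_const 2
  have hm0 : Measurable fun z => ‖φ z‖ₑ ^ 2 := hφ.continuous.measurable.enorm.pow_const 2
  have key : ∀ p : Fin (d + 1) × Bool, ∫⁻ y in ucube d, ‖φ (c.bface p.1 p.2 y)‖ₑ ^ 2
      ≤ 2 * ((1 + C₃) * C₁) * ((∫⁻ z in c.dom, ‖φ z‖ₑ ^ 2) + ∑ k, ∫⁻ z in c.dom, ‖pd k φ z‖ₑ ^ 2) := by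
    intro p
    refine (cube_trace_ineq (hφ.comp c.contDiff_Φ) p.1 (faceVal_mem p.2)).trans ?_
    rw [mul_assoc, mul_assoc]
    gcongr
    calc ∫⁻ ξ in openCube d, (‖(φ ∘ c.Φ) ξ‖ₑ ^ 2 + ‖pd p.1 (φ ∘ c.Φ) ξ‖ₑ ^ 2)
        ≤ ∫⁻ ξ in openCube d, (1 + C₃) * (‖φ (c.Φ ξ)‖ₑ ^ 2 + ∑ k, ‖pd k φ (c.Φ ξ)‖ₑ ^ 2) := by
          refine setLIntegral_mono' (isOpen_openCube d).measurableSet fun ξ hξ => ?_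
          have := h₃ φ hφ ξ (openCube_subset_closedCube d hξ) p.1
          rw [mul_add]
          refine add_le_add ?_ (this.trans ?_)
          · exact le_mul_of_one_le_left zero_le (le_add_right le_rfl)
          · gcongr; exact le_add_left le_rfl
      _ = (1 + C₃) * ∫⁻ ξ in openCube d, (‖φ (c.Φ ξ)‖ₑ ^ 2 + ∑ k, ‖pd k φ (c.Φ ξ)‖ₑ ^ 2) :=
          lintegral_const_mul' _ _ (by simpa using hC₃)
      _ ≤ (1 + C₃) * (C₁ * ∫⁻ z in c.dom, (‖φ z‖ₑ ^ 2 + ∑ k, ‖pd k φ z‖ₑ ^ 2)) := by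
          gcongr
          exact h₁ fun z => ‖φ z‖ₑ ^ 2 + ∑ k, ‖pd k φ z‖ₑ ^ 2
      _ = (1 + C₃) * (C₁ * ((∫⁻ z in c.dom, ‖φ z‖ₑ ^ 2) + ∑ k, ∫⁻ z in c.dom, ‖pd k φ z‖ₑ ^ 2)) := by
          rw [lintegral_add_left hm0, lintegral_finsetSum _ fun k _ => hmp k]
  refine (h₂ _ hm0).trans ?_
  rw [mul_assoc C₂]
  gcongr
  refine (Finset.sum_le_sum fun p _ => key p).trans ?_
  rw [Finset.sum_const, Finset.card_univ, nsmul_eq_mul, ← mul_assoc]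

end CubeChart

/-! ### Density of smooth functions -/

lemma exists_forall_eLpNorm_le {U : Set (E d)} (hU : MeasurableSet U) (hf : volume U ≠ ⊤)
    {ε : ℝ≥0∞} (hε : ε ≠ 0) : ∃ δ : ℝ, 0 < δ ∧ ∀ f : E d → ℝ, (∀ z ∈ U, |f z| ≤ δ) →
      eLpNorm f 2 (volume.restrict U) ≤ ε := by
  set V := (volume.restrict U) Set.univ ^ ((2 : ℝ≥0∞).toReal)⁻¹ with hV
  have hV' : V ≠ ⊤ := ENNReal.rpow_ne_top_of_nonneg (by simp) (by simpa using hf)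
  have ht : Tendsto (fun δ : ℝ => V * ENNReal.ofReal δ) (𝓝 0) (𝓝 (V * ENNReal.ofReal 0)) :=
    ENNReal.Tendsto.const_mul (ENNReal.continuous_ofReal.tendsto 0) (Or.inr hV')
  rw [ENNReal.ofReal_zero, mul_zero] at ht
  have h1 : ∀ᶠ δ : ℝ in 𝓝[>] 0, V * ENNReal.ofReal δ ≤ ε :=
    (ht.mono_left nhdsWithin_le_nhds).eventually (eventually_le_nhds (pos_iff_ne_zero.2 hε))
  obtain ⟨δ, hδ, hδ0⟩ := (h1.and self_mem_nhdsWithin).exists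
  refine ⟨δ, hδ0, fun f hf => le_trans (eLpNorm_le_of_ae_bound ?_) hδ⟩
  exact (ae_restrict_iff' hU).2 (Eventually.of_forall hf)

/-- Approximate `W` by a compactly supported continuous function, whose mollification converges
uniformly; contractivity of mollification controls the remainder. The three errors give the factor
`3`. -/
lemma exists_eLpNorm_moll_sub_le {U : Set (E d)} (hU : MeasurableSet U) (hf : volume U ≠ ⊤)
    {W : E d → ℝ} (hW : MemLp W 2 volume) {ε : ℝ≥0∞} (hε : ε ≠ 0) :
    ∃ r₀ > 0, ∀ b : ContDiffBump (0 : E d), b.rOut ≤ r₀ →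
      eLpNorm (moll b W - W) 2 (volume.restrict U) ≤ 3 * ε := by
  obtain ⟨ψ, hψc, hψ, hψcont, hψm⟩ := hW.exists_hasCompactSupport_eLpNorm_sub_le (by simp) hε
  obtain ⟨δ, hδ, hδU⟩ := exists_forall_eLpNorm_le hU hf hε
  obtain ⟨r₀, hr₀, h⟩ := exists_forall_norm_moll_sub_le hψcont hψc hδ
  refine ⟨r₀, hr₀, fun b hb => ?_⟩
  have hWl := hW.locallyIntegrable (by norm_num)
  have e : moll b W - W = (moll b (W - ψ) + (moll b ψ - ψ)) - (W - ψ) := by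
    rw [moll_sub b hWl hψcont.locallyIntegrable]; abel
  have hs : ∀ {w : E d → ℝ}, LocallyIntegrable w →
      AEStronglyMeasurable (moll b w) (volume.restrict U) := fun hw =>
    (contDiff_moll b hw).continuous.aestronglyMeasurable
  have hsub : LocallyIntegrable (W - ψ) := hWl.sub hψcont.locallyIntegrable
  have m1 := hs hsub
  have m2 : AEStronglyMeasurable (moll b ψ - ψ) (volume.restrict U) :=
    (hs hψcont.locallyIntegrable).sub hψcont.aestronglyMeasurable
  have m3 : AEStronglyMeasurable (W - ψ) volume := hW.1.sub hψcont.aestronglyMeasurable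
  rw [e]
  refine (eLpNorm_sub_le (m1.add m2) m3.restrict (by norm_num)).trans ?_
  have e3 : (3 : ℝ≥0∞) * ε = ε + ε + ε := by ring
  rw [e3]
  refine add_le_add ((eLpNorm_add_le m1 m2 (by norm_num)).trans (add_le_add ?_ ?_)) ?_
  · exact (eLpNorm_mono_measure _ Measure.restrict_le_self).trans ((eLpNorm_moll_le b m3).trans hψ)
  · exact hδU _ fun z _ => h b hb z
  · exact (eLpNorm_mono_measure _ Measure.restrict_le_self).trans hψ

/-! ### Dilation towards the centre of a patch -/

lemma eventually_forall_abs_le {K : Set (E d)} (hK : IsCompact K) {H : ℝ → E d → ℝ}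
    (hH : Continuous fun p : ℝ × E d => H p.1 p.2) {s₀ : ℝ} (h0 : ∀ ξ ∈ K, H s₀ ξ = 0) {ε : ℝ}
    (hε : 0 < ε) : ∀ᶠ s in 𝓝 s₀, ∀ ξ ∈ K, |H s ξ| ≤ ε := by
  refine hK.eventually_forall_of_forall_eventually fun ξ hξ => ?_
  have ht : Tendsto (fun p : ℝ × E d => |H p.1 p.2|) (𝓝 (s₀, ξ)) (𝓝 |H s₀ ξ|) :=
    hH.abs.tendsto (s₀, ξ)
  rw [h0 ξ hξ, abs_zero] at ht
  exact ht.eventually (eventually_le_nhds hε)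

/-- Dilation about the centre of the cube. -/
def dil (s : ℝ) (ξ : E d) : E d := (1 - s) • WithLp.toLp 2 (fun _ => (1 / 2 : ℝ)) + s • ξ

lemma dil_apply (s : ℝ) (ξ : E d) (α : Fin (d + 1)) : dil s ξ α = (1 - s) * (1 / 2) + s * ξ α := rfl

lemma dil_one (ξ : E d) : dil 1 ξ = ξ := by simp [dil]

lemma dil_mem_openCube {s : ℝ} (h0 : 0 < s) (h1 : s < 1) {ξ : E d} (hξ : ξ ∈ closedCube d) :
    dil s ξ ∈ openCube d := fun α => by
  rw [dil_apply]; constructor <;> nlinarith [hξ α]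

lemma continuous_dil : Continuous fun p : ℝ × E d => dil p.1 p.2 := by
  unfold dil; fun_prop

lemma hasFDerivAt_dil (s : ℝ) (ξ : E d) :
    HasFDerivAt (dil s) (s • ContinuousLinearMap.id ℝ (E d)) ξ :=
  ((hasFDerivAt_id ξ).const_smul s).const_add _

lemma contDiff_dil (s : ℝ) : ContDiff ℝ 1 (dil s : E d → E d) :=
  contDiff_const.add (contDiff_id.const_smul s)

/-- For `s > 1/2` the Jacobian of the dilation is at least `2^{-(d+1)}`, which makes the constant
independent of `s`. -/
lemma setLIntegral_dil_le {s : ℝ} (h0 : 1 / 2 < s) (h1 : s < 1) (F : E d → ℝ≥0∞) :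
    ∫⁻ ξ in openCube d, F (dil s ξ) ≤ 2 ^ (d + 1) * ∫⁻ ξ in openCube d, F ξ := by
  have hs : 0 < s := by linarith
  have hinj : Function.Injective (dil s : E d → E d) := fun x y h => by
    have := add_left_cancel h
    exact smul_right_injective (E d) hs.ne' this
  have hsub : (dil s : E d → E d) '' openCube d ⊆ openCube d := by
    rintro _ ⟨ξ, hξ, rfl⟩; exact dil_mem_openCube hs h1 (openCube_subset_closedCube d hξ)
  have h := lintegral_image_eq_lintegral_abs_det_fderiv_mul volume
    (isOpen_openCube d).measurableSet (fun ξ _ => (hasFDerivAt_dil s ξ).hasFDerivWithinAt)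
    hinj.injOn F
  have hdet : (s • ContinuousLinearMap.id ℝ (E d)).det = s ^ (d + 1) := by
    rw [ContinuousLinearMap.det]
    simp
  simp only [hdet] at h
  have hle : (1 : ℝ≥0∞) ≤ 2 ^ (d + 1) * ENNReal.ofReal |s ^ (d + 1)| := by
    rw [abs_of_pos (by positivity), ENNReal.ofReal_pow hs.le, ← mul_pow]
    refine one_le_pow₀ ?_
    have : (2 : ℝ≥0∞) = ENNReal.ofReal 2 := by simp
    rw [this, ← ENNReal.ofReal_mul (by norm_num), ← ENNReal.ofReal_one]
    exact ENNReal.ofReal_le_ofReal (by linarith)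
  calc ∫⁻ ξ in openCube d, F (dil s ξ)
      ≤ ∫⁻ ξ in openCube d, 2 ^ (d + 1) * (ENNReal.ofReal |s ^ (d + 1)| * F (dil s ξ)) := by
        refine lintegral_mono fun ξ => ?_
        rw [← mul_assoc]
        exact le_mul_of_one_le_left zero_le hle
    _ = 2 ^ (d + 1) * ∫⁻ ξ in (dil s : E d → E d) '' openCube d, F ξ := by
        rw [lintegral_const_mul' _ _ (by simp), h]
    _ ≤ _ := by gcongr

namespace CubeChart

variable (c : CubeChart d)

lemma volume_dom_ne_top : volume c.dom ≠ ⊤ := c.isBounded_dom.measure_lt_top.ne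

/-- Dilation in the chart. -/
def shrink (s : ℝ) (z : E d) : E d := c.Φ (dil s (c.Θ z))

lemma contDiff_shrink (s : ℝ) : ContDiff ℝ 1 (c.shrink s) :=
  c.contDiff_Φ.comp ((contDiff_dil s).comp c.contDiff_Θ)

lemma shrink_mem (s : ℝ) {z : E d} (hz : z ∈ c.dom) :
    c.shrink s z ∈ c.Φ '' (dil s '' closedCube d) := by
  obtain ⟨ξ, hξ, rfl⟩ := hz
  exact ⟨_, ⟨ξ, openCube_subset_closedCube d hξ, rfl⟩, by
    rw [shrink, c.left_inv ξ (c.openCube_subset hξ)]⟩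

lemma image_dil_subset {s : ℝ} (h0 : 0 < s) (h1 : s < 1) :
    c.Φ '' (dil s '' closedCube d) ⊆ c.dom := by
  rintro _ ⟨_, ⟨ξ, hξ, rfl⟩, rfl⟩
  exact ⟨_, dil_mem_openCube h0 h1 hξ, rfl⟩

lemma isCompact_image_dil (s : ℝ) : IsCompact (c.Φ '' (dil s '' closedCube d)) :=
  ((isCompact_closedCube d).image (contDiff_dil s).continuous).image c.contDiff_Φ.continuous

lemma eLpNorm_comp_shrink_le : ∃ C : ℝ≥0∞, C ≠ ⊤ ∧ ∀ s : ℝ, 1 / 2 < s → s < 1 → ∀ F : E d → ℝ,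
    eLpNorm (F ∘ c.shrink s) 2 (volume.restrict c.dom) ≤ C * eLpNorm F 2 (volume.restrict c.dom) := by
  obtain ⟨C₁, hC₁, h₁⟩ := c.setLIntegral_openCube_comp_le
  obtain ⟨B, hB⟩ := (isCompact_closedCube d).exists_bound_of_continuousOn c.continuous_det.continuousOn
  set C := ENNReal.ofReal B * (2 ^ (d + 1) * C₁) with hC
  have hC' : C ≠ ⊤ := ENNReal.mul_ne_top (by simp) (ENNReal.mul_ne_top (by simp) hC₁)
  -- The factor `1 + C` replaces `√C`, since `C ≤ (1 + C)²`.
  refine ⟨1 + C, by simpa using hC', fun s h0 h1 F => ?_⟩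
  have key : ∫⁻ z in c.dom, ‖F (c.shrink s z)‖ₑ ^ 2 ≤ C * ∫⁻ z in c.dom, ‖F z‖ₑ ^ 2 := by
    have hm := (isOpen_openCube d).measurableSet
    calc ∫⁻ z in c.dom, ‖F (c.shrink s z)‖ₑ ^ 2
        = ∫⁻ ξ in openCube d, ENNReal.ofReal |(fderiv ℝ c.Φ ξ).det| * ‖F (c.shrink s (c.Φ ξ))‖ₑ ^ 2 := by
          rw [dom, c.setLIntegral_image hm c.openCube_subset]
      _ ≤ ∫⁻ ξ in openCube d, ENNReal.ofReal B * ‖F (c.Φ (dil s ξ))‖ₑ ^ 2 := by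
          refine setLIntegral_mono' hm fun ξ hξ => ?_
          rw [shrink, c.left_inv ξ (c.openCube_subset hξ)]
          gcongr
          exact hB ξ (openCube_subset_closedCube d hξ)
      _ = ENNReal.ofReal B * ∫⁻ ξ in openCube d, ‖F (c.Φ (dil s ξ))‖ₑ ^ 2 :=
          lintegral_const_mul' _ _ (by simp)
      _ ≤ ENNReal.ofReal B * (2 ^ (d + 1) * (C₁ * ∫⁻ z in c.dom, ‖F z‖ₑ ^ 2)) := by
          gcongr
          refine (setLIntegral_dil_le h0 h1 fun ξ => ‖F (c.Φ ξ)‖ₑ ^ 2).trans ?_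
          gcongr
          exact h₁ fun z => ‖F z‖ₑ ^ 2
      _ = C * ∫⁻ z in c.dom, ‖F z‖ₑ ^ 2 := by rw [hC]; ring
  have h2 : eLpNorm (F ∘ c.shrink s) 2 (volume.restrict c.dom) ^ 2
      ≤ ((1 + C) * eLpNorm F 2 (volume.restrict c.dom)) ^ 2 := by
    rw [mul_pow, eLpNorm_two_sq, eLpNorm_two_sq]
    refine key.trans ?_
    gcongr
    calc C ≤ 1 + C := le_add_self
      _ ≤ (1 + C) ^ 2 := le_self_pow₀ le_self_add (by norm_num)
  exact (ENNReal.pow_le_pow_left_iff (by norm_num)).1 h2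

lemma eventually_dist_shrink_le {ε : ℝ} (hε : 0 < ε) :
    ∀ᶠ s in 𝓝 (1 : ℝ), ∀ z ∈ c.dom, dist (c.shrink s z) z ≤ ε := by
  have h := eventually_forall_abs_le (isCompact_closedCube d)
    (H := fun s ξ => dist (c.Φ (dil s ξ)) (c.Φ ξ)) (s₀ := 1)
    ((c.contDiff_Φ.continuous.comp continuous_dil).dist
      (c.contDiff_Φ.continuous.comp continuous_snd)) (fun ξ _ => by simp [dil_one]) hε
  filter_upwards [h] with s hs z hz
  obtain ⟨ξ, hξ, rfl⟩ := hz
  rw [shrink, c.left_inv ξ (c.openCube_subset hξ)]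
  exact (le_abs_self _).trans (hs ξ (openCube_subset_closedCube d hξ))

/-- Strong continuity of the dilations in `L²`: they are uniformly bounded there, and on a compactly
supported continuous function they converge uniformly. -/
lemma eventually_eLpNorm_comp_shrink_sub_le : ∃ C : ℝ≥0∞, C ≠ ⊤ ∧ ∀ h : E d → ℝ, Measurable h →
    MemLp h 2 (volume.restrict c.dom) → ∀ ε : ℝ≥0∞, ε ≠ 0 → ∀ᶠ s in 𝓝[<] (1 : ℝ),
      eLpNorm (h ∘ c.shrink s - h) 2 (volume.restrict c.dom) ≤ C * ε := by
  obtain ⟨C, hC, hCs⟩ := c.eLpNorm_comp_shrink_le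
  refine ⟨C + 1 + 1, by simpa using hC, fun h hm hL ε hε => ?_⟩
  obtain ⟨ψ, hψc, hψ, hψcont, hψm⟩ := hL.exists_hasCompactSupport_eLpNorm_sub_le (by simp) hε
  obtain ⟨δ, hδ, hδU⟩ := exists_forall_eLpNorm_le c.isOpen_dom.measurableSet c.volume_dom_ne_top hε
  obtain ⟨r, hr, hu⟩ := Metric.uniformContinuous_iff.1
    (hψc.uniformContinuous_of_continuous hψcont) δ hδ
  have hhalf : ∀ᶠ s in 𝓝[<] (1 : ℝ), 1 / 2 < s :=
    (eventually_gt_nhds (by norm_num)).filter_mono nhdsWithin_le_nhds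
  filter_upwards [(c.eventually_dist_shrink_le (half_pos hr)).filter_mono nhdsWithin_le_nhds,
    self_mem_nhdsWithin, hhalf] with s hs h1 h0
  have hS := (c.contDiff_shrink s).continuous
  have e : h ∘ c.shrink s - h = ((h - ψ) ∘ c.shrink s + (ψ ∘ c.shrink s - ψ)) - (h - ψ) := by
    ext z; simp
  have m3 : AEStronglyMeasurable (h - ψ) (volume.restrict c.dom) :=
    (hm.sub hψcont.measurable).aestronglyMeasurable
  have m1 : AEStronglyMeasurable ((h - ψ) ∘ c.shrink s) (volume.restrict c.dom) :=
    ((hm.sub hψcont.measurable).comp hS.measurable).aestronglyMeasurable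
  have m2 : AEStronglyMeasurable (ψ ∘ c.shrink s - ψ) (volume.restrict c.dom) :=
    ((hψcont.comp hS).sub hψcont).aestronglyMeasurable
  rw [e, add_mul, add_mul, one_mul]
  refine (eLpNorm_sub_le (m1.add m2) m3 (by norm_num)).trans
    (add_le_add ((eLpNorm_add_le m1 m2 (by norm_num)).trans (add_le_add ?_ ?_)) hψ)
  · exact (hCs s h0 h1 _).trans (by gcongr)
  · refine hδU _ fun z hz => ?_
    exact (hu ((hs z hz).trans_lt (half_lt_self hr))).le

/-- The entries of the Jacobian of `shrink`. -/
def shrinkJac (s : ℝ) (j k : Fin (d + 1)) (z : E d) : ℝ := pd k (fun z => c.shrink s z j) z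

lemma shrinkJac_eq (s : ℝ) (j k : Fin (d + 1)) (z : E d) : c.shrinkJac s j k z
    = fderiv ℝ c.Φ (dil s (c.Θ z)) (s • fderiv ℝ c.Θ z (EuclideanSpace.single k 1)) j := by
  have h1 : HasFDerivAt (c.shrink s) (fderiv ℝ c.Φ (dil s (c.Θ z)) ∘L
      ((s • ContinuousLinearMap.id ℝ (E d)) ∘L fderiv ℝ c.Θ z)) z :=
    (c.contDiff_Φ.differentiable (by simp) _).hasFDerivAt.comp z ((hasFDerivAt_dil s _).comp z
      (c.contDiff_Θ.differentiable (by simp) z).hasFDerivAt)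
  have h2 := (EuclideanSpace.proj (𝕜 := ℝ) j).hasFDerivAt.comp z h1
  rw [shrinkJac, pd, show (fun z => c.shrink s z j)
    = (EuclideanSpace.proj (𝕜 := ℝ) j : E d →L[ℝ] ℝ) ∘ c.shrink s from rfl, h2.fderiv]
  simp

lemma continuous_shrinkJac (s : ℝ) (j k : Fin (d + 1)) : Continuous (c.shrinkJac s j k) :=
  pd_continuous ((EuclideanSpace.proj (𝕜 := ℝ) j : E d →L[ℝ] ℝ).contDiff.comp (c.contDiff_shrink s)) k

lemma eventually_shrinkJac {ε : ℝ} (hε : 0 < ε) (j k : Fin (d + 1)) : ∀ᶠ s in 𝓝 (1 : ℝ),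
    ∀ z ∈ c.dom, |c.shrinkJac s j k z - if j = k then 1 else 0| ≤ ε := by
  have hcont : Continuous fun p : ℝ × E d => fderiv ℝ c.Φ (dil p.1 p.2)
      (p.1 • fderiv ℝ c.Θ (c.Φ p.2) (EuclideanSpace.single k 1)) := by
    refine ((c.contDiff_Φ.continuous_fderiv (by simp)).comp continuous_dil).clm_apply
      (continuous_fst.smul ?_)
    exact (((c.contDiff_Θ.continuous_fderiv (by simp)).comp
      (c.contDiff_Φ.continuous.comp continuous_snd))).clm_apply continuous_const
  have h := eventually_forall_abs_le (isCompact_closedCube d)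
    (H := fun s ξ => fderiv ℝ c.Φ (dil s ξ)
      (s • fderiv ℝ c.Θ (c.Φ ξ) (EuclideanSpace.single k 1)) j - if j = k then 1 else 0) (s₀ := 1)
    (((PiLp.continuous_apply 2 _ j).comp hcont).sub continuous_const) (fun ξ hξ => ?_) hε
  · filter_upwards [h] with s hs z hz
    obtain ⟨ξ, hξ, rfl⟩ := hz
    rw [shrinkJac_eq, c.left_inv ξ (c.openCube_subset hξ)]
    exact hs ξ (openCube_subset_closedCube d hξ)
  · have h1 : fderiv ℝ c.Φ ξ (fderiv ℝ c.Θ (c.Φ ξ) (EuclideanSpace.single k 1))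
        = EuclideanSpace.single k 1 := by
      obtain ⟨w, hw⟩ := c.fderiv_Φ_surjective (c.cube_subset hξ) (EuclideanSpace.single k 1)
      have h2 := congrArg (fun T : E d →L[ℝ] E d => T w) (c.fderiv_comp (c.cube_subset hξ))
      simp only [ContinuousLinearMap.comp_apply, ContinuousLinearMap.id_apply] at h2
      rw [← hw, h2]
    simp only [dil_one, one_smul, h1]
    simp

lemma pd_comp_shrink {φ : E d → ℝ} (hφ : ContDiff ℝ 1 φ) (s : ℝ) (k : Fin (d + 1)) (z : E d) :
    pd k (φ ∘ c.shrink s) z = ∑ j, pd j φ (c.shrink s z) * c.shrinkJac s j k z := by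
  have hS := (c.contDiff_shrink s).differentiable (by simp) z
  have h1 := (hφ.differentiable (by simp) _).hasFDerivAt.comp z hS.hasFDerivAt
  set v := fderiv ℝ (c.shrink s) z (EuclideanSpace.single k 1) with hv
  have hv' : v = ∑ j, v j • EuclideanSpace.single j (1 : ℝ) := by
    ext j; simp [Finset.sum_apply, Pi.single_apply]
  have h2 : ∀ j, c.shrinkJac s j k z = v j := fun j => by
    have := (EuclideanSpace.proj (𝕜 := ℝ) j).hasFDerivAt.comp z hS.hasFDerivAt
    rw [shrinkJac, pd, show (fun z => c.shrink s z j)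
      = (EuclideanSpace.proj (𝕜 := ℝ) j : E d →L[ℝ] ℝ) ∘ c.shrink s from rfl, this.fderiv]
    rfl
  rw [pd, h1.fderiv, ContinuousLinearMap.comp_apply, ← hv]
  conv_lhs => rw [hv']
  rw [map_sum]
  exact Finset.sum_congr rfl fun j _ => by rw [map_smul, smul_eq_mul, h2, mul_comm]; rfl

/-- The derivative of a mollification is the mollified weak derivative only away from the boundary.
Composing with `shrink s` evaluates it only on a compact subset of the patch, and for `s` close to
`1` the composition is close to the identity together with its Jacobian. Restricting to `ε ≤ 1`
bounds the Jacobian entries by `2`. -/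
lemma exists_contDiff_approx {w : E d → ℝ} {g : Fin (d + 1) → E d → ℝ} (hwm : Measurable w)
    (hgm : ∀ k, Measurable (g k)) (hw : MemLp w 2 (volume.restrict c.dom))
    (hg : ∀ k, MemLp (g k) 2 (volume.restrict c.dom))
    (hwg : ∀ k, HasWeakPartial c.dom k w (g k)) :
    ∃ C : ℝ≥0∞, C ≠ ⊤ ∧ ∀ ε : ℝ≥0∞, ε ≠ 0 → ε ≤ 1 → ∃ f : E d → ℝ, ContDiff ℝ 1 f ∧
      eLpNorm (f - w) 2 (volume.restrict c.dom) ≤ C * ε ∧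
      ∀ k, eLpNorm (pd k f - g k) 2 (volume.restrict c.dom) ≤ C * ε := by
  obtain ⟨C₁, hC₁, h₁⟩ := c.eLpNorm_comp_shrink_le
  obtain ⟨C₂, hC₂, h₂⟩ := c.eventually_eLpNorm_comp_shrink_sub_le
  set A := ∑ j, (2 * (C₁ * 3) + C₁ * eLpNorm (g j) 2 (volume.restrict c.dom)) with hA
  have hA' : A ≠ ⊤ := by
    refine (ENNReal.sum_lt_top.2 fun j _ => ?_).ne
    exact ENNReal.add_lt_top.2 ⟨ENNReal.mul_lt_top (by simp)
      (ENNReal.mul_lt_top hC₁.lt_top (by simp)), ENNReal.mul_lt_top hC₁.lt_top (hg j).2⟩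
  refine ⟨(C₁ * 3 + C₂) + (A + C₂), by
    simp [hA', hC₂, ENNReal.mul_eq_top, hC₁], fun ε hε hε1 => ?_⟩
  have hεt : ε ≠ ⊤ := ne_top_of_le_ne_top ENNReal.one_ne_top hε1
  have hmU := c.isOpen_dom.measurableSet
  have hhalf : ∀ᶠ s in 𝓝[<] (1 : ℝ), 1 / 2 < s :=
    (eventually_gt_nhds (by norm_num)).filter_mono nhdsWithin_le_nhds
  have hJ : ∀ᶠ s in 𝓝[<] (1 : ℝ), ∀ j k, ∀ z ∈ c.dom,
      |c.shrinkJac s j k z - if j = k then 1 else 0| ≤ ε.toReal :=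
    eventually_all.2 fun j => eventually_all.2 fun k =>
      (c.eventually_shrinkJac (ENNReal.toReal_pos hε hεt) j k).filter_mono nhdsWithin_le_nhds
  obtain ⟨s, ⟨⟨⟨⟨h0, h1⟩, hJ⟩, hsw⟩, hsg⟩⟩ := ((((hhalf.and self_mem_nhdsWithin).and hJ).and
    (h₂ w hwm hw ε hε)).and (eventually_all.2 fun j => h₂ (g j) (hgm j) (hg j) ε hε)).exists
  have hs0 : 0 < s := by linarith
  set W := c.dom.indicator w with hW
  set G := fun j => c.dom.indicator (g j) with hG
  have hWL : MemLp W 2 volume := (memLp_indicator_iff_restrict hmU).2 hw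
  have hGL : ∀ j, MemLp (G j) 2 volume := fun j => (memLp_indicator_iff_restrict hmU).2 (hg j)
  have hWl : LocallyIntegrable W := hWL.locallyIntegrable (by norm_num)
  have hGl : ∀ j, LocallyIntegrable (G j) := fun j => (hGL j).locallyIntegrable (by norm_num)
  obtain ⟨r, hr, hrW⟩ := exists_eLpNorm_moll_sub_le hmU c.volume_dom_ne_top hWL hε
  choose r' hr' hrG using fun j => exists_eLpNorm_moll_sub_le hmU c.volume_dom_ne_top (hGL j) hε
  -- The dilation is fixed before the mollification radius, which must stay below the distance from
  -- the shrunken patch to the boundary.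
  obtain ⟨δ, hδ, hδU⟩ := (c.isCompact_image_dil s).exists_cthickening_subset_open c.isOpen_dom
    (c.image_dil_subset hs0 h1)
  obtain ⟨R, hR, hRr, hRδ, hRr'⟩ : ∃ R > 0, R ≤ r ∧ R ≤ δ ∧ ∀ k, R ≤ r' k := by
    obtain ⟨m, hm⟩ := Finite.exists_min r'
    exact ⟨min r (min δ (r' m)), lt_min hr (lt_min hδ (hr' m)), min_le_left _ _,
      (min_le_right _ _).trans (min_le_left _ _),
      fun k => ((min_le_right _ _).trans (min_le_right _ _)).trans (hm k)⟩
  set b := bump d R hR with hb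
  have hbR : b.rOut = R := rfl
  have hS := (c.contDiff_shrink s).continuous
  have hmollW := contDiff_moll b hWl
  have hSdom : ∀ z ∈ c.dom, c.shrink s z ∈ c.dom := fun z hz =>
    c.image_dil_subset hs0 h1 (c.shrink_mem s hz)
  have hpd : ∀ z ∈ c.dom, ∀ j, pd j (moll b W) (c.shrink s z) = moll b (G j) (c.shrink s z) := by
    intro z hz j
    refine (hwg j).pd_moll hmU hWl b ?_
    refine (Metric.closedBall_subset_cthickening (c.shrink_mem s hz) _).trans
      ((Metric.cthickening_mono ?_ _).trans hδU)
    rwa [hbR]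
  have hcomp : ∀ {F : E d → ℝ} {a : ℝ≥0∞}, eLpNorm F 2 (volume.restrict c.dom) ≤ 3 * a →
      eLpNorm (F ∘ c.shrink s) 2 (volume.restrict c.dom) ≤ C₁ * 3 * a := fun h => by
    rw [mul_assoc]
    exact (h₁ s h0 h1 _).trans (by gcongr)
  refine ⟨moll b W ∘ c.shrink s, (hmollW.of_le (by simp)).comp (c.contDiff_shrink s), ?_, fun k => ?_⟩
  · have e : moll b W ∘ c.shrink s - w =ᵐ[volume.restrict c.dom]
        (moll b W - W) ∘ c.shrink s + (w ∘ c.shrink s - w) := by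
      refine (ae_restrict_iff' hmU).2 (Eventually.of_forall fun z hz => ?_)
      simp [hW, Set.indicator_of_mem (hSdom z hz)]
    rw [eLpNorm_congr_ae e]
    have m1 : AEStronglyMeasurable ((moll b W - W) ∘ c.shrink s) (volume.restrict c.dom) :=
      ((hmollW.continuous.measurable.sub (hwm.indicator hmU)).comp hS.measurable).aestronglyMeasurable
    have m2 : AEStronglyMeasurable (w ∘ c.shrink s - w) (volume.restrict c.dom) :=
      ((hwm.comp hS.measurable).sub hwm).aestronglyMeasurable
    refine (eLpNorm_add_le m1 m2 (by norm_num)).trans ?_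
    calc _ ≤ C₁ * 3 * ε + C₂ * ε := add_le_add (hcomp (hrW b (hbR.trans_le hRr))) hsw
      _ = (C₁ * 3 + C₂) * ε := by ring
      _ ≤ _ := mul_le_mul' le_self_add le_rfl
  -- The error of the derivative has three parts: mollification (`P`), the deviation of the Jacobian
  -- from the identity (`R'`), and the effect of the dilation on `g k` itself.
  · set P := fun j => fun z => (moll b (G j) - G j) (c.shrink s z) * c.shrinkJac s j k z with hP
    set R' := fun j => fun z => g j (c.shrink s z) * (c.shrinkJac s j k z - if j = k then 1 else 0)
      with hR'
    have e : pd k (moll b W ∘ c.shrink s) - g k =ᵐ[volume.restrict c.dom]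
        (∑ j, (P j + R' j)) + (g k ∘ c.shrink s - g k) := by
      refine (ae_restrict_iff' hmU).2 (Eventually.of_forall fun z hz => ?_)
      have e1 : ∑ j, (P j + R' j) z = ∑ j, moll b (G j) (c.shrink s z) * c.shrinkJac s j k z
          - g k (c.shrink s z) := by
        have : g k (c.shrink s z) = ∑ j, g j (c.shrink s z) * if j = k then 1 else 0 := by simp
        rw [this, ← Finset.sum_sub_distrib]
        refine Finset.sum_congr rfl fun j _ => ?_
        simp only [hP, hR', hG, Pi.add_apply, Pi.sub_apply, Set.indicator_of_mem (hSdom z hz)]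
        ring
      simp only [Pi.sub_apply, Pi.add_apply, Finset.sum_apply, Function.comp_apply] at e1 ⊢
      rw [e1, c.pd_comp_shrink (hmollW.of_le (by simp))]
      simp only [hpd z hz]
      ring
    have mJ := fun j => (c.continuous_shrinkJac s j k).measurable
    have mG : ∀ j, Measurable (G j) := fun j => (hgm j).indicator hmU
    have mP : ∀ j, AEStronglyMeasurable (P j) (volume.restrict c.dom) := fun j =>
      ((((contDiff_moll b (hGl j)).continuous.measurable.sub (mG j)).comp hS.measurable).mul
        (mJ j)).aestronglyMeasurable
    have mR : ∀ j, AEStronglyMeasurable (R' j) (volume.restrict c.dom) := fun j =>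
      (((hgm j).comp hS.measurable).mul ((mJ j).sub_const _)).aestronglyMeasurable
    have m2 : AEStronglyMeasurable (g k ∘ c.shrink s - g k) (volume.restrict c.dom) :=
      (((hgm k).comp hS.measurable).sub (hgm k)).aestronglyMeasurable
    have ms : AEStronglyMeasurable (∑ j, (P j + R' j)) (volume.restrict c.dom) :=
      Finset.aestronglyMeasurable_sum _ fun j _ => (mP j).add (mR j)
    have nP : ∀ j, eLpNorm (P j) 2 (volume.restrict c.dom) ≤ 2 * (C₁ * 3 * ε) := fun j => by
      have : ∀ᵐ z ∂(volume.restrict c.dom),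
          ‖P j z‖ ≤ 2 * ‖((moll b (G j) - G j) ∘ c.shrink s) z‖ := by
        refine (ae_restrict_iff' hmU).2 (Eventually.of_forall fun z hz => ?_)
        rw [hP, norm_mul, mul_comm]
        refine mul_le_mul_of_nonneg_right ?_ (norm_nonneg _)
        have h := hJ j k z hz
        have h3 : ε.toReal ≤ 1 := by
          simpa using ENNReal.toReal_mono ENNReal.one_ne_top hε1
        rw [Real.norm_eq_abs, abs_le]
        rw [abs_le] at h
        split_ifs at h <;> constructor <;> linarith
      refine (eLpNorm_le_mul_eLpNorm_of_ae_le_mul this 2).trans ?_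
      rw [show ENNReal.ofReal 2 = 2 by simp]
      gcongr
      exact hcomp (hrG j b (hbR.trans_le (hRr' j)))
    have nR : ∀ j, eLpNorm (R' j) 2 (volume.restrict c.dom)
        ≤ ε * (C₁ * eLpNorm (g j) 2 (volume.restrict c.dom)) := fun j => by
      have : ∀ᵐ z ∂(volume.restrict c.dom), ‖R' j z‖ ≤ ε.toReal * ‖(g j ∘ c.shrink s) z‖ := by
        refine (ae_restrict_iff' hmU).2 (Eventually.of_forall fun z hz => ?_)
        rw [hR', norm_mul, mul_comm]
        exact mul_le_mul_of_nonneg_right (hJ j k z hz) (norm_nonneg _)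
      refine (eLpNorm_le_mul_eLpNorm_of_ae_le_mul this 2).trans ?_
      rw [ENNReal.ofReal_toReal hεt]
      gcongr
      exact h₁ s h0 h1 _
    rw [eLpNorm_congr_ae e]
    refine (eLpNorm_add_le ms m2 (by norm_num)).trans ?_
    calc _ ≤ A * ε + C₂ * ε := by
          refine add_le_add ?_ (hsg k)
          refine (eLpNorm_sum_le (fun j _ => (mP j).add (mR j)) (by norm_num)).trans ?_
          rw [hA, Finset.sum_mul]
          refine Finset.sum_le_sum fun j _ => ?_
          refine (eLpNorm_add_le (mP j) (mR j) (by norm_num)).trans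
            ((add_le_add (nP j) (nR j)).trans_eq ?_)
          ring
      _ = (A + C₂) * ε := by ring
      _ ≤ _ := mul_le_mul' le_add_self le_rfl

end CubeChart

/-- A `C¹` function can be approximated in `H¹` of a bounded open set by smooth functions. -/
lemma exists_smooth_eLpNorm_le {U : Set (E d)} (hU : IsOpen U) (hb : Bornology.IsBounded U)
    {f : E d → ℝ} (hf : ContDiff ℝ 1 f) {ε : ℝ≥0∞} (hε : ε ≠ 0) :
    ∃ φ : E d → ℝ, ContDiff ℝ ∞ φ ∧ eLpNorm (φ - f) 2 (volume.restrict U) ≤ ε ∧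
      ∀ k, eLpNorm (pd k φ - pd k f) 2 (volume.restrict U) ≤ ε := by
  obtain ⟨δ, hδ, hδU⟩ := exists_forall_eLpNorm_le hU.measurableSet hb.measure_lt_top.ne hε
  obtain ⟨R, hR0, hR⟩ := hb.subset_closedBall_lt 0 0
  let χ : ContDiffBump (0 : E d) := ⟨R, R + 1, hR0, by linarith⟩
  have hχ : ContDiff ℝ 1 (χ : E d → ℝ) := χ.contDiff
  have e : ∀ z ∈ U, (fun z => χ z * f z) =ᶠ[𝓝 z] f := fun z hz => by
    filter_upwards [hU.mem_nhds hz] with x hx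
    rw [χ.one_of_mem_closedBall (hR hx), one_mul]
  obtain ⟨φ, hφ, -, h0, h1⟩ := exists_smooth_approx (f := fun z => χ z * f z) (hχ.mul hf)
    χ.hasCompactSupport.mul_right hδ
  refine ⟨φ, hφ, hδU _ fun z hz => ?_, fun k => hδU _ fun z hz => ?_⟩
  · simpa only [Pi.sub_apply, (e z hz).eq_of_nhds] using h0 z
  · have := h1 k z
    rw [pd, pd, (e z hz).fderiv_eq] at this
    exact this

/-! ### Traces -/

/-- Bounded open sets with a boundary regular enough for traces and Green's formula. -/
structure IsGreenDomain (U : Set (E d)) : Prop where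
  isOpen : IsOpen U
  isBounded : Bornology.IsBounded U
  volume_frontier : volume (frontier U) = 0
  surf_lt_top : surf U Set.univ < ⊤
  ae_isOuterNormal : ∀ᵐ z ∂(surf U), IsOuterNormal U z (outerNormal U z)
  aestronglyMeasurable_outerNormal : ∀ k,
    AEStronglyMeasurable (fun z => outerNormal U z k) (surf U)
  green : ∀ {W w g : E d → ℝ} {k : Fin (d + 1)}, Continuous W → Set.EqOn w W U →
    HasWeakPartial U k w g → IntegrableOn g U →
    ∫ z in U, g z = ∫ z, W z * outerNormal U z k ∂(surf U)
  trace_ineq : ∃ C : ℝ≥0∞, C ≠ ⊤ ∧ ∀ φ : E d → ℝ, ContDiff ℝ 1 φ →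
    eLpNorm φ 2 (surf U) ≤ C * (eLpNorm φ 2 (volume.restrict U)
      + ∑ k, eLpNorm (pd k φ) 2 (volume.restrict U))
  dense : ∀ (w : E d → ℝ) (g : Fin (d + 1) → E d → ℝ), MemLp w 2 (volume.restrict U) →
    (∀ k, MemLp (g k) 2 (volume.restrict U)) → (∀ k, HasWeakPartial U k w (g k)) →
    ∃ φ : ℕ → E d → ℝ, (∀ n, ContDiff ℝ ∞ (φ n)) ∧ TendstoL2 (volume.restrict U) φ w ∧
      ∀ k, TendstoL2 (volume.restrict U) (fun n => pd k (φ n)) (g k)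

lemma sum_sq_le_sq_sum {ι : Type*} (s : Finset ι) (a : ι → ℝ≥0∞) :
    ∑ i ∈ s, a i ^ 2 ≤ (∑ i ∈ s, a i) ^ 2 := by
  classical
  induction s using Finset.induction_on with
  | empty => simp
  | insert i s hi ih =>
    rw [Finset.sum_insert hi, Finset.sum_insert hi]
    have e : (a i + ∑ j ∈ s, a j) ^ 2
        = a i ^ 2 + (∑ j ∈ s, a j) ^ 2 + 2 * a i * ∑ j ∈ s, a j := by ring
    rw [e]
    exact (add_le_add_right ih _).trans le_self_add

theorem CubeChart.isGreenDomain (c : CubeChart d) : IsGreenDomain c.dom where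
  isOpen := c.isOpen_dom
  isBounded := c.isBounded_dom
  volume_frontier := c.volume_frontier
  surf_lt_top := c.surf_univ_lt_top
  ae_isOuterNormal := c.ae_isOuterNormal
  aestronglyMeasurable_outerNormal := c.aestronglyMeasurable_outerNormal
  green := c.green
  trace_ineq := by
    obtain ⟨C, hC, h⟩ := c.trace_ineq
    refine ⟨1 + C, by simpa using hC, fun φ hφ => ?_⟩
    have h2 : eLpNorm φ 2 (surf c.dom) ^ 2 ≤ ((1 + C) * (eLpNorm φ 2 (volume.restrict c.dom)
        + ∑ k, eLpNorm (pd k φ) 2 (volume.restrict c.dom))) ^ 2 := by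
      rw [mul_pow, eLpNorm_two_sq]
      refine (h φ hφ).trans ?_
      refine mul_le_mul' (le_add_self.trans (le_self_pow₀ le_self_add (by norm_num))) ?_
      simp only [← eLpNorm_two_sq]
      set a := eLpNorm φ 2 (volume.restrict c.dom)
      have e : ∀ x y : ℝ≥0∞, x ^ 2 + y ^ 2 ≤ (x + y) ^ 2 := fun x y => by
        have : (x + y) ^ 2 = x ^ 2 + y ^ 2 + 2 * x * y := by ring
        rw [this]; exact le_self_add
      refine le_trans ?_ (e _ _)
      gcongr
      exact sum_sq_le_sq_sum _ _
    exact (ENNReal.pow_le_pow_left_iff (by norm_num)).1 h2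
  dense := by
    intro w g hw hg hwg
    have hU := c.isOpen_dom
    set w' := hw.1.mk w with hw'
    set g' := fun k => (hg k).1.mk (g k) with hg'
    have ew : w =ᵐ[volume.restrict c.dom] w' := hw.1.ae_eq_mk
    have eg : ∀ k, g k =ᵐ[volume.restrict c.dom] g' k := fun k => (hg k).1.ae_eq_mk
    obtain ⟨C, hC, h⟩ := c.exists_contDiff_approx hw.1.stronglyMeasurable_mk.measurable
      (fun k => (hg k).1.stronglyMeasurable_mk.measurable) ((memLp_congr_ae ew).1 hw)
      (fun k => (memLp_congr_ae (eg k)).1 (hg k)) (fun k => (hwg k).congr hU ew (eg k))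
    have hε : ∀ n : ℕ, ((n : ℝ≥0∞) + 1)⁻¹ ≠ 0 := fun n => by simp
    have hε1 : ∀ n : ℕ, ((n : ℝ≥0∞) + 1)⁻¹ ≤ 1 := fun n => by simp
    choose f hf hfw hfg using fun n => h _ (hε n) (hε1 n)
    choose φ hφ hφf hφg using fun n => exists_smooth_eLpNorm_le hU c.isBounded_dom (hf n) (hε n)
    have ht0 : Tendsto (fun n : ℕ => ((n : ℝ≥0∞) + 1)⁻¹) atTop (𝓝 0) := by
      have := ENNReal.tendsto_inv_nat_nhds_zero.comp (tendsto_add_atTop_nat 1)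
      refine this.congr fun n => ?_
      simp
    have ht : Tendsto (fun n : ℕ => (1 + C) * ((n : ℝ≥0∞) + 1)⁻¹) atTop (𝓝 0) := by
      have := ENNReal.Tendsto.const_mul (a := 1 + C) ht0 (Or.inr (by simpa using hC))
      rwa [mul_zero] at this
    refine ⟨φ, hφ, ?_, fun k => ?_⟩
    · refine tendsto_of_tendsto_of_tendsto_of_le_of_le tendsto_const_nhds ht (fun _ => zero_le)
        fun n => ?_
      have e : φ n - w =ᵐ[volume.restrict c.dom] (φ n - f n) + (f n - w') := by
        filter_upwards [ew] with z hz; simp [hz, hw']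
      beta_reduce
      rw [eLpNorm_congr_ae e, add_mul, one_mul]
      exact (eLpNorm_add_le
        ((hφ n).continuous.sub (hf n).continuous).aestronglyMeasurable
        ((hf n).continuous.aestronglyMeasurable.sub
          hw.1.stronglyMeasurable_mk.aestronglyMeasurable) (by norm_num)).trans
        (add_le_add (hφf n) (hfw n))
    · refine tendsto_of_tendsto_of_tendsto_of_le_of_le tendsto_const_nhds ht (fun _ => zero_le)
        fun n => ?_
      have e : pd k (φ n) - g k =ᵐ[volume.restrict c.dom]
          (pd k (φ n) - pd k (f n)) + (pd k (f n) - g' k) := by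
        filter_upwards [eg k] with z hz; simp [hz, hg']
      have hp := pd_continuous (hf n) k
      have hp' := pd_continuous ((hφ n).of_le (by simp)) k
      beta_reduce
      rw [eLpNorm_congr_ae e, add_mul, one_mul]
      exact (eLpNorm_add_le (hp'.sub hp).aestronglyMeasurable
        (hp.aestronglyMeasurable.sub
          (hg k).1.stronglyMeasurable_mk.aestronglyMeasurable) (by norm_num)).trans
        (add_le_add (hφg n k) (hfg n k))

/-! ### Weak derivatives of `H¹` functions and `L²` limits -/

lemma MemH1.hasWeakPartial {U : Set (E d)} {w : E d → ℝ} (h : MemH1 U w) (k : Fin (d + 1)) :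
    HasWeakPartial U k w (weakPartial U k w) := (h.2 k).choose_spec.2.weakPartial

lemma HasL2Partial.memLp {U : Set (E d)} (hU : IsOpen U) {w : E d → ℝ} {k : Fin (d + 1)}
    (h : HasL2Partial U k w) : MemLp (weakPartial U k w) 2 (volume.restrict U) := by
  obtain ⟨g, hg, hw⟩ := h
  exact (memLp_congr_ae (hw.ae_eq hU)).2 hg

lemma MemH1.memLp {U : Set (E d)} (hU : IsOpen U) {w : E d → ℝ} (h : MemH1 U w) (k : Fin (d + 1)) :
    MemLp (weakPartial U k w) 2 (volume.restrict U) := (h.2 k).memLp hU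

lemma tendsto_integral_mul_of_L2 {μ : Measure (E d)} {a b : ℕ → E d → ℝ} {a' b' : E d → ℝ}
    (ha : ∀ n, MemLp (a n) 2 μ) (hb : ∀ n, MemLp (b n) 2 μ) (ha' : MemLp a' 2 μ)
    (hb' : MemLp b' 2 μ) (hta : TendstoL2 μ a a') (htb : TendstoL2 μ b b') :
    Tendsto (fun n => ∫ z, a n z * b n z ∂μ) atTop (𝓝 (∫ z, a' z * b' z ∂μ)) := by
  have h1 : Tendsto (fun n => (ha n).toLp (a n)) atTop (𝓝 (ha'.toLp a')) := by
    refine (Lp.tendsto_Lp_iff_tendsto_eLpNorm'' _ ha _ ha').2 hta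
  have h2 : Tendsto (fun n => (hb n).toLp (b n)) atTop (𝓝 (hb'.toLp b')) :=
    (Lp.tendsto_Lp_iff_tendsto_eLpNorm'' _ hb _ hb').2 htb
  have e : ∀ {x y : E d → ℝ} (hx : MemLp x 2 μ) (hy : MemLp y 2 μ),
      inner ℝ (hx.toLp x : Lp ℝ 2 μ) (hy.toLp y : Lp ℝ 2 μ) = ∫ z, x z * y z ∂μ := fun hx hy => by
    rw [L2.inner_def]
    refine integral_congr_ae ?_
    filter_upwards [hx.coeFn_toLp, hy.coeFn_toLp] with z h1 h2
    rw [h1, h2]; simp [mul_comm]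
  have h3 := Filter.Tendsto.inner (𝕜 := ℝ) h1 h2
  simpa only [e] using h3

lemma TendstoL2.sub {μ : Measure (E d)} {a b : ℕ → E d → ℝ} {a' b' : E d → ℝ}
    (ha : ∀ n, AEStronglyMeasurable (a n - a') μ) (hb : ∀ n, AEStronglyMeasurable (b n - b') μ)
    (hta : TendstoL2 μ a a') (htb : TendstoL2 μ b b') :
    TendstoL2 μ (fun n => a n - b n) (a' - b') := by
  have h := hta.add htb
  rw [add_zero] at h
  refine tendsto_of_tendsto_of_tendsto_of_le_of_le tendsto_const_nhds h (fun _ => zero_le)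
    fun n => ?_
  have e : a n - b n - (a' - b') = (a n - a') - (b n - b') := by abel
  beta_reduce
  rw [e]
  exact eLpNorm_sub_le (ha n) (hb n) (by norm_num)

lemma TendstoL2.congr {μ : Measure (E d)} {a : ℕ → E d → ℝ} {a' a'' : E d → ℝ}
    (h : TendstoL2 μ a a') (e : a' =ᵐ[μ] a'') : TendstoL2 μ a a'' := by
  refine Tendsto.congr (fun n => eLpNorm_congr_ae ?_) h
  exact (ae_eq_refl (a n)).sub e

lemma pd_sub {f g : E d → ℝ} (hf : ContDiff ℝ 1 f) (hg : ContDiff ℝ 1 g) (k : Fin (d + 1)) :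
    pd k (f - g) = pd k f - pd k g := by
  ext z
  simp [pd, fderiv_sub (hf.differentiable (by simp) z) (hg.differentiable (by simp) z)]

namespace IsGreenDomain

variable {U : Set (E d)}

lemma memLp_surf (hU : IsGreenDomain U) {φ : E d → ℝ} (hφ : Continuous φ) :
    MemLp φ 2 (surf U) := by
  have hfin : IsFiniteMeasure (surf U) := ⟨hU.surf_lt_top⟩
  have hK : IsCompact (frontier U) := hU.isBounded.isCompact_closure.of_isClosed_subset
    isClosed_frontier frontier_subset_closure
  obtain ⟨B, hB⟩ := hK.exists_bound_of_continuousOn hφ.continuousOn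
  exact MemLp.of_bound hφ.aestronglyMeasurable B
    ((ae_restrict_iff' isClosed_frontier.measurableSet).2 (Eventually.of_forall hB))

lemma memLp_volume (hU : IsGreenDomain U) {φ : E d → ℝ} (hφ : Continuous φ) :
    MemLp φ 2 (volume.restrict U) := by
  have hfin : IsFiniteMeasure (volume.restrict U) := ⟨by
    simpa using hU.isBounded.measure_lt_top⟩
  obtain ⟨B, hB⟩ := hU.isBounded.isCompact_closure.exists_bound_of_continuousOn hφ.continuousOn
  exact MemLp.of_bound hφ.aestronglyMeasurable B
    ((ae_restrict_iff' hU.isOpen.measurableSet).2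
      (Eventually.of_forall fun z hz => hB z (subset_closure hz)))

/-- Functions that are close in `H¹` have close boundary values. -/
lemma tendsto_eLpNorm_surf (hU : IsGreenDomain U) {ι : Type*} {l : Filter ι} {f : ι → E d → ℝ}
    (hf : ∀ i, ContDiff ℝ 1 (f i))
    (h0 : Tendsto (fun i => eLpNorm (f i) 2 (volume.restrict U)) l (𝓝 0))
    (h1 : ∀ k, Tendsto (fun i => eLpNorm (pd k (f i)) 2 (volume.restrict U)) l (𝓝 0)) :
    Tendsto (fun i => eLpNorm (f i) 2 (surf U)) l (𝓝 0) := by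
  obtain ⟨C, hC, h⟩ := hU.trace_ineq
  have ht := ENNReal.Tendsto.const_mul (a := C)
    (h0.add (tendsto_finsetSum Finset.univ fun k _ => h1 k)) (Or.inr hC)
  simp only [Finset.sum_const_zero, add_zero, mul_zero] at ht
  exact tendsto_of_tendsto_of_tendsto_of_le_of_le tendsto_const_nhds ht (fun _ => zero_le)
    fun i => h _ (hf i)

lemma tendsto_eLpNorm_sub_prod {μ : Measure (E d)} {φ : ℕ → E d → ℝ} {w : E d → ℝ}
    (hm : ∀ n, AEStronglyMeasurable (φ n - w) μ) (h : TendstoL2 μ φ w) :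
    Tendsto (fun p : ℕ × ℕ => eLpNorm (φ p.1 - φ p.2) 2 μ) atTop (𝓝 0) := by
  have h' : Tendsto (fun n => eLpNorm (φ n - w) 2 μ) atTop (𝓝 0) := h
  have ht := (h'.comp tendsto_fst).add (h'.comp tendsto_snd)
  rw [prod_atTop_atTop_eq, add_zero] at ht
  refine tendsto_of_tendsto_of_tendsto_of_le_of_le tendsto_const_nhds ht (fun _ => zero_le)
    fun p => ?_
  have e : φ p.1 - φ p.2 = (φ p.1 - w) - (φ p.2 - w) := by abel
  beta_reduce
  rw [e]
  exact eLpNorm_sub_le (hm _) (hm _) (by norm_num)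

/-- Smooth functions converging in `H¹` have boundary values that are Cauchy in `L²(∂U)` by the
trace inequality; completeness gives the limit. -/
lemma exists_isTrace (hU : IsGreenDomain U) {w : E d → ℝ} (hw : MemH1 U w) :
    ∃ g, IsTrace U w g := by
  obtain ⟨φ, hφ, h0, h1⟩ := hU.dense w (fun k => weakPartial U k w) hw.1
    (fun k => hw.memLp hU.isOpen k) fun k => hw.hasWeakPartial k
  have hφ1 : ∀ n, ContDiff ℝ 1 (φ n) := fun n => (hφ n).of_le (by simp)
  have hL : ∀ n, MemLp (φ n) 2 (surf U) := fun n => hU.memLp_surf (hφ n).continuous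
  have hc : Tendsto (fun p : ℕ × ℕ => eLpNorm (φ p.1 - φ p.2) 2 (surf U)) atTop (𝓝 0) := by
    refine hU.tendsto_eLpNorm_surf (fun p => (hφ1 p.1).sub (hφ1 p.2)) ?_ fun k => ?_
    · exact tendsto_eLpNorm_sub_prod
        (fun n => (hφ n).continuous.aestronglyMeasurable.sub hw.1.1) h0
    · refine (tendsto_eLpNorm_sub_prod (fun n => ((pd_continuous (hφ1 n) k).aestronglyMeasurable.sub
        (hw.memLp hU.isOpen k).1)) (h1 k)).congr fun p => ?_
      rw [pd_sub (hφ1 _) (hφ1 _)]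
  have hcs : CauchySeq fun n => (hL n).toLp (φ n) := by
    rw [Lp.cauchySeq_Lp_iff_cauchySeq_eLpNorm]
    refine hc.congr fun p => eLpNorm_congr_ae ?_
    exact ((hL _).coeFn_toLp.symm).sub ((hL _).coeFn_toLp.symm)
  have : Fact ((1 : ℝ≥0∞) ≤ 2) := ⟨by norm_num⟩
  obtain ⟨g, hg⟩ := cauchySeq_tendsto_of_complete hcs
  refine ⟨g, Lp.memLp g, φ, hφ, h0, h1, ?_⟩
  have := (Lp.tendsto_Lp_iff_tendsto_eLpNorm' _ _).1 hg
  refine this.congr fun n => eLpNorm_congr_ae ?_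
  exact (hL n).coeFn_toLp.sub (ae_eq_refl _)

lemma isTrace_trace (hU : IsGreenDomain U) {w : E d → ℝ} (hw : MemH1 U w) :
    IsTrace U w (trace U w) := by
  have h : ∃ g, MemH1 U w ∧ IsTrace U w g := (hU.exists_isTrace hw).imp fun g hg => ⟨hw, hg⟩
  rw [trace, dif_pos h]; exact h.choose_spec.2

/-- The difference of two approximating sequences tends to zero in `H¹`, hence on the boundary. -/
lemma isTrace_unique (hU : IsGreenDomain U) {w g₁ g₂ : E d → ℝ} (hw : MemH1 U w)
    (h₁ : IsTrace U w g₁) (h₂ : IsTrace U w g₂) : g₁ =ᵐ[surf U] g₂ := by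
  obtain ⟨hg₁, φ, hφ, h10, h11, h1g⟩ := h₁
  obtain ⟨hg₂, ψ, hψ, h20, h21, h2g⟩ := h₂
  have hφ1 : ∀ n, ContDiff ℝ 1 (φ n) := fun n => (hφ n).of_le (by simp)
  have hψ1 : ∀ n, ContDiff ℝ 1 (ψ n) := fun n => (hψ n).of_le (by simp)
  have hs : ∀ {μ : Measure (E d)} {f g : E d → ℝ}, Continuous f → AEStronglyMeasurable g μ →
    AEStronglyMeasurable (f - g) μ := fun hf hg => hf.aestronglyMeasurable.sub hg
  have h0 : Tendsto (fun n => eLpNorm (φ n - ψ n) 2 (surf U)) atTop (𝓝 0) := by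
    refine hU.tendsto_eLpNorm_surf (fun n => (hφ1 n).sub (hψ1 n)) ?_ fun k => ?_
    · have := h10.sub (fun n => hs (hφ n).continuous hw.1.1)
        (fun n => hs (hψ n).continuous hw.1.1) h20
      simpa [TendstoL2] using this
    · have := (h11 k).sub (fun n => hs (pd_continuous (hφ1 n) k) (hw.memLp hU.isOpen k).1)
        (fun n => hs (pd_continuous (hψ1 n) k) (hw.memLp hU.isOpen k).1) (h21 k)
      simpa [TendstoL2, pd_sub (hφ1 _) (hψ1 _)] using this
  have h3 := h1g.sub (fun n => hs (hφ n).continuous hg₁.1)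
    (fun n => hs (hψ n).continuous hg₂.1) h2g
  have hz : TendstoL2 (surf U) (fun n => φ n - ψ n) 0 := by simpa [TendstoL2] using h0
  have h4 := hz.sub (fun n => by
      simpa using ((hφ n).continuous.sub (hψ n).continuous).aestronglyMeasurable)
    (fun n => hs ((hφ n).continuous.sub (hψ n).continuous) (hg₁.1.sub hg₂.1)) h3
  have h5 : eLpNorm (g₁ - g₂) 2 (surf U) = 0 := by
    have : Tendsto (fun _ : ℕ => eLpNorm (g₁ - g₂) 2 (surf U)) atTop (𝓝 0) := by
      simpa [TendstoL2, ← eLpNorm_neg (f := g₁ - g₂)] using h4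
    exact tendsto_nhds_unique tendsto_const_nhds this
  rw [eLpNorm_eq_zero_iff (hg₁.1.sub hg₂.1) (by norm_num)] at h5
  exact (sub_ae_eq_zero _ _).1 h5

lemma isTrace_of_contDiff (hU : IsGreenDomain U) {φ : E d → ℝ} (hφ : ContDiff ℝ ∞ φ) :
    IsTrace U φ φ := by
  refine ⟨hU.memLp_surf hφ.continuous, fun _ => φ, fun _ => hφ, by simp [TendstoL2],
    fun k => ?_, by simp [TendstoL2]⟩
  have h := (hasWeakPartial_of_contDiff (hφ.of_le (by simp)) U k).ae_eq hU.isOpen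
  refine TendstoL2.congr (a' := pd k φ) (by simp [TendstoL2]) h.symm

lemma memH1_of_contDiff (hU : IsGreenDomain U) {φ : E d → ℝ} (hφ : ContDiff ℝ 1 φ) :
    MemH1 U φ :=
  ⟨hU.memLp_volume hφ.continuous, fun k => ⟨_, hU.memLp_volume (pd_continuous hφ k),
    hasWeakPartial_of_contDiff hφ U k⟩⟩

lemma memLp_mul_outerNormal (hU : IsGreenDomain U) {g : E d → ℝ} (k : Fin (d + 1))
    (hg : MemLp g 2 (surf U)) : MemLp (fun z => g z * outerNormal U z k) 2 (surf U) := by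
  refine hg.mono (hg.1.mul (hU.aestronglyMeasurable_outerNormal k)) (Eventually.of_forall fun z => ?_)
  rw [norm_mul]
  exact mul_le_of_le_one_right (norm_nonneg _) (abs_outerNormal_le _ _ _)

/-- Integration by parts for `H¹` functions. -/
theorem green_trace (hU : IsGreenDomain U) {w₁ w₂ g₁ g₂ : E d → ℝ} (hw₁ : MemH1 U w₁)
    (hw₂ : MemH1 U w₂) (h₁ : IsTrace U w₁ g₁) (h₂ : IsTrace U w₂ g₂) (k : Fin (d + 1)) :
    (∫ z in U, weakPartial U k w₁ z * w₂ z) + ∫ z in U, w₁ z * weakPartial U k w₂ z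
      = ∫ z, g₁ z * (g₂ z * outerNormal U z k) ∂(surf U) := by
  obtain ⟨hg₁, φ, hφ, h10, h11, h1g⟩ := h₁
  obtain ⟨hg₂, ψ, hψ, h20, h21, h2g⟩ := h₂
  have hφ1 : ∀ n, ContDiff ℝ 1 (φ n) := fun n => (hφ n).of_le (by simp)
  have hψ1 : ∀ n, ContDiff ℝ 1 (ψ n) := fun n => (hψ n).of_le (by simp)
  have v : ∀ {f : E d → ℝ}, Continuous f → MemLp f 2 (volume.restrict U) := hU.memLp_volume
  have t1 := tendsto_integral_mul_of_L2 (fun n => v (pd_continuous (hφ1 n) k))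
    (fun n => v (hψ n).continuous) (hw₁.memLp hU.isOpen k) hw₂.1 (h11 k) h20
  have t2 := tendsto_integral_mul_of_L2 (fun n => v (hφ n).continuous)
    (fun n => v (pd_continuous (hψ1 n) k)) hw₁.1 (hw₂.memLp hU.isOpen k) h10 (h21 k)
  have t3 : TendstoL2 (surf U) (fun n z => ψ n z * outerNormal U z k)
      (fun z => g₂ z * outerNormal U z k) := by
    refine tendsto_of_tendsto_of_tendsto_of_le_of_le tendsto_const_nhds h2g (fun _ => zero_le)
      fun n => eLpNorm_mono fun z => ?_
    simp only [Pi.sub_apply, ← sub_mul]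
    rw [norm_mul]
    exact mul_le_of_le_one_right (norm_nonneg _) (abs_outerNormal_le _ _ _)
  have t4 := tendsto_integral_mul_of_L2 (fun n => hU.memLp_surf (hφ n).continuous)
    (fun n => hU.memLp_mul_outerNormal k (hU.memLp_surf (hψ n).continuous)) hg₁
    (hU.memLp_mul_outerNormal k hg₂) h1g t3
  -- Both sides pass to the limit, so it suffices to apply Green's formula to the product of two
  -- smooth functions.
  refine tendsto_nhds_unique (t1.add t2) (t4.congr fun n => ?_)
  have hprod : ContDiff ℝ 1 fun z => φ n z * ψ n z := (hφ1 n).mul (hψ1 n)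
  have hint : ∀ {f : E d → ℝ}, Continuous f → IntegrableOn f U := fun hf =>
    (hf.continuousOn.integrableOn_compact hU.isBounded.isCompact_closure).mono_set subset_closure
  have hG := hU.green hprod.continuous (Set.eqOn_refl _ _)
    (hasWeakPartial_of_contDiff hprod U k) (hint (pd_continuous hprod k))
  have i1 : IntegrableOn (fun z => pd k (φ n) z * ψ n z) U :=
    hint ((pd_continuous (hφ1 n) k).mul (hψ n).continuous)
  have i2 : IntegrableOn (fun z => φ n z * pd k (ψ n) z) U :=
    hint ((hφ n).continuous.mul (pd_continuous (hψ1 n) k))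
  rw [← integral_add i1 i2]
  simp only [mul_assoc] at hG
  rw [← hG]
  refine setIntegral_congr_fun hU.isOpen.measurableSet fun z _ => ?_
  rw [pd_mul ((hφ1 n).differentiable (by simp) z) ((hψ1 n).differentiable (by simp) z)]
  ring

/-- The trace of an `H¹` function that is continuous up to the boundary. -/
theorem trace_ae_eq_of_continuous (hU : IsGreenDomain U) {w W : E d → ℝ} (hw : MemH1 U w)
    (hW : Continuous W) (hwW : Set.EqOn w W U) : trace U w =ᵐ[surf U] W := by
  have hfin : IsFiniteMeasure (surf U) := ⟨hU.surf_lt_top⟩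
  have htr := hU.isTrace_trace hw
  -- Green's formula for `w φ` is used twice, once with the trace of `w` and once with its
  -- continuous extension `W`. The volume terms agree, so the difference of the boundary values
  -- times any normal component annihilates every test function.
  have key : ∀ k, ∀ᵐ z ∂(surf U), (trace U w z - W z) * outerNormal U z k = 0 := by
    intro k
    have hL : MemLp (fun z => (trace U w z - W z) * outerNormal U z k) 2 (surf U) :=
      hU.memLp_mul_outerNormal k (htr.1.sub (hU.memLp_surf hW))
    have hLi := hL.integrable (by norm_num)
    refine ae_eq_zero_of_integral_contDiff_smul_eq_zero hLi.locallyIntegrable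
      fun φ hφ hφc => ?_
    have hφ1 : ContDiff ℝ 1 φ := hφ.of_le (by simp)
    have hφH := hU.memH1_of_contDiff hφ1
    have e1 := hU.green_trace hw hφH htr (hU.isTrace_of_contDiff hφ) k
    have hi1 : IntegrableOn (fun z => weakPartial U k w z * φ z) U :=
      (hw.memLp hU.isOpen k).integrable_mul hφH.1
    have hi2 : IntegrableOn (fun z => w z * pd k φ z) U :=
      hw.1.integrable_mul (hU.memLp_volume (pd_continuous hφ1 k))
    have e2 := hU.green (W := fun z => W z * φ z) (hW.mul hφ.continuous)
      (fun z hz => by beta_reduce; rw [hwW hz]) ((hw.hasWeakPartial k).mul_contDiff hU.isOpen hφ1)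
      (hi1.add hi2)
    rw [integral_add hi1 hi2] at e2
    have e3 : ∫ z in U, w z * weakPartial U k φ z = ∫ z in U, w z * pd k φ z := by
      refine integral_congr_ae ?_
      filter_upwards [(hasWeakPartial_of_contDiff hφ1 U k).ae_eq hU.isOpen] with z hz
      rw [hz]
    rw [e3, e2] at e1
    have hn := hU.memLp_mul_outerNormal k (hU.memLp_surf hφ.continuous)
    have i1 : Integrable (fun z => trace U w z * (φ z * outerNormal U z k)) (surf U) :=
      htr.1.integrable_mul hn
    have i2 : Integrable (fun z => W z * (φ z * outerNormal U z k)) (surf U) :=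
      (hU.memLp_surf hW).integrable_mul hn
    have : ∫ z, φ z • ((trace U w z - W z) * outerNormal U z k) ∂(surf U)
        = (∫ z, trace U w z * (φ z * outerNormal U z k) ∂(surf U))
          - ∫ z, W z * (φ z * outerNormal U z k) ∂(surf U) := by
      rw [← integral_sub i1 i2]
      refine integral_congr_ae (Eventually.of_forall fun z => ?_)
      simp only [smul_eq_mul]; ring
    rw [this, ← e1, sub_eq_zero]
    refine integral_congr_ae (Eventually.of_forall fun z => ?_)
    simp only; ring
  filter_upwards [ae_all_iff.2 key, hU.ae_isOuterNormal] with z hz hn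
  -- A unit normal has a nonzero component, which can be cancelled.
  have hne : outerNormal U z ≠ 0 := fun h => by simpa [h] using hn.1
  obtain ⟨k, hk⟩ : ∃ k, outerNormal U z k ≠ 0 := by
    by_contra! h
    exact hne (by ext k; simpa using h k)
  exact sub_eq_zero.1 ((mul_eq_zero.1 (hz k)).resolve_right hk)

end IsGreenDomain

/-! ### Null sets and restriction to smaller domains -/

lemma MemH1.congr {U : Set (E d)} (hU : IsOpen U) {w w' : E d → ℝ} (h : MemH1 U w)
    (e : w =ᵐ[volume.restrict U] w') : MemH1 U w' :=
  ⟨(memLp_congr_ae e).1 h.1, fun k => ⟨_, h.memLp hU k, (h.hasWeakPartial k).congr hU e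
    (ae_eq_refl _)⟩⟩

lemma MemH1.mono {U V : Set (E d)} (hVU : V ⊆ U) {w : E d → ℝ} (h : MemH1 U w) : MemH1 V w :=
  ⟨h.1.mono_measure (Measure.restrict_mono hVU le_rfl), fun k => by
    obtain ⟨g, hg, hw⟩ := h.2 k
    exact ⟨g, hg.mono_measure (Measure.restrict_mono hVU le_rfl), hw.mono hVU⟩⟩

lemma weakPartial_congr {U : Set (E d)} (hU : IsOpen U) {w w' : E d → ℝ} (h : MemH1 U w)
    (e : w =ᵐ[volume.restrict U] w') (k : Fin (d + 1)) :
    weakPartial U k w =ᵐ[volume.restrict U] weakPartial U k w' :=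
  ((((h.congr hU e).hasWeakPartial k).congr hU e.symm (ae_eq_refl _)).ae_eq hU)

lemma IsGreenDomain.trace_congr {U : Set (E d)} (hU : IsGreenDomain U) {w w' : E d → ℝ}
    (h : MemH1 U w) (e : w =ᵐ[volume.restrict U] w') : trace U w =ᵐ[surf U] trace U w' := by
  have h' := h.congr hU.isOpen e
  obtain ⟨hg, φ, hφ, h0, h1, h2⟩ := hU.isTrace_trace h
  exact hU.isTrace_unique h' ⟨hg, φ, hφ, h0.congr e,
    fun k => (h1 k).congr (weakPartial_congr hU.isOpen h e k), h2⟩ (hU.isTrace_trace h')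

/-! ### Charts of the patches -/

lemma exists_cutoff {K W : Set (E d)} (hK : IsClosed K) (hW : IsOpen W) (hKW : K ⊆ W) :
    ∃ χ : E d → ℝ, ContDiff ℝ 1 χ ∧ tsupport χ ⊆ W ∧ ∀ᶠ x in 𝓝ˢ K, χ x = 1 := by
  obtain ⟨f, h0, h1, -⟩ := exists_contMDiffMap_zero_one_nhds_of_isClosed (n := 1)
    (modelWithCornersSelf ℝ (E d)) hW.isClosed_compl hK
    (Set.disjoint_left.2 fun x hx hxK => hx (hKW hxK))
  refine ⟨f, f.contMDiff.contDiff, fun x hx => ?_, h1⟩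
  by_contra hxW
  have h2 : ∀ᶠ y in 𝓝 x, f y = 0 := (eventually_nhdsSet_iff_forall.1 h0) x hxW
  exact (notMem_tsupport_iff_eventuallyEq.2 h2) hx

/-- By compactness, injectivity on the closed cube together with local injectivity extends to an
open neighbourhood, where the inverse function theorem gives a `C¹` inverse. A first cutoff turns
this inverse into a globally defined `Θ`; a second one, supported where the first equals one, serves
to localise test functions. -/
lemma exists_cubeChart {Φ : E d → E d} (hΦ : ContDiff ℝ 1 Φ) (hinj : Set.InjOn Φ (closedCube d))
    (hdet : ∀ ξ ∈ closedCube d, (fderiv ℝ Φ ξ).det ≠ 0) : ∃ c : CubeChart d, c.Φ = Φ := by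
  have hstrict : ∀ ξ, HasStrictFDerivAt Φ (fderiv ℝ Φ ξ) ξ := fun ξ =>
    hΦ.hasStrictFDerivAt (by simp)
  have heq : ∀ ξ, (fderiv ℝ Φ ξ).det ≠ 0 → ∃ L : E d ≃L[ℝ] E d, (L : E d →L[ℝ] E d) = fderiv ℝ Φ ξ :=
    fun ξ hξ => ⟨ContinuousLinearMap.toContinuousLinearEquivOfDetNeZero _ hξ, by ext; simp⟩
  obtain ⟨t, hto, hct, hti⟩ := hinj.exists_isOpen_superset (isCompact_closedCube d)
    (fun x _ => hΦ.continuous.continuousAt) fun ξ hξ => by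
      obtain ⟨L, hL⟩ := heq ξ (hdet ξ hξ)
      have h : HasStrictFDerivAt Φ (L : E d →L[ℝ] E d) ξ := hL ▸ hstrict ξ
      exact ⟨_, (h.toOpenPartialHomeomorph Φ).open_source.mem_nhds
        h.mem_toOpenPartialHomeomorph_source, (h.toOpenPartialHomeomorph Φ).injOn⟩
  set O := t ∩ {ξ | (fderiv ℝ Φ ξ).det ≠ 0} with hO
  have hOo : IsOpen O := hto.inter ((isOpen_compl_singleton (x := (0 : ℝ))).preimage
    (ContinuousLinearMap.continuous_det.comp (hΦ.continuous_fderiv (by simp))))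
  have hOc : closedCube d ⊆ O := fun ξ hξ => ⟨hct hξ, hdet ξ hξ⟩
  have hOi : Set.InjOn Φ O := hti.mono Set.inter_subset_left
  have hopen : ∀ V : Set (E d), IsOpen V → V ⊆ O → IsOpen (Φ '' V) := fun V hV hVO => by
    rw [isOpen_iff_mem_nhds]
    rintro _ ⟨ξ, hξ, rfl⟩
    obtain ⟨L, hL⟩ := heq ξ (hVO hξ).2
    rw [← (hstrict ξ).map_nhds_eq_of_surj (LinearMap.range_eq_top.2 (hL ▸ L.surjective))]
    exact image_mem_map (hV.mem_nhds hξ)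
  have hKc : IsClosed (Φ '' closedCube d) :=
    ((isCompact_closedCube d).image hΦ.continuous).isClosed
  obtain ⟨χ, hχ, hχs, hχ1⟩ := exists_cutoff hKc (hopen O hOo subset_rfl) (Set.image_mono hOc)
  obtain ⟨V, hVo, hKV, hV1⟩ := mem_nhdsSet_iff_exists.1 hχ1
  -- Over this smaller neighbourhood the first cutoff is identically one, so multiplying the inverse
  -- by it changes nothing.
  set O' := O ∩ Φ ⁻¹' V with hO'
  have hO'o : IsOpen O' := hOo.inter (hVo.preimage hΦ.continuous)
  have hO'c : closedCube d ⊆ O' := fun ξ hξ => ⟨hOc hξ, hKV ⟨ξ, hξ, rfl⟩⟩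
  obtain ⟨χ', hχ', hχs', hχ1'⟩ := exists_cutoff hKc (hopen O' hO'o Set.inter_subset_left)
    (Set.image_mono hO'c)
  set inv := Function.invFunOn Φ O with hinv
  have hinvΦ : ∀ ξ ∈ O, inv (Φ ξ) = ξ := fun ξ hξ => hOi.leftInvOn_invFunOn hξ
  have hinvC : ∀ z ∈ Φ '' O, ContDiffAt ℝ 1 inv z := by
    rintro _ ⟨ξ, hξ, rfl⟩
    obtain ⟨L, hL⟩ := heq ξ hξ.2
    have hd : HasFDerivAt Φ (L : E d →L[ℝ] E d) ξ := hL ▸ (hstrict ξ).hasFDerivAt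
    have hl := hΦ.contDiffAt.to_localInverse hd (one_ne_zero)
    refine hl.congr_of_eventuallyEq ?_
    have hs := hΦ.contDiffAt.hasStrictFDerivAt' hd one_ne_zero
    have h1 := hs.eventually_right_inverse
    have h2 := hs.localInverse_tendsto.eventually (hOo.mem_nhds hξ)
    filter_upwards [h1, h2] with z hz1 hz2
    conv_lhs => rw [← hz1]
    exact hinvΦ _ hz2
  have hΘ : ContDiff ℝ 1 fun z => χ z • inv z := by
    refine contDiff_iff_contDiffAt.2 fun z => ?_
    -- On the support of the cutoff the local inverse is smooth enough; off it the product vanishes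
    -- near the point, whatever `invFunOn` returns.
    by_cases hz : z ∈ tsupport χ
    · exact hχ.contDiffAt.smul (hinvC z (hχs hz))
    · refine (contDiffAt_const (c := (0 : E d))).congr_of_eventuallyEq ?_
      filter_upwards [notMem_tsupport_iff_eventuallyEq.1 hz] with x hx
      rw [hx]; simp
  exact ⟨{
    Φ := Φ
    Θ := fun z => χ z • inv z
    χ := χ'
    O := O'
    contDiff_Φ := hΦ
    contDiff_Θ := hΘ
    contDiff_χ := hχ'
    isOpen_O := hO'o
    cube_subset := hO'c
    left_inv := fun ξ hξ => by
      have : χ (Φ ξ) = 1 := hV1 hξ.2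
      simp only [this, one_smul, hinvΦ ξ hξ.1]
    χ_eq_one := fun ξ hξ => hχ1'.self_of_nhdsSet _ ⟨ξ, hξ, rfl⟩
    χ_support := (subset_tsupport _).trans hχs' }, rfl⟩

namespace PatchData

lemma contDiff_geo (P : PatchData d) : ContDiff ℝ 1 P.geo :=
  ContDiff.sum fun m _ => (P.contDiff_basisExt m).smul contDiff_const

end PatchData

namespace Patch

variable (P : Patch d)

/-- A chart of the patch. -/
def chart : CubeChart d := (exists_cubeChart P.contDiff_geo P.geo_injOn P.geo_regular).choose

lemma chart_Φ : P.chart.Φ = P.geo :=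
  (exists_cubeChart P.contDiff_geo P.geo_injOn P.geo_regular).choose_spec

lemma chart_dom : P.chart.dom = P.dom := by rw [CubeChart.dom, chart_Φ]; rfl

lemma isGreenDomain : IsGreenDomain P.dom := P.chart_dom ▸ P.chart.isGreenDomain

/-- The right-hand function is `C¹` on the whole space, which makes every discrete function `C¹` up
to the boundary of its patch. -/
lemma physBasis_eqOn (m : P.Idx) :
    Set.EqOn (P.physBasis m) (fun z => P.basisExt m (P.chart.Θ z)) P.dom := by
  rintro _ ⟨ξ, hξ, rfl⟩
  have h1 : Function.invFunOn P.geo (openCube d) (P.geo ξ) = ξ :=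
    (P.geo_injOn.mono (openCube_subset_closedCube d)).leftInvOn_invFunOn hξ
  have h2 : P.chart.Θ (P.geo ξ) = ξ := by
    rw [← chart_Φ]; exact P.chart.left_inv ξ (P.chart.openCube_subset hξ)
  rw [PatchData.physBasis, h1]
  beta_reduce
  rw [h2, P.basisExt_eq m hξ]

end Patch

/-! ### Linear structure of `H¹` and `H²`, and discrete functions -/

lemma MemH1.add {U : Set (E d)} (hU : IsOpen U) {w w' : E d → ℝ} (h : MemH1 U w)
    (h' : MemH1 U w') : MemH1 U (w + w') :=
  ⟨h.1.add h'.1, fun k => ⟨_, (h.memLp hU k).add (h'.memLp hU k),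
    (h.hasWeakPartial k).add hU (h'.hasWeakPartial k)⟩⟩

lemma MemH1.smul {U : Set (E d)} (hU : IsOpen U) {w : E d → ℝ} (h : MemH1 U w) (r : ℝ) :
    MemH1 U (r • w) :=
  ⟨h.1.const_smul r, fun k => ⟨_, (h.memLp hU k).const_smul r, (h.hasWeakPartial k).smul r⟩⟩

lemma MemH2.congr {U : Set (E d)} (hU : IsOpen U) {w w' : E d → ℝ} (h : MemH2 U w)
    (e : w =ᵐ[volume.restrict U] w') : MemH2 U w' :=
  ⟨h.1.congr hU e, fun k => (h.2 k).congr hU (weakPartial_congr hU h.1 e k)⟩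

lemma MemH2.add {U : Set (E d)} (hU : IsOpen U) {w w' : E d → ℝ} (h : MemH2 U w)
    (h' : MemH2 U w') : MemH2 U (w + w') :=
  ⟨h.1.add hU h'.1, fun k => ((h.2 k).add hU (h'.2 k)).congr hU
    (((h.1.hasWeakPartial k).add hU (h'.1.hasWeakPartial k)).ae_eq hU).symm⟩

lemma MemH2.smul {U : Set (E d)} (hU : IsOpen U) {w : E d → ℝ} (h : MemH2 U w) (r : ℝ) :
    MemH2 U (r • w) :=
  ⟨h.1.smul hU r, fun k => ((h.2 k).smul hU r).congr hU
    (((h.1.hasWeakPartial k).smul r).ae_eq hU).symm⟩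

lemma IsGreenDomain.memH2_zero {U : Set (E d)} (hU : IsGreenDomain U) :
    MemH2 U (0 : E d → ℝ) := by
  have h0 : MemH1 U (0 : E d → ℝ) := hU.memH1_of_contDiff contDiff_const
  refine ⟨h0, fun k => h0.congr hU.isOpen (EventuallyEq.symm ?_)⟩
  refine ((hasWeakPartial_of_contDiff (f := (0 : E d → ℝ)) contDiff_const U k).ae_eq
    hU.isOpen).trans (Eventually.of_forall fun z => ?_)
  show pd k (fun _ => (0 : ℝ)) z = 0
  simp [pd]

/-- The functions of the discrete space of a patch are in `H²`, and `C¹` up to the boundary. -/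
lemma Patch.space_regular (P : Patch d) {w : E d → ℝ} (hw : w ∈ P.space) :
    MemH2 P.dom w ∧ ∃ V : E d → ℝ, ContDiff ℝ 1 V ∧ Set.EqOn w V P.dom := by
  have hU := P.isGreenDomain
  induction hw using Submodule.span_induction with
  | mem x hx =>
    obtain ⟨m, rfl⟩ := hx
    exact ⟨P.basis_memH2 m, _, (P.contDiff_basisExt m).comp P.chart.contDiff_Θ, P.physBasis_eqOn m⟩
  | zero => exact ⟨hU.memH2_zero, 0, contDiff_const, Set.eqOn_refl _ _⟩
  | add x y _ _ hx hy =>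
    obtain ⟨hx2, V, hV, hxV⟩ := hx
    obtain ⟨hy2, W, hW, hyW⟩ := hy
    exact ⟨hx2.add hU.isOpen hy2, V + W, hV.add hW, fun z hz => by simp [hxV hz, hyW hz]⟩
  | smul r x _ hx =>
    obtain ⟨hx2, V, hV, hxV⟩ := hx
    exact ⟨hx2.smul hU.isOpen r, r • V, contDiff_const.smul hV, fun z hz => by simp [hxV hz]⟩

/-- The traces of an `H²` function that is `C¹` up to the boundary. -/
lemma IsGreenDomain.trace_weakPartial_ae_eq {U : Set (E d)} (hU : IsGreenDomain U) {v V : E d → ℝ}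
    (hv : MemH2 U v) (hV : ContDiff ℝ 1 V) (hvV : Set.EqOn v V U) (k : Fin (d + 1)) :
    weakPartial U k v =ᵐ[volume.restrict U] pd k V ∧
      trace U (weakPartial U k v) =ᵐ[surf U] pd k V := by
  have e0 : v =ᵐ[volume.restrict U] V :=
    (ae_restrict_iff' hU.isOpen.measurableSet).2 (Eventually.of_forall hvV)
  have e1 : weakPartial U k v =ᵐ[volume.restrict U] pd k V :=
    ((hasWeakPartial_of_contDiff hV U k).congr hU.isOpen e0.symm (ae_eq_refl _)).ae_eq hU.isOpen
  exact ⟨e1, (hU.trace_congr (hv.2 k) e1).trans (hU.trace_ae_eq_of_continuous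
    ((hv.2 k).congr hU.isOpen e1) (pd_continuous hV k) (Set.eqOn_refl _ _))⟩

/-! ### Derivatives on the zero set -/

/-- The derivative of a `C¹` function vanishes almost everywhere on its zero set. -/
lemma ae_fderiv_eq_zero_of_eq_zero {m : ℕ} {g : EuclideanSpace ℝ (Fin m) → ℝ} (hg : ContDiff ℝ 1 g)
    (v : EuclideanSpace ℝ (Fin m)) : ∀ᵐ y, g y = 0 → fderiv ℝ g y v = 0 := by
  have hgc : Continuous fun y => fderiv ℝ g y v := (hg.continuous_fderiv (by simp)).clm_apply continuous_const
  set F : EuclideanSpace ℝ (Fin m) → ℝ := Set.indicator (g ⁻¹' {0}) fun y => fderiv ℝ g y v with hF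
  have hFm : Measurable F := hgc.measurable.indicator ((isClosed_singleton.preimage hg.continuous).measurableSet)
  have hFl : LocallyIntegrable F := hgc.locallyIntegrable.indicator
    ((isClosed_singleton.preimage hg.continuous).measurableSet)
  have key : ∀ᵐ y, F y = 0 := by
    refine ae_eq_zero_of_integral_contDiff_smul_eq_zero hFl fun φ hφ hφc => ?_
    -- The functions `ε arctan (g / ε)` tend to zero uniformly, while their derivatives tend
    -- boundedly to the derivative of `g` restricted to the zero set. Integrating by parts against
    -- `φ` and letting `ε → 0` shows that this restriction is zero as a distribution.
    set ε : ℕ → ℝ := fun n => 1 / ((n : ℝ) + 1) with hε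
    have hε0 : ∀ n, 0 < ε n := fun n => Nat.one_div_pos_of_nat
    have hεt : Tendsto ε atTop (𝓝 0) := tendsto_one_div_add_atTop_nhds_zero_nat
    have hd : ∀ n y, HasFDerivAt (fun y => ε n * Real.arctan (g y / ε n))
        ((1 / (1 + (g y / ε n) ^ 2)) • fderiv ℝ g y) y := fun n y => by
      have h1 := ((hg.differentiable (by simp) y).hasFDerivAt.mul_const (ε n)⁻¹).arctan.const_mul (ε n)
      simp only [← div_eq_mul_inv] at h1
      have e : ε n • (1 / (1 + (g y / ε n) ^ 2)) • (ε n)⁻¹ • fderiv ℝ g y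
          = (1 / (1 + (g y / ε n) ^ 2)) • fderiv ℝ g y := by
        rw [smul_comm (1 / (1 + (g y / ε n) ^ 2)) (ε n)⁻¹, smul_inv_smul₀ (hε0 n).ne']
      rwa [e] at h1
    have hφd : ContDiff ℝ 1 φ := hφ.of_le (by simp)
    have hφv : Continuous fun y => fderiv ℝ φ y v :=
      (hφd.continuous_fderiv (by simp)).clm_apply continuous_const
    have hφvc : HasCompactSupport fun y => fderiv ℝ φ y v :=
      (hφc.fderiv ℝ).comp_left (g := fun L : EuclideanSpace ℝ (Fin m) →L[ℝ] ℝ => L v) rfl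
    have hac : ∀ n, Continuous fun y => ε n * Real.arctan (g y / ε n) := fun n =>
      continuous_const.mul (Real.continuous_arctan.comp (hg.continuous.div_const _))
    have hqc : ∀ n, Continuous fun y => 1 / (1 + (g y / ε n) ^ 2) := fun n =>
      continuous_const.div (by have := hg.continuous; fun_prop) fun y => by positivity
    have hdc : ∀ n, Continuous fun y => (1 / (1 + (g y / ε n) ^ 2)) * fderiv ℝ g y v := fun n =>
      (hqc n).mul hgc
    have hfd : ∀ n y, fderiv ℝ (fun y => ε n * Real.arctan (g y / ε n)) y v
        = (1 / (1 + (g y / ε n) ^ 2)) * fderiv ℝ g y v := fun n y => by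
      rw [(hd n y).fderiv]; rfl
    have hibp : ∀ n, ∫ y, (ε n * Real.arctan (g y / ε n)) * fderiv ℝ φ y v
        = -∫ y, ((1 / (1 + (g y / ε n) ^ 2)) * fderiv ℝ g y v) * φ y := fun n => by
      have := integral_mul_fderiv_eq_neg_fderiv_mul_of_integrable (μ := volume) (v := v)
        (f := fun y => ε n * Real.arctan (g y / ε n)) (g := φ) ?_ ?_ ?_
        (fun x _ => (hd n x).differentiableAt) (fun x _ => hφd.differentiable (by simp) x)
      · simpa only [hfd] using this
      · simp only [hfd]
        exact ((hdc n).mul hφ.continuous).integrable_of_hasCompactSupport hφc.mul_left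
      · exact ((hac n).mul hφv).integrable_of_hasCompactSupport hφvc.mul_left
      · exact ((hac n).mul hφ.continuous).integrable_of_hasCompactSupport hφc.mul_left
    have hleft : Tendsto (fun n => ∫ y, (ε n * Real.arctan (g y / ε n)) * fderiv ℝ φ y v) atTop
        (𝓝 0) := by
      have hi : Integrable fun y => fderiv ℝ φ y v := hφv.integrable_of_hasCompactSupport hφvc
      have h0 : Tendsto (fun n => ε n * 2 * ∫ y, ‖fderiv ℝ φ y v‖) atTop (𝓝 0) := by
        simpa using (hεt.mul_const 2).mul_const (∫ y, ‖fderiv ℝ φ y v‖)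
      refine squeeze_zero_norm (fun n => ?_) h0
      rw [← integral_const_mul]
      refine norm_integral_le_of_norm_le (hi.norm.const_mul _) (Eventually.of_forall fun y => ?_)
      rw [norm_mul, norm_mul, Real.norm_of_nonneg (hε0 n).le]
      gcongr
      rw [Real.norm_eq_abs, abs_le]
      have h1 := Real.arctan_lt_pi_div_two (g y / ε n)
      have h2 := Real.neg_pi_div_two_lt_arctan (g y / ε n)
      have h3 := Real.pi_le_four
      constructor <;> linarith
    have hright : Tendsto (fun n => ∫ y, ((1 / (1 + (g y / ε n) ^ 2)) * fderiv ℝ g y v) * φ y) atTop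
        (𝓝 (∫ y, F y * φ y)) := by
      refine tendsto_integral_of_dominated_convergence (fun y => ‖fderiv ℝ g y v * φ y‖)
        (fun n => ((hdc n).mul hφ.continuous).aestronglyMeasurable)
        ((hgc.mul hφ.continuous).integrable_of_hasCompactSupport hφc.mul_left).norm
        (fun n => Eventually.of_forall fun y => ?_) (Eventually.of_forall fun y => ?_)
      · rw [mul_assoc, norm_mul]
        refine mul_le_of_le_one_left (norm_nonneg _) ?_
        rw [Real.norm_of_nonneg (by positivity)]
        exact div_le_one_of_le₀ (by nlinarith [sq_nonneg (g y / ε n)]) (by positivity)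
      · refine Tendsto.mul_const _ ?_
        by_cases hy : g y = 0
        · have : F y = fderiv ℝ g y v := Set.indicator_of_mem (by simpa using hy) _
          simp [hy, this]
        · have : F y = 0 := Set.indicator_of_notMem (by simpa using hy) _
          rw [this]
          have h1 : Tendsto (fun n => ε n ^ 2 / (ε n ^ 2 + g y ^ 2)) atTop
              (𝓝 (0 ^ 2 / (0 ^ 2 + g y ^ 2))) :=
            (hεt.pow 2).div ((hεt.pow 2).add_const _) (by positivity)
          have h2 := h1.mul_const (fderiv ℝ g y v)
          simp only [ne_eq, OfNat.ofNat_ne_zero, not_false_eq_true, zero_pow, zero_div, zero_mul] at h2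
          refine h2.congr fun n => ?_
          have := (hε0 n).ne'
          congr 1
          field_simp
    have h := tendsto_nhds_unique (hright.neg.congr fun n => (hibp n).symm) hleft
    simpa [mul_comm] using h
  filter_upwards [key] with y hy h0
  rwa [hF, Set.indicator_of_mem (by simpa using h0)] at hy

/-- If a `C¹` function vanishes on a part of the boundary, its gradient is normal there. -/
lemma CubeChart.ae_pd_mul_outerNormal (c : CubeChart d) {V : E d → ℝ} (hV : ContDiff ℝ 1 V)
    {S : Set (E d)} (hS : ∀ᵐ z ∂(surf c.dom), z ∈ S → V z = 0) :
    ∀ᵐ z ∂(surf c.dom), z ∈ S → ∀ k l,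
      pd k V z * outerNormal c.dom z l = pd l V z * outerNormal c.dom z k := by
  rw [c.ae_surf_iff] at hS ⊢
  intro α b
  -- Applied to `V` in the parametrisation of the face, the lemma on zero sets kills the tangential
  -- derivatives wherever `V` vanishes, even if `S` covers only part of the face.
  have h1 : ∀ i : Fin d, ∀ᵐ y ∂(volume.restrict (ucube d)), V (c.bface α b y) = 0 →
      fderiv ℝ (V ∘ c.bface α b) y (EuclideanSpace.single i 1) = 0 := fun i =>
    ae_restrict_of_ae (ae_fderiv_eq_zero_of_eq_zero (hV.comp (c.contDiff_bface α b)) _)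
  filter_upwards [hS α b, ae_all_iff.2 h1, ae_restrict_mem (isOpen_ucube d).measurableSet]
    with y hy hy1 hyu hyS
  have hyc := ucube_subset_ccube d hyu
  set ξ := face α (faceVal b) y with hξ
  have hξO : ξ ∈ c.O := c.face_mem_O hyc
  set z := c.bface α b y with hz
  have hzξ : z = c.Φ ξ := rfl
  have htan : ∀ i : Fin d, fderiv ℝ V z (fderiv ℝ c.Φ ξ (EuclideanSpace.single (α.succAbove i) 1))
      = 0 := fun i => by
    have h2 := hy1 i (hy hyS)
    rw [((hV.differentiable (by simp) _).hasFDerivAt.comp y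
      ((c.contDiff_bface α b).differentiable (by simp) y).hasFDerivAt).fderiv,
      c.fderiv_bface] at h2
    simpa [faceLin_single] using h2
  -- In the basis of images of coordinate vectors under the chart, only the transversal direction
  -- `α` contributes, so the gradient of `V` is parallel to that of the `α`-th chart coordinate,
  -- hence to the normal.
  have hpd : ∀ w : E d, fderiv ℝ V z w
      = inner ℝ w (c.grad α z) * fderiv ℝ V z (fderiv ℝ c.Φ ξ (EuclideanSpace.single α 1)) := by
    intro w
    obtain ⟨p, hp⟩ := c.fderiv_Φ_surjective hξO w
    have h2 : fderiv ℝ c.Θ z w = p := by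
      have := congrArg (fun T : E d →L[ℝ] E d => T p) (c.fderiv_comp hξO)
      simp only [ContinuousLinearMap.comp_apply, ContinuousLinearMap.id_apply] at this
      rw [← hp, hzξ, this]
    have hp' : p = ∑ β, p β • EuclideanSpace.single β (1 : ℝ) := by
      ext j; simp [Finset.sum_apply, Pi.single_apply]
    rw [c.inner_grad, h2, ← hp]
    conv_lhs => rw [hp']
    rw [map_sum, map_sum, Fin.sum_univ_succAbove _ α]
    simp only [map_smul, htan, smul_eq_mul, mul_zero, Finset.sum_const_zero, add_zero]
  intro k l
  have e : ∀ k, pd k V z = c.grad α z k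
      * fderiv ℝ V z (fderiv ℝ c.Φ ξ (EuclideanSpace.single α 1)) := fun k => by
    rw [pd, hpd]
    simp [EuclideanSpace.inner_single_left]
  rw [e, e, hz, c.outerNormal_bface α b hyu, CubeChart.faceNormal]
  simp only [PiLp.smul_apply, smul_eq_mul]
  ring

/-! ### The boundary pieces of the cylinder -/

namespace SpaceTimeDomain

variable (D : SpaceTimeDomain d)

lemma isOpen_Q : IsOpen D.Q := D.isOpen_cylinder

lemma closure_Q_subset : closure D.Q ⊆ {z | 0 ≤ z (tm d) ∧ z (tm d) ≤ D.T} := by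
  have hc : Continuous fun z : E d => z (tm d) := PiLp.continuous_apply 2 _ _
  exact closure_minimal (fun z hz => ⟨hz.1.le, hz.2.1.le⟩)
    ((isClosed_le continuous_const hc).inter (isClosed_le hc continuous_const))

lemma closure_Q_cases {z : E d} (hz : z ∈ closure D.Q) :
    z ∈ D.Q ∨ z ∈ D.top ∨ z ∈ D.lateral ∪ D.bottom := by
  by_cases hQ : z ∈ D.Q
  · exact Or.inl hQ
  have hf : z ∈ frontier D.Q := by rw [D.isOpen_Q.frontier_eq]; exact ⟨hz, hQ⟩
  obtain ⟨h0, h1⟩ := D.closure_Q_subset hz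
  rcases h0.eq_or_lt with h0 | h0
  · exact Or.inr (Or.inr (Or.inr ⟨hf, h0.symm⟩))
  rcases h1.eq_or_lt with h1 | h1
  · exact Or.inr (Or.inl ⟨hf, h1⟩)
  · exact Or.inr (Or.inr (Or.inl ⟨hf, h0, h1⟩))

lemma notMem_Q_of_frontier {z : E d} (hz : z ∈ frontier D.Q) : z ∉ D.Q := by
  rw [D.isOpen_Q.frontier_eq] at hz; exact hz.2

lemma top_notMem {z : E d} (hz : z ∈ D.top) : z ∉ D.lateral ∪ D.bottom := by
  rintro (h | h)
  · exact h.2.2.ne hz.2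
  · have := D.T_pos
    exact this.ne (h.2.symm.trans hz.2)

lemma measurableSet_top : MeasurableSet D.top :=
  isClosed_frontier.measurableSet.inter
    ((measurableSet_singleton _).preimage (PiLp.continuous_apply 2 _ _).measurable)

lemma measurableSet_lateral_union_bottom : MeasurableSet (D.lateral ∪ D.bottom) := by
  have hm : Measurable fun z : E d => z (tm d) := (PiLp.continuous_apply 2 _ _).measurable
  exact (isClosed_frontier.measurableSet.inter ((measurableSet_lt measurable_const hm).inter
    (measurableSet_lt hm measurable_const))).union
    (isClosed_frontier.measurableSet.inter ((measurableSet_singleton _).preimage hm))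

end SpaceTimeDomain

namespace Multipatch

variable {D : SpaceTimeDomain d} (M : Multipatch D)

lemma isGreenDomain (i : Fin M.N) : IsGreenDomain (M.dom i) := (M.patch i).isGreenDomain

lemma isOpen_dom (i : Fin M.N) : IsOpen (M.dom i) := (M.isGreenDomain i).isOpen

lemma disjoint_dom {i j : Fin M.N} (h : i ≠ j) : Disjoint (M.dom i) (M.dom j) :=
  M.patch_disjoint i j h

/-! ### Geometry of the interfaces -/

/-- The boundary points at which all adjacent patches have an outer normal. -/
def IsRegularPoint (y : E d) : Prop :=
  ∀ i, y ∈ frontier (M.dom i) → IsOuterNormal (M.dom i) y (M.nrm i y)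

lemma ae_isRegularPoint : ∀ᵐ y ∂(Measure.euclideanHausdorffMeasure d : Measure (E d)),
    M.IsRegularPoint y :=
  ae_all_iff.2 fun i => (ae_restrict_iff' isClosed_frontier.measurableSet).1
    (M.isGreenDomain i).ae_isOuterNormal

variable {M}

lemma IsRegularPoint.nrm_eq_neg {y : E d} (h : M.IsRegularPoint y) {i j : Fin M.N} (hij : i ≠ j)
    (hi : y ∈ frontier (M.dom i)) (hj : y ∈ frontier (M.dom j)) : M.nrm j y = -M.nrm i y :=
  IsOuterNormal.eq_neg (M.disjoint_dom hij) (M.isOpen_dom i) (h i hi) (h j hj)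

lemma IsRegularPoint.nrm_ne_zero {y : E d} (h : M.IsRegularPoint y) {i : Fin M.N}
    (hi : y ∈ frontier (M.dom i)) : M.nrm i y ≠ 0 := fun h0 => by
  simpa [h0] using (h i hi).1

/-- Three pairwise opposite vectors are all zero, which unit normals are not. -/
lemma IsRegularPoint.eq_of_mem {y : E d} (h : M.IsRegularPoint y) {i j k : Fin M.N} (hij : i ≠ j)
    (hik : i ≠ k) (hi : y ∈ frontier (M.dom i)) (hj : y ∈ frontier (M.dom j))
    (hk : y ∈ frontier (M.dom k)) : j = k := by
  by_contra hjk
  have h1 := h.nrm_eq_neg hij hi hj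
  have h2 := h.nrm_eq_neg hik hi hk
  have h3 := h.nrm_eq_neg hjk hj hk
  rw [h1, h2, neg_neg] at h3
  refine h.nrm_ne_zero hi ?_
  ext t
  have h4 := congrArg (fun z : E d => z t) h3
  simp only [PiLp.neg_apply] at h4
  rw [PiLp.zero_apply]
  linarith

/-- Points outside the closure of the patch accumulate at `y`. Near `y` they lie in `Q`, hence in
closures of other patches, and by finiteness one patch occurs arbitrarily close to `y`; disjointness
puts `y` on its boundary. -/
lemma IsRegularPoint.exists_ne {y : E d} (h : M.IsRegularPoint y) {i : Fin M.N}
    (hi : y ∈ frontier (M.dom i)) (hQ : y ∈ D.Q) : ∃ j, i ≠ j ∧ y ∈ frontier (M.dom j) := by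
  have h1 := (h i hi).frequently_notMem_closure
  have h2 : ∃ᶠ z in 𝓝 y, ∃ j, i ≠ j ∧ z ∈ closure (M.dom j) := by
    refine (h1.and_eventually (D.isOpen_Q.mem_nhds hQ)).mono fun z hz => ?_
    have h3 : z ∈ ⋃ j, closure (M.dom j) := M.closure_eq ▸ subset_closure hz.2
    obtain ⟨j, hj⟩ := Set.mem_iUnion.1 h3
    exact ⟨j, fun h => hz.1 (h ▸ hj), hj⟩
  obtain ⟨j, hj⟩ := frequently_exists.1 h2
  obtain ⟨_, hij, -⟩ := hj.exists
  refine ⟨j, hij, ?_⟩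
  have hyc : y ∈ closure (M.dom j) := isClosed_closure.mem_of_frequently_of_tendsto
    (hj.mono fun z hz => hz.2) tendsto_id
  rw [(M.isOpen_dom j).frontier_eq]
  refine ⟨hyc, fun hyj => ?_⟩
  exact Set.disjoint_left.1 ((M.disjoint_dom hij).closure_left (M.isOpen_dom j))
    (frontier_subset_closure hi) hyj

/-- The patch lies below the hyperplane `t = T`, so its normal at a point of that hyperplane can
only be the time direction. -/
lemma IsRegularPoint.nrm_top {y : E d} (h : M.IsRegularPoint y) {i : Fin M.N}
    (hy : y ∈ M.topFacet i) : M.nrm i y = EuclideanSpace.single (tm d) 1 := by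
  refine (h i hy.1).eq_of_halfspace (by simp) fun z hz => ?_
  have h1 : z (tm d) < D.T := (M.patch_subset i hz).2.1
  have h2 : y (tm d) = D.T := hy.2.2
  rw [EuclideanSpace.inner_single_right]
  simp only [PiLp.sub_apply]
  simp
  linarith

variable (M)

lemma frontier_subset (i : Fin M.N) : frontier (M.dom i) ⊆ closure D.Q :=
  frontier_subset_closure.trans (closure_mono (M.patch_subset i))

lemma measurableSet_facet (i j : Fin M.N) : MeasurableSet (M.facet i j) :=
  D.isOpen_Q.measurableSet.inter
    (isClosed_frontier.measurableSet.inter isClosed_frontier.measurableSet)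

lemma measurableSet_topFacet (i : Fin M.N) : MeasurableSet (M.topFacet i) :=
  isClosed_frontier.measurableSet.inter D.measurableSet_top

/-- Boundary integrals over the patches, split into interior facets, top and the rest. -/
theorem sum_integral_surf {b : Fin M.N → E d → ℝ} (hb : ∀ i, Integrable (b i) (surf (M.dom i))) :
    ∑ i, ∫ y, b i y ∂(surf (M.dom i))
      = M.sumFacets (fun i j => surfInt (M.facet i j) fun y => b i y + b j y)
        + (∑ i, surfInt (M.topFacet i) (b i))
        + ∑ i, ∫ y in D.lateral ∪ D.bottom, b i y ∂(surf (M.dom i)) := by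
  set H : Measure (E d) := Measure.euclideanHausdorffMeasure d with hH
  have hF : ∀ i j, M.facet i j ⊆ frontier (M.dom i) := fun i j y hy => hy.2.1
  have hF' : ∀ i j, M.facet i j ⊆ frontier (M.dom j) := fun i j y hy => hy.2.2
  have hcomm : ∀ i j, M.facet i j = M.facet j i := fun i j => by
    rw [facet, facet, Set.inter_comm (frontier (M.dom i))]
  have hint : ∀ i j, IntegrableOn (b i) (M.facet i j) H := fun i j =>
    IntegrableOn.mono_set (hb i) (hF i j)
  have key : ∀ i, ∫ y, b i y ∂(surf (M.dom i))
      = (∑ j ∈ {i}ᶜ, ∫ y in M.facet i j, b i y ∂H) + surfInt (M.topFacet i) (b i)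
        + ∫ y in D.lateral ∪ D.bottom, b i y ∂(surf (M.dom i)) := by
    intro i
    have e1 : ∀ j, ∫ y in M.facet i j, b i y ∂H
        = ∫ y, (M.facet i j).indicator (b i) y ∂(surf (M.dom i)) := fun j => by
      rw [integral_indicator (M.measurableSet_facet i j), surf,
        Measure.restrict_restrict (M.measurableSet_facet i j),
        Set.inter_eq_left.2 (hF i j)]
    have e2 : surfInt (M.topFacet i) (b i)
        = ∫ y, D.top.indicator (b i) y ∂(surf (M.dom i)) := by
      rw [integral_indicator D.measurableSet_top, surf,
        Measure.restrict_restrict D.measurableSet_top, Set.inter_comm]; rfl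
    have e3 := integral_indicator (μ := surf (M.dom i)) (f := b i)
      D.measurableSet_lateral_union_bottom
    simp only [e1]
    rw [e2, ← e3, ← integral_finsetSum, ← integral_add, ← integral_add]
    -- Almost every boundary point lies on exactly one interior facet, or on the top, or on the
    -- remaining boundary, so the indicators add up to one.
    · refine integral_congr_ae ((ae_restrict_iff' isClosed_frontier.measurableSet).2 ?_)
      filter_upwards [M.ae_isRegularPoint] with y hy hyi
      rcases D.closure_Q_cases (M.frontier_subset i hyi) with h | h | h
      · obtain ⟨j, hij, hj⟩ := hy.exists_ne hyi h
        have h1 : y ∉ D.top := fun h' => D.notMem_Q_of_frontier h'.1 h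
        have h2 : y ∉ D.lateral ∪ D.bottom := fun h' =>
          D.notMem_Q_of_frontier (h'.elim (fun h => h.1) fun h => h.1) h
        rw [Set.indicator_of_notMem h1, Set.indicator_of_notMem h2, Finset.sum_eq_single j]
        · rw [Set.indicator_of_mem (show y ∈ M.facet i j from ⟨h, hyi, hj⟩)]; ring
        · intro k hk hkj
          refine Set.indicator_of_notMem (fun hyk => hkj ?_) _
          exact (hy.eq_of_mem hij (fun h => by simp [h] at hk) hyi hj hyk.2.2).symm
        · intro hj'; exact absurd (by simpa using Ne.symm hij) hj'
      · have h1 : ∀ j, y ∉ M.facet i j := fun j hj => D.notMem_Q_of_frontier h.1 hj.1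
        rw [Set.indicator_of_mem h, Set.indicator_of_notMem (D.top_notMem h)]
        simp [Set.indicator_of_notMem (h1 _)]
      · have h1 : ∀ j, y ∉ M.facet i j := fun j hj =>
          D.notMem_Q_of_frontier (h.elim (fun h => h.1) fun h => h.1) hj.1
        have h2 : y ∉ D.top := fun h' => D.top_notMem h' h
        rw [Set.indicator_of_mem h, Set.indicator_of_notMem h2]
        simp [Set.indicator_of_notMem (h1 _)]
    · exact (integrable_finsetSum _ fun j _ => (hb i).indicator (M.measurableSet_facet i j)).add
        ((hb i).indicator D.measurableSet_top)
    · exact (hb i).indicator D.measurableSet_lateral_union_bottom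
    · exact integrable_finsetSum _ fun j _ => (hb i).indicator (M.measurableSet_facet i j)
    · exact (hb i).indicator D.measurableSet_top
    · exact fun j _ => (hb i).indicator (M.measurableSet_facet i j)
  rw [Finset.sum_congr rfl fun i _ => key i, Finset.sum_add_distrib, Finset.sum_add_distrib]
  congr 2
  -- The sum over ordered pairs is folded into a sum over unordered ones, collecting both one-sided
  -- contributions on each facet.
  have hs := Finset.sum_sum_Ioi_add_eq_sum_sum_off_diag
    (fun j i : Fin M.N => ∫ y in M.facet i j, b i y ∂H)
  rw [← hs]
  refine Finset.sum_congr rfl fun i _ => Finset.sum_congr rfl fun j _ => ?_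
  change _ = ∫ y in M.facet i j, (b i y + b j y) ∂H
  rw [integral_add (hint i j) (hcomm i j ▸ hint j i), hcomm j i]

/-! ### Traces on interior facets -/

lemma ae_mem_iUnion_dom : ∀ᵐ z ∂(volume : Measure (E d)), z ∈ D.Q → ∃ i, z ∈ M.dom i := by
  have h : ∀ᵐ z ∂(volume : Measure (E d)), ∀ i, z ∉ frontier (M.dom i) :=
    ae_all_iff.2 fun i => measure_eq_zero_iff_ae_notMem.1 (M.isGreenDomain i).volume_frontier
  filter_upwards [h] with z hz hQ
  have h3 : z ∈ ⋃ j, closure (M.dom j) := M.closure_eq ▸ subset_closure hQ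
  obtain ⟨j, hj⟩ := Set.mem_iUnion.1 h3
  refine ⟨j, ?_⟩
  by_contra hzj
  exact hz j (by rw [(M.isOpen_dom j).frontier_eq]; exact ⟨hj, hzj⟩)

lemma setIntegral_Q {F : E d → ℝ} (hF : IntegrableOn F D.Q) :
    ∫ z in D.Q, F z = ∑ i, ∫ z in M.dom i, F z := by
  have h1 : ∫ z in D.Q, F z = ∫ z in ⋃ i, M.dom i, F z := by
    refine setIntegral_congr_set ?_
    filter_upwards [M.ae_mem_iUnion_dom] with z hz
    refine propext ⟨fun h => Set.mem_iUnion.2 (hz h), fun h => ?_⟩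
    obtain ⟨i, hi⟩ := Set.mem_iUnion.1 h
    exact M.patch_subset i hi
  rw [h1, integral_iUnion_fintype (fun i => (M.isOpen_dom i).measurableSet)
    (fun i j hij => M.disjoint_dom hij) fun i => hF.mono_set (M.patch_subset i)]

lemma der_ae_eq {w : E d → ℝ} (hw : MemH1 D.Q w) (i : Fin M.N) (k : Fin (d + 1)) :
    M.der i k w =ᵐ[volume.restrict (M.dom i)] weakPartial D.Q k w :=
  ((hw.hasWeakPartial k).mono (M.patch_subset i)).ae_eq (M.isOpen_dom i)

lemma isTrace_tr (i : Fin M.N) {w : E d → ℝ} (hw : MemH1 (M.dom i) w) :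
    IsTrace (M.dom i) w (M.tr i w) := (M.isGreenDomain i).isTrace_trace hw

/-- The one-sided traces of an `H¹` function agree on interior facets. -/
theorem tr_ae_eq_tr {w : E d → ℝ} (hw : MemH1 D.Q w) :
    ∀ᵐ y ∂(Measure.euclideanHausdorffMeasure d : Measure (E d)), ∀ i j,
      y ∈ M.facet i j → M.tr i w y = M.tr j w y := by
  set H : Measure (E d) := Measure.euclideanHausdorffMeasure d with hH
  set ν : Measure (E d) := H.restrict (⋃ i, frontier (M.dom i)) with hν
  have hwi : ∀ i, MemH1 (M.dom i) w := fun i => hw.mono (M.patch_subset i)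
  have hmF : ∀ i, MeasurableSet (frontier (M.dom i)) := fun i => isClosed_frontier.measurableSet
  have hνi : ∀ i, ν.restrict (frontier (M.dom i)) = surf (M.dom i) := fun i => by
    rw [hν, Measure.restrict_restrict (hmF i), Set.inter_eq_left.2 (Set.subset_iUnion (fun i => frontier (M.dom i)) i)]; rfl
  have hfin : ∀ i, IsFiniteMeasure (surf (M.dom i)) := fun i => ⟨(M.isGreenDomain i).surf_lt_top⟩
  have hL : ∀ i k, MemLp (fun y => M.tr i w y * M.nrm i y k) 2 (surf (M.dom i)) := fun i k =>
    (M.isGreenDomain i).memLp_mul_outerNormal k (M.isTrace_tr i (hwi i)).1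
  -- The `k`-th component of the jump of `w` on the union of all patch boundaries, carried by the
  -- single measure `ν`.
  set f : Fin (d + 1) → E d → ℝ := fun k y =>
    ∑ i, (frontier (M.dom i)).indicator (fun y => M.tr i w y * M.nrm i y k) y with hf
  have hind : ∀ i k, Integrable ((frontier (M.dom i)).indicator
      (fun y => M.tr i w y * M.nrm i y k)) ν := fun i k =>
    (integrable_indicator_iff (hmF i)).2 (by
      rw [IntegrableOn, hνi]; exact (hL i k).integrable (by norm_num))
  -- Summing Green's formula over the patches against a test function supported in `Q`, the volume
  -- terms add up to zero by the weak derivative of `w` on all of `Q`. So the jump integrates to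
  -- zero against every such test function.
  have key : ∀ k, ∀ᵐ y ∂ν, y ∈ D.Q → f k y = 0 := by
    intro k
    have hfi : Integrable (f k) ν := integrable_finsetSum _ fun i _ => hind i k
    refine D.isOpen_Q.ae_eq_zero_of_integral_contDiff_smul_eq_zero
      (hfi.locallyIntegrable.locallyIntegrableOn _) fun φ hφ hφc hφs => ?_
    have hφ1 : ContDiff ℝ 1 φ := hφ.of_le (by simp)
    have hwk := hw.hasWeakPartial k
    have hp := pd_continuous hφ1 k
    have hpc := pd_hasCompactSupport hφc k
    have i1 : IntegrableOn (fun z => weakPartial D.Q k w z * φ z) D.Q :=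
      LocallyIntegrableOn.mul_test D.isOpen_Q hwk.2.1 hφ.continuous hφc hφs
    have i2 : IntegrableOn (fun z => w z * pd k φ z) D.Q :=
      LocallyIntegrableOn.mul_test D.isOpen_Q hwk.1 hp hpc ((tsupport_pd_subset φ k).trans hφs)
    have e1 : ∀ i, (∫ z in M.dom i, weakPartial D.Q k w z * φ z)
        + ∫ z in M.dom i, w z * pd k φ z
        = ∫ y, (M.tr i w y * M.nrm i y k) * φ y ∂(surf (M.dom i)) := by
      intro i
      have hG := M.isGreenDomain i
      have h := hG.green_trace (hwi i) (hG.memH1_of_contDiff hφ1) (M.isTrace_tr i (hwi i))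
        (hG.isTrace_of_contDiff hφ) k
      have h1 : ∫ z in M.dom i, weakPartial D.Q k w z * φ z
          = ∫ z in M.dom i, weakPartial (M.dom i) k w z * φ z := by
        refine integral_congr_ae ?_
        filter_upwards [M.der_ae_eq hw i k] with z hz
        rw [← hz]; rfl
      have h2 : ∫ z in M.dom i, w z * pd k φ z
          = ∫ z in M.dom i, w z * weakPartial (M.dom i) k φ z := by
        refine integral_congr_ae ?_
        filter_upwards [(hasWeakPartial_of_contDiff hφ1 (M.dom i) k).ae_eq hG.isOpen] with z hz
        rw [hz]
      rw [h1, h2, h]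
      refine integral_congr_ae (Eventually.of_forall fun y => ?_)
      simp only [nrm]; ring
    have e2 : ∫ y, φ y • f k y ∂ν
        = ∑ i, ∫ y, (M.tr i w y * M.nrm i y k) * φ y ∂(surf (M.dom i)) := by
      obtain ⟨B, hB⟩ := hφ.continuous.bounded_above_of_compact_support hφc
      have : ∀ i, ∫ y, (M.tr i w y * M.nrm i y k) * φ y ∂(surf (M.dom i))
          = ∫ y, (frontier (M.dom i)).indicator (fun y => M.tr i w y * M.nrm i y k) y * φ y ∂ν := by
        intro i
        rw [← hνi, ← integral_indicator (hmF i)]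
        refine integral_congr_ae (Eventually.of_forall fun y => ?_)
        by_cases hy : y ∈ frontier (M.dom i) <;> simp [hy]
      rw [Finset.sum_congr rfl fun i _ => this i, ← integral_finsetSum]
      · refine integral_congr_ae (Eventually.of_forall fun y => ?_)
        simp only [hf, smul_eq_mul]
        rw [mul_comm, Finset.sum_mul]
      · exact fun i _ => (hind i k).mul_bdd hφ.continuous.aestronglyMeasurable
          (Eventually.of_forall hB)
    rw [e2, ← Finset.sum_congr rfl fun i _ => e1 i, Finset.sum_add_distrib,
      ← M.setIntegral_Q i1, ← M.setIntegral_Q i2, hwk.2.2 φ hφ hφc hφs]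
    ring
  have hall : ∀ᵐ y ∂H, y ∈ ⋃ i, frontier (M.dom i) → ∀ k, y ∈ D.Q → f k y = 0 :=
    (ae_restrict_iff' (MeasurableSet.iUnion hmF)).1 (ae_all_iff.2 key)
  filter_upwards [hall, M.ae_isRegularPoint] with y hy hyr i j hyF
  by_cases hij : i = j
  · rw [hij]
  obtain ⟨hQ, hi, hj⟩ := hyF
  have hn := hyr.nrm_eq_neg hij hi hj
  -- At a regular point of the facet only the two patches `i` and `j` contribute, with opposite
  -- normals.
  have hsum : ∀ k, (M.tr i w y - M.tr j w y) * M.nrm i y k = 0 := by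
    intro k
    have h := hy (Set.mem_iUnion.2 ⟨i, hi⟩) k hQ
    rw [hf] at h
    beta_reduce at h
    rw [Finset.sum_eq_add_of_mem i j (Finset.mem_univ _) (Finset.mem_univ _) hij,
      Set.indicator_of_mem hi, Set.indicator_of_mem hj, hn] at h
    · rw [← h]; simp only [PiLp.neg_apply]; ring
    · intro l _ hl
      refine Set.indicator_of_notMem (fun hyl => ?_) _
      exact hl.2 (hyr.eq_of_mem hij hl.1.symm hi hj hyl).symm
  obtain ⟨k, hk⟩ : ∃ k, M.nrm i y k ≠ 0 := by
    by_contra! h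
    exact hyr.nrm_ne_zero hi (by ext k; simpa using h k)
  exact sub_eq_zero.1 ((mul_eq_zero.1 (hsum k)).resolve_right hk)

end Multipatch

/-! ### The differential equation -/

lemma pd_comm {φ : E d → ℝ} (hφ : ContDiff ℝ ∞ φ) (k l : Fin (d + 1)) (z : E d) :
    pd k (pd l φ) z = pd l (pd k φ) z := by
  have h2 : ContDiff ℝ 1 (fderiv ℝ φ) := hφ.fderiv_right (m := 1) (by norm_num; exact ENat.LEInfty.out)
  have e : ∀ k l, pd k (pd l φ) z
      = fderiv ℝ (fderiv ℝ φ) z (EuclideanSpace.single k 1) (EuclideanSpace.single l 1) := by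
    intro k l
    have h3 := (h2.differentiable (by simp) z).hasFDerivAt.clm_apply
      (hasFDerivAt_const (EuclideanSpace.single l (1 : ℝ)) z)
    rw [pd, show pd l φ = fun z => fderiv ℝ φ z (EuclideanSpace.single l 1) from rfl, h3.fderiv]
    simp
  rw [e, e]
  have hs : IsSymmSndFDerivAt ℝ φ z :=
    hφ.contDiffAt.isSymmSndFDerivAt (by simp; exact ENat.LEInfty.out)
  exact hs.eq _ _

lemma contDiff_pd {φ : E d → ℝ} (hφ : ContDiff ℝ ∞ φ) (k : Fin (d + 1)) : ContDiff ℝ ∞ (pd k φ) :=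
  (hφ.fderiv_right (m := ∞) (by simp)).clm_apply contDiff_const

/-- Weak second derivatives commute. -/
lemma MemH2.weakPartial_comm {U : Set (E d)} (hU : IsOpen U) {v : E d → ℝ} (hv : MemH2 U v)
    (k l : Fin (d + 1)) :
    weakPartial U k (weakPartial U l v) =ᵐ[volume.restrict U]
      weakPartial U l (weakPartial U k v) := by
  have h1 := (hv.2 l).hasWeakPartial k
  have h2 := (hv.2 k).hasWeakPartial l
  refine HasWeakPartial.ae_eq hU ⟨h1.1, h2.2.1, fun φ hφ hc hs => ?_⟩
  rw [(neg_eq_iff_eq_neg.2 ((hv.1.hasWeakPartial l).2.2 _ (contDiff_pd hφ k)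
      (pd_hasCompactSupport hc k) ((tsupport_pd_subset φ k).trans hs))).symm, ← h2.2.2 φ hφ hc hs,
    (neg_eq_iff_eq_neg.2 ((hv.1.hasWeakPartial k).2.2 _ (contDiff_pd hφ l)
      (pd_hasCompactSupport hc l) ((tsupport_pd_subset φ l).trans hs))).symm]
  simp only [pd_comm hφ k l]

namespace SpaceTimeDomain

variable (D : SpaceTimeDomain d)

lemma memTest_of_hasCompactSupport {φ : E d → ℝ} (hφ : ContDiff ℝ ∞ φ) (hc : HasCompactSupport φ)
    (hs : tsupport φ ⊆ D.Q) : D.MemTest φ := by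
  have hφ1 : ContDiff ℝ 1 φ := hφ.of_le (by simp)
  have hL : ∀ {ψ : E d → ℝ}, Continuous ψ → HasCompactSupport ψ →
      MemLp ψ 2 (volume.restrict D.Q) := fun h h' => (h.memLp_of_hasCompactSupport h').restrict _
  have hw := fun k => hasWeakPartial_of_contDiff hφ1 D.Q k
  refine ⟨⟨hL hφ.continuous hc, fun k =>
    ⟨_, hL (pd_continuous hφ1 k) (pd_hasCompactSupport hc k), hw k⟩⟩, fun _ => φ, fun _ => hφ,
    fun _ => ?_, by simp [TendstoL2], fun k => ?_⟩
  · have h1 : closure (D.lateral ∪ D.top) ⊆ frontier D.Q :=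
      closure_minimal (Set.union_subset (fun z hz => hz.1) fun z hz => hz.1) isClosed_frontier
    exact Set.disjoint_left.2 fun z hz hz' => D.notMem_Q_of_frontier (h1 hz') (hs hz)
  · exact TendstoL2.congr (a' := pd k φ) (by simp [TendstoL2]) ((hw k).ae_eq D.isOpen_Q).symm

/-- A weak solution in `H²(Q)` satisfies the heat equation almost everywhere. -/
lemma IsWeakSolution.ae_eq {D : SpaceTimeDomain d} {f u : E d → ℝ}
    (hu : D.IsWeakSolution f u) (hf : MemLp f 2 (volume.restrict D.Q)) (hu2 : MemH2 D.Q u) :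
    f =ᵐ[volume.restrict D.Q] fun z => weakPartial D.Q (tm d) u z
      - ∑ k : Fin d, weakPartial D.Q (sp k) (weakPartial D.Q (sp k) u) z := by
  have hQ := D.isOpen_Q
  have hli : ∀ {g : E d → ℝ}, MemLp g 2 (volume.restrict D.Q) → LocallyIntegrableOn g D.Q :=
    fun hg => locallyIntegrableOn_of_locallyIntegrable_restrict (hg.locallyIntegrable (by norm_num))
  set g : E d → ℝ := fun z => weakPartial D.Q (tm d) u z
      - ∑ k : Fin d, weakPartial D.Q (sp k) (weakPartial D.Q (sp k) u) z with hg
  have hgL : MemLp g 2 (volume.restrict D.Q) :=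
    (hu2.1.memLp hQ _).sub (memLp_finsetSum _ fun k _ => (hu2.2 _).memLp hQ _)
  -- Smooth functions supported in `Q` are admissible in the weak problem and leave no boundary
  -- terms, so the residual of the equation annihilates them all.
  have key : ∀ᵐ z ∂(volume : Measure (E d)), z ∈ D.Q → (g - f) z = 0 := by
    refine hQ.ae_eq_zero_of_integral_contDiff_smul_eq_zero (hli (hgL.sub hf))
      fun φ hφ hc hs => ?_
    have hφ1 : ContDiff ℝ 1 φ := hφ.of_le (by simp)
    have h := hu.2 φ (D.memTest_of_hasCompactSupport hφ hc hs)
    have hpd := fun k => (hasWeakPartial_of_contDiff hφ1 D.Q k).ae_eq hQ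
    have hi : ∀ {a : E d → ℝ}, MemLp a 2 (volume.restrict D.Q) →
        IntegrableOn (fun z => a z * φ z) D.Q := fun ha =>
      LocallyIntegrableOn.mul_test hQ (hli ha) hφ.continuous hc hs
    have hip : ∀ {a : E d → ℝ} (k : Fin (d + 1)), MemLp a 2 (volume.restrict D.Q) →
        IntegrableOn (fun z => a z * pd k φ z) D.Q := fun k ha =>
      LocallyIntegrableOn.mul_test hQ (hli ha) (pd_continuous hφ1 k) (pd_hasCompactSupport hc k)
        ((tsupport_pd_subset φ k).trans hs)
    have e1 : ∫ z in D.Q, u z * weakPartial D.Q (tm d) φ z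
        = -∫ z in D.Q, weakPartial D.Q (tm d) u z * φ z := by
      rw [← (hu2.1.hasWeakPartial (tm d)).2.2 φ hφ hc hs]
      refine integral_congr_ae ?_
      filter_upwards [hpd (tm d)] with z hz
      rw [hz]
    have e2 : ∫ z in D.Q, ∑ k : Fin d, weakPartial D.Q (sp k) u z * weakPartial D.Q (sp k) φ z
        = -∑ k : Fin d, ∫ z in D.Q, weakPartial D.Q (sp k) (weakPartial D.Q (sp k) u) z * φ z := by
      rw [← Finset.sum_neg_distrib]
      have : ∫ z in D.Q, ∑ k : Fin d, weakPartial D.Q (sp k) u z * weakPartial D.Q (sp k) φ z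
          = ∫ z in D.Q, ∑ k : Fin d, weakPartial D.Q (sp k) u z * pd (sp k) φ z := by
        refine integral_congr_ae ?_
        filter_upwards [ae_all_iff.2 hpd] with z hz
        simp only [hz]
      rw [this, integral_finsetSum _ fun k _ => hip _ (hu2.1.memLp hQ _)]
      exact Finset.sum_congr rfl fun k _ => ((hu2.2 (sp k)).hasWeakPartial (sp k)).2.2 φ hφ hc hs
    rw [weakForm, e1, e2, neg_neg] at h
    have e3 : ∫ z, φ z • (g - f) z = (∫ z in D.Q, g z * φ z) - ∫ z in D.Q, f z * φ z := by
      rw [← integral_sub (hi hgL) (hi hf), eq_comm]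
      have : ∀ z, g z * φ z - f z * φ z = φ z • (g - f) z := fun z => by
        simp only [smul_eq_mul, Pi.sub_apply]; ring
      simp only [this]
      refine setIntegral_eq_integral_of_forall_compl_eq_zero fun z hz => ?_
      rw [image_eq_zero_of_notMem_tsupport fun h => hz (hs h), zero_smul]
    have e4 : ∫ z in D.Q, g z * φ z = (∫ z in D.Q, weakPartial D.Q (tm d) u z * φ z)
        - ∑ k : Fin d, ∫ z in D.Q, weakPartial D.Q (sp k) (weakPartial D.Q (sp k) u) z * φ z := by
      have i2 : ∀ k : Fin d, IntegrableOn
          (fun z => weakPartial D.Q (sp k) (weakPartial D.Q (sp k) u) z * φ z) D.Q := fun k =>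
        hi ((hu2.2 _).memLp hQ _)
      rw [← integral_finsetSum _ fun k _ => i2 k,
        ← integral_sub (hi (hu2.1.memLp hQ _)) (integrable_finsetSum _ fun k _ => i2 k)]
      refine integral_congr_ae (Eventually.of_forall fun z => ?_)
      simp only [hg, sub_mul, Finset.sum_mul]
    rw [e3, e4, ← h]
    ring
  refine (ae_restrict_iff' hQ.measurableSet).2 ?_
  filter_upwards [key] with z hz hzQ
  exact (sub_eq_zero.1 (hz hzQ)).symm

end SpaceTimeDomain

/-! ### Integration by parts on one patch -/

lemma integral_lin_comb {α : Type*} [MeasurableSpace α] {μ : Measure α} {a b c e : α → ℝ}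
    (ha : Integrable a μ) (hb : Integrable b μ) (hc : Integrable c μ) (he : Integrable e μ)
    (r τ : ℝ) : ∫ z, (r * a z + τ * b z + c z - τ * e z) ∂μ
      = r * (∫ z, a z ∂μ) + τ * (∫ z, b z ∂μ) + (∫ z, c z ∂μ) - τ * ∫ z, e z ∂μ := by
  have h1 : Integrable (fun z => r * a z + τ * b z) μ := (ha.const_mul r).add (hb.const_mul τ)
  have h2 : Integrable (fun z => r * a z + τ * b z + c z) μ := h1.add hc
  rw [integral_sub h2 (he.const_mul τ), integral_add h1 hc,
    integral_add (ha.const_mul r) (hb.const_mul τ), integral_const_mul, integral_const_mul,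
    integral_const_mul]

/-- Integration by parts on one patch. -/
theorem IsGreenDomain.integral_identity {U : Set (E d)} (hU : IsGreenDomain U) {u v f : E d → ℝ}
    (hu : MemH2 U u) (hv : MemH2 U v) (τ : ℝ)
    (hf : f =ᵐ[volume.restrict U] fun z => weakPartial U (tm d) u z
      - ∑ k : Fin d, weakPartial U (sp k) (weakPartial U (sp k) u) z) :
    ∫ z in U, (-(u z * weakPartial U (tm d) v z)
        + τ * (weakPartial U (tm d) u z * weakPartial U (tm d) v z)
        + ∑ k : Fin d, weakPartial U (sp k) u z * weakPartial U (sp k) v z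
        - τ * ∑ k : Fin d, weakPartial U (tm d) (weakPartial U (sp k) u) z
            * weakPartial U (sp k) v z)
      = (∫ z in U, f z * (v z + τ * weakPartial U (tm d) v z))
        - (∫ y, trace U u y * (trace U v y * outerNormal U y (tm d)) ∂(surf U))
        + (∑ k : Fin d, ∫ y, trace U (weakPartial U (sp k) u) y
            * (trace U v y * outerNormal U y (sp k)) ∂(surf U))
        + τ * ((∑ k : Fin d, ∫ y, trace U (weakPartial U (sp k) u) y
              * (trace U (weakPartial U (tm d) v) y * outerNormal U y (sp k)) ∂(surf U))
            - ∑ k : Fin d, ∫ y, trace U (weakPartial U (sp k) u) y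
              * (trace U (weakPartial U (sp k) v) y * outerNormal U y (tm d)) ∂(surf U)) := by
  have hO := hU.isOpen
  have hi : ∀ {a b : E d → ℝ}, MemLp a 2 (volume.restrict U) → MemLp b 2 (volume.restrict U) →
      IntegrableOn (fun z => a z * b z) U := fun ha hb => ha.integrable_mul hb
  have lu := fun k => hu.1.memLp hO k
  have lv := fun k => hv.1.memLp hO k
  have luu := fun k l => (hu.2 k).memLp hO l
  have tr : ∀ {w : E d → ℝ}, MemH1 U w → IsTrace U w (trace U w) := fun h => hU.isTrace_trace h
  have G1 := hU.green_trace hu.1 hv.1 (tr hu.1) (tr hv.1) (tm d)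
  have G2 := Finset.sum_congr rfl fun (k : Fin d) (_ : k ∈ Finset.univ) =>
    hU.green_trace (hu.2 (sp k)) hv.1 (tr (hu.2 (sp k))) (tr hv.1) (sp k)
  have G3 := Finset.sum_congr rfl fun (k : Fin d) (_ : k ∈ Finset.univ) =>
    hU.green_trace (hu.2 (sp k)) (hv.2 (tm d)) (tr (hu.2 (sp k))) (tr (hv.2 (tm d))) (sp k)
  have G4 := Finset.sum_congr rfl fun (k : Fin d) (_ : k ∈ Finset.univ) =>
    hU.green_trace (hu.2 (sp k)) (hv.2 (sp k)) (tr (hu.2 (sp k))) (tr (hv.2 (sp k))) (tm d)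
  -- Commuting the mixed derivatives of `v` gives `G3` and `G4` a common volume integral.
  -- Eliminating it trades `-∂_t∇u·∇v` for `-Δu ∂_t v` plus boundary terms, without third
  -- derivatives of `u`.
  have hc : ∀ k : Fin d,
      ∫ z in U, weakPartial U (sp k) u z * weakPartial U (sp k) (weakPartial U (tm d) v) z
        = ∫ z in U, weakPartial U (sp k) u z * weakPartial U (tm d) (weakPartial U (sp k) v) z := by
    intro k
    refine integral_congr_ae ?_
    filter_upwards [hv.weakPartial_comm hO (sp k) (tm d)] with z hz
    rw [hz]
  simp only [hc] at G3
  rw [Finset.sum_add_distrib] at G2 G3 G4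
  have hL : ∫ z in U, (-(u z * weakPartial U (tm d) v z)
        + τ * (weakPartial U (tm d) u z * weakPartial U (tm d) v z)
        + ∑ k : Fin d, weakPartial U (sp k) u z * weakPartial U (sp k) v z
        - τ * ∑ k : Fin d, weakPartial U (tm d) (weakPartial U (sp k) u) z
            * weakPartial U (sp k) v z)
      = -(∫ z in U, u z * weakPartial U (tm d) v z)
        + τ * (∫ z in U, weakPartial U (tm d) u z * weakPartial U (tm d) v z)
        + (∑ k : Fin d, ∫ z in U, weakPartial U (sp k) u z * weakPartial U (sp k) v z)
        - τ * ∑ k : Fin d, ∫ z in U, weakPartial U (tm d) (weakPartial U (sp k) u) z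
            * weakPartial U (sp k) v z := by
    have i1 := hi hu.1.1 (lv (tm d))
    have i2 := hi (lu (tm d)) (lv (tm d))
    have i3 := fun k : Fin d => hi (lu (sp k)) (lv (sp k))
    have i4 := fun k : Fin d => hi (luu (sp k) (tm d)) (lv (sp k))
    have s3 := integrable_finsetSum Finset.univ fun k _ => i3 k
    have s4 := integrable_finsetSum Finset.univ fun k _ => i4 k
    have h := integral_lin_comb i1 i2 s3 s4 (-1) τ
    simp only [neg_one_mul, integral_finsetSum _ fun k _ => i3 k,
      integral_finsetSum _ fun k _ => i4 k] at h
    exact h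
  have hR : ∫ z in U, f z * (v z + τ * weakPartial U (tm d) v z)
      = (∫ z in U, weakPartial U (tm d) u z * v z)
        - (∑ k : Fin d, ∫ z in U, weakPartial U (sp k) (weakPartial U (sp k) u) z * v z)
        + τ * ((∫ z in U, weakPartial U (tm d) u z * weakPartial U (tm d) v z)
          - ∑ k : Fin d, ∫ z in U, weakPartial U (sp k) (weakPartial U (sp k) u) z
            * weakPartial U (tm d) v z) := by
    have i1 := hi (lu (tm d)) hv.1.1
    have i2 := hi (lu (tm d)) (lv (tm d))
    have i3 := fun k : Fin d => hi (luu (sp k) (sp k)) hv.1.1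
    have i4 := fun k : Fin d => hi (luu (sp k) (sp k)) (lv (tm d))
    have s3 := integrable_finsetSum Finset.univ fun k _ => i3 k
    have s4 := integrable_finsetSum Finset.univ fun k _ => i4 k
    have e : ∀ᵐ z ∂(volume.restrict U), f z * (v z + τ * weakPartial U (tm d) v z)
        = -1 * (∑ k : Fin d, weakPartial U (sp k) (weakPartial U (sp k) u) z * v z)
          + τ * (weakPartial U (tm d) u z * weakPartial U (tm d) v z)
          + weakPartial U (tm d) u z * v z
          - τ * ∑ k : Fin d, weakPartial U (sp k) (weakPartial U (sp k) u) z
              * weakPartial U (tm d) v z := by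
      filter_upwards [hf] with z hz
      rw [hz, ← Finset.sum_mul, ← Finset.sum_mul]
      ring
    have h := integral_lin_comb s3 i2 i1 s4 (-1) τ
    rw [integral_finsetSum _ fun k _ => i3 k, integral_finsetSum _ fun k _ => i4 k] at h
    rw [integral_congr_ae e]
    refine h.trans ?_
    ring
  rw [hL, hR, ← G1, ← G2, ← G3, ← G4]
  ring

namespace Multipatch

variable {D : SpaceTimeDomain d} (M : Multipatch D)

/-! ### Consistency -/

lemma memH2_dom {u : E d → ℝ} (hu : MemH2 D.Q u) (i : Fin M.N) : MemH2 (M.dom i) u :=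
  ⟨hu.1.mono (M.patch_subset i), fun k => ((hu.2 k).mono (M.patch_subset i)).congr (M.isOpen_dom i)
    (M.der_ae_eq hu.1 i k).symm⟩

/-- The relations between the one-sided traces of an `H²` function on interior facets. -/
lemma ae_facet {u : E d → ℝ} (hu : MemH2 D.Q u) :
    ∀ᵐ y ∂(Measure.euclideanHausdorffMeasure d : Measure (E d)), ∀ i j, i ≠ j → y ∈ M.facet i j →
      M.nrm j y = -M.nrm i y ∧ M.tr j u y = M.tr i u y ∧
        ∀ k, M.trD j k u y = M.trD i k u y := by
  have h1 : ∀ᵐ y ∂(Measure.euclideanHausdorffMeasure d : Measure (E d)), ∀ k i,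
      y ∈ frontier (M.dom i) → M.trD i k u y = M.tr i (weakPartial D.Q k u) y :=
    ae_all_iff.2 fun k => ae_all_iff.2 fun i =>
      (ae_restrict_iff' isClosed_frontier.measurableSet).1
        ((M.isGreenDomain i).trace_congr ((M.memH2_dom hu i).2 k) (M.der_ae_eq hu.1 i k))
  filter_upwards [h1, M.ae_isRegularPoint, M.tr_ae_eq_tr hu.1,
    ae_all_iff.2 fun k => M.tr_ae_eq_tr (hu.2 k)] with y hy hr ht hd i j hij hF
  refine ⟨hr.nrm_eq_neg hij hF.2.1 hF.2.2, (ht i j hF).symm, fun k => ?_⟩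
  rw [hy k i hF.2.1, hy k j hF.2.2, hd k i j hF]

lemma MemV0h.memH2 {M : Multipatch D} {v : E d → ℝ} (hv : M.MemV0h v) (i : Fin M.N) :
    MemH2 (M.dom i) v := by
  obtain ⟨w, hw, hvw⟩ := hv.1 i
  exact ((M.patch i).space_regular hw).1.congr (M.isOpen_dom i)
    ((ae_restrict_iff' (M.isOpen_dom i).measurableSet).2
      (Eventually.of_forall fun z hz => (hvw hz).symm))

/-- The boundary values of a discrete function and of its gradient on `Σ ∪ Σ_0`. -/
lemma MemV0h.ae_boundary {M : Multipatch D} {v : E d → ℝ} (hv : M.MemV0h v) (i : Fin M.N) :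
    ∀ᵐ y ∂(surf (M.dom i)), y ∈ D.lateral ∪ D.bottom → M.tr i v y = 0 ∧
      ∀ k l, M.trD i k v y * M.nrm i y l = M.trD i l v y * M.nrm i y k := by
  obtain ⟨w, hw, hvw⟩ := hv.1 i
  obtain ⟨-, V, hV, hwV⟩ := (M.patch i).space_regular hw
  have hvV : Set.EqOn v V (M.dom i) := fun z hz => (hvw hz).trans (hwV hz)
  have hG := M.isGreenDomain i
  have h2 := hv.memH2 i
  have ht := hG.trace_ae_eq_of_continuous h2.1 hV.continuous hvV
  have htD := fun k => (hG.trace_weakPartial_ae_eq h2 hV hvV k).2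
  have hz : ∀ᵐ y ∂(surf (M.dom i)), y ∈ D.lateral ∪ D.bottom → V y = 0 := by
    filter_upwards [hv.2 i, ht] with y h h' hy
    rw [← h', ← h hy]; rfl
  have hd : (M.patch i).chart.dom = M.dom i := (M.patch i).chart_dom
  have hp := (M.patch i).chart.ae_pd_mul_outerNormal hV (S := D.lateral ∪ D.bottom)
    (by rw [hd]; exact hz)
  rw [hd] at hp
  filter_upwards [hv.2 i, hp, ae_all_iff.2 htD] with y h h' h'' hy
  refine ⟨h hy, fun k l => ?_⟩
  have e : ∀ k, M.trD i k v y = pd k V y := fun k => h'' k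
  rw [e, e]
  exact h' hy k l

lemma sumFacets_congr {g g' : Fin M.N → Fin M.N → ℝ} (h : ∀ i j, i ≠ j → g i j = g' i j) :
    M.sumFacets g = M.sumFacets g' :=
  Finset.sum_congr rfl fun i _ => Finset.sum_congr rfl fun j hj =>
    h i j (Finset.mem_Ioi.1 hj).ne

lemma sumFacets_neg (g : Fin M.N → Fin M.N → ℝ) :
    M.sumFacets (fun i j => -g i j) = -M.sumFacets g := by
  simp [sumFacets]

lemma surfInt_congr {F : Set (E d)} (hF : MeasurableSet F) {g g' : E d → ℝ}
    (h : ∀ᵐ y ∂(Measure.euclideanHausdorffMeasure d : Measure (E d)), y ∈ F → g y = g' y) :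
    surfInt F g = surfInt F g' :=
  integral_congr_ae ((ae_restrict_iff' hF).2 h)

lemma surfInt_neg (F : Set (E d)) (g : E d → ℝ) : surfInt F (fun y => -g y) = -surfInt F g :=
  integral_neg _

/-- Partial integration turns the volume part into the right-hand side plus the boundary integrals
`-b₁ + b₂ + b₃ - b₄` of all patches. The facet and top terms of the form are their negatives there,
and nothing remains on `Σ ∪ Σ_0`. The weights `τ i` may differ across a facet because they stay with
the one-sided values of the test function. -/
theorem consistency {f u v : E d → ℝ} (δ₁ δ₂ : ℝ) (τ : Fin M.N → ℝ) (hu2 : MemH2 D.Q u)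
    (hf : f =ᵐ[volume.restrict D.Q] fun z => weakPartial D.Q (tm d) u z
      - ∑ k : Fin d, weakPartial D.Q (sp k) (weakPartial D.Q (sp k) u) z)
    (hv : M.MemV0h v) :
    (∑ i, ∫ z in M.dom i,
      (-(u z * M.der i (tm d) v z) + τ i * (M.der i (tm d) u z * M.der i (tm d) v z)
        + ∑ k : Fin d, M.der i (sp k) u z * M.der i (sp k) v z
        - τ i * ∑ k : Fin d, M.der i (tm d) (M.der i (sp k) u) z * M.der i (sp k) v z))
  + M.sumFacets (fun i j => surfInt (M.facet i j) fun y =>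
      M.up i (M.tr i u) (M.tr j u) y * M.jump i j (tm d) (M.tr i v) (M.tr j v) y)
  + (∑ i, surfInt (M.topFacet i) fun y => M.tr i u y * M.tr i v y)
  + (∑ i, τ i * surfInt (M.topFacet i) fun y =>
      ∑ k : Fin d, M.trD i (sp k) u y * M.trD i (sp k) v y)
  + M.sumFacets (fun i j => surfInt (M.facet i j) fun y =>
      ∑ k : Fin d, M.up i (M.trD i (sp k) u) (M.trD j (sp k) u) y *
        M.jump i j (tm d) (τ i • M.trD i (sp k) v) (τ j • M.trD j (sp k) v) y)
  + M.sumFacets (fun i j => surfInt (M.facet i j) fun y =>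
      ∑ k : Fin d,
        (-(avg (M.trD i (sp k) u) (M.trD j (sp k) u) y *
            M.jump i j (sp k) (M.tr i v) (M.tr j v) y)
          + avg (M.trD i (sp k) v) (M.trD j (sp k) v) y *
            M.jump i j (sp k) (M.tr i u) (M.tr j u) y))
  + M.sumFacets (fun i j => surfInt (M.facet i j) fun y =>
      ∑ k : Fin d,
        (-(avg (M.trD i (sp k) u) (M.trD j (sp k) u) y *
            M.jump i j (sp k) (τ i • M.trD i (tm d) v) (τ j • M.trD j (tm d) v) y)
          + τ i * (avg (M.trD i (sp k) v) (M.trD j (sp k) v) y *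
            M.jump i j (sp k) (M.trD i (tm d) u) (M.trD j (tm d) u) y)))
  + M.sumFacets (fun i j => surfInt (M.facet i j) fun y =>
      ∑ k : Fin d,
        (δ₁ / M.h i * (M.jump i j (sp k) (M.tr i u) (M.tr j u) y *
            M.jump i j (sp k) (M.tr i v) (M.tr j v) y)
          + δ₂ * τ i * (M.jump i j (sp k) (M.trD i (tm d) u) (M.trD j (tm d) u) y *
            M.jump i j (sp k) (M.trD i (tm d) v) (M.trD j (tm d) v) y)))
    = ∑ i, ∫ z in M.dom i, f z * (v z + τ i * M.der i (tm d) v z) := by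
  have hui := M.memH2_dom hu2
  have hvi := hv.memH2
  have hfac := M.ae_facet hu2
  have hL : ∀ i {w : E d → ℝ}, MemH1 (M.dom i) w → MemLp (M.tr i w) 2 (surf (M.dom i)) :=
    fun i w hw => (M.isTrace_tr i hw).1
  have hLn : ∀ i {w : E d → ℝ} (k : Fin (d + 1)), MemH1 (M.dom i) w →
      MemLp (fun y => M.tr i w y * M.nrm i y k) 2 (surf (M.dom i)) := fun i w k hw =>
    (M.isGreenDomain i).memLp_mul_outerNormal k (hL i hw)
  have hI : ∀ i {w w' : E d → ℝ} (k : Fin (d + 1)), MemH1 (M.dom i) w → MemH1 (M.dom i) w' →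
      Integrable (fun y => M.tr i w y * (M.tr i w' y * M.nrm i y k)) (surf (M.dom i)) :=
    fun i w w' k hw hw' => (hL i hw).integrable_mul (hLn i k hw')
  -- the boundary terms of the patches
  set b₁ : Fin M.N → E d → ℝ := fun i y => M.tr i u y * (M.tr i v y * M.nrm i y (tm d)) with hb₁
  set b₂ : Fin M.N → E d → ℝ := fun i y =>
    ∑ k : Fin d, M.trD i (sp k) u y * (M.tr i v y * M.nrm i y (sp k)) with hb₂
  set b₃ : Fin M.N → E d → ℝ := fun i y =>
    τ i * ∑ k : Fin d, M.trD i (sp k) u y * (M.trD i (tm d) v y * M.nrm i y (sp k)) with hb₃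
  set b₄ : Fin M.N → E d → ℝ := fun i y =>
    τ i * ∑ k : Fin d, M.trD i (sp k) u y * (M.trD i (sp k) v y * M.nrm i y (tm d)) with hb₄
  have J₂ : ∀ i (k : Fin d), Integrable (fun y => M.trD i (sp k) u y
      * (M.tr i v y * M.nrm i y (sp k))) (surf (M.dom i)) := fun i k =>
    hI i _ ((hui i).2 _) (hvi i).1
  have J₃ : ∀ i (k : Fin d), Integrable (fun y => M.trD i (sp k) u y
      * (M.trD i (tm d) v y * M.nrm i y (sp k))) (surf (M.dom i)) := fun i k =>
    hI i _ ((hui i).2 _) ((hvi i).2 _)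
  have J₄ : ∀ i (k : Fin d), Integrable (fun y => M.trD i (sp k) u y
      * (M.trD i (sp k) v y * M.nrm i y (tm d))) (surf (M.dom i)) := fun i k =>
    hI i _ ((hui i).2 _) ((hvi i).2 _)
  have I₁ : ∀ i, Integrable (b₁ i) (surf (M.dom i)) := fun i => hI i _ (hui i).1 (hvi i).1
  have I₂ : ∀ i, Integrable (b₂ i) (surf (M.dom i)) := fun i =>
    integrable_finsetSum _ fun k _ => J₂ i k
  have I₃ : ∀ i, Integrable (b₃ i) (surf (M.dom i)) := fun i =>
    (integrable_finsetSum _ fun k _ => J₃ i k).const_mul _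
  have I₄ : ∀ i, Integrable (b₄ i) (surf (M.dom i)) := fun i =>
    (integrable_finsetSum _ fun k _ => J₄ i k).const_mul _
  -- volume terms
  have T₀ : ∑ i, ∫ z in M.dom i,
      (-(u z * M.der i (tm d) v z) + τ i * (M.der i (tm d) u z * M.der i (tm d) v z)
        + ∑ k : Fin d, M.der i (sp k) u z * M.der i (sp k) v z
        - τ i * ∑ k : Fin d, M.der i (tm d) (M.der i (sp k) u) z * M.der i (sp k) v z)
      = (∑ i, ∫ z in M.dom i, f z * (v z + τ i * M.der i (tm d) v z))
        - (∑ i, ∫ y, b₁ i y ∂(surf (M.dom i))) + (∑ i, ∫ y, b₂ i y ∂(surf (M.dom i)))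
        + (∑ i, ∫ y, b₃ i y ∂(surf (M.dom i))) - ∑ i, ∫ y, b₄ i y ∂(surf (M.dom i)) := by
    rw [← Finset.sum_sub_distrib, ← Finset.sum_add_distrib, ← Finset.sum_add_distrib,
      ← Finset.sum_sub_distrib]
    refine Finset.sum_congr rfl fun i _ => ?_
    have hfi : f =ᵐ[volume.restrict (M.dom i)] fun z => weakPartial (M.dom i) (tm d) u z
        - ∑ k : Fin d, weakPartial (M.dom i) (sp k) (weakPartial (M.dom i) (sp k) u) z := by
      have h1 := ae_mono (Measure.restrict_mono (M.patch_subset i) le_rfl) hf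
      have h2 : ∀ k : Fin d, weakPartial (M.dom i) (sp k) (weakPartial (M.dom i) (sp k) u)
          =ᵐ[volume.restrict (M.dom i)] weakPartial D.Q (sp k) (weakPartial D.Q (sp k) u) :=
        fun k => (weakPartial_congr (M.isOpen_dom i) ((hui i).2 (sp k))
          (M.der_ae_eq hu2.1 i (sp k)) (sp k)).trans (M.der_ae_eq (hu2.2 (sp k)) i (sp k))
      filter_upwards [h1, M.der_ae_eq hu2.1 i (tm d), ae_all_iff.2 h2] with z hz hz1 hz2
      rw [hz]
      simp only [hz2]
      rw [← hz1]; rfl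
    have h := (M.isGreenDomain i).integral_identity (hui i) (hvi i) (τ i) hfi
    refine h.trans ?_
    have e₂ : ∫ y, b₂ i y ∂(surf (M.dom i)) = _ := integral_finsetSum _ fun k _ => J₂ i k
    have e₃ : ∫ y, b₃ i y ∂(surf (M.dom i)) = _ :=
      (integral_const_mul _ _).trans (congrArg (τ i * ·) (integral_finsetSum _ fun k _ => J₃ i k))
    have e₄ : ∫ y, b₄ i y ∂(surf (M.dom i)) = _ :=
      (integral_const_mul _ _).trans (congrArg (τ i * ·) (integral_finsetSum _ fun k _ => J₄ i k))
    rw [e₂, e₃, e₄, mul_sub, ← add_sub_assoc]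
    rfl
  -- facet terms
  have T₁ : M.sumFacets (fun i j => surfInt (M.facet i j) fun y =>
      M.up i (M.tr i u) (M.tr j u) y * M.jump i j (tm d) (M.tr i v) (M.tr j v) y)
      = M.sumFacets (fun i j => surfInt (M.facet i j) fun y => b₁ i y + b₁ j y) := by
    refine M.sumFacets_congr fun i j hij => surfInt_congr (M.measurableSet_facet i j) ?_
    filter_upwards [hfac] with y hy hF
    obtain ⟨hn, ht, -⟩ := hy i j hij hF
    simp only [up, jump, hb₁, ht, ite_self]
    ring
  have T₄ : M.sumFacets (fun i j => surfInt (M.facet i j) fun y =>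
      ∑ k : Fin d, M.up i (M.trD i (sp k) u) (M.trD j (sp k) u) y *
        M.jump i j (tm d) (τ i • M.trD i (sp k) v) (τ j • M.trD j (sp k) v) y)
      = M.sumFacets (fun i j => surfInt (M.facet i j) fun y => b₄ i y + b₄ j y) := by
    refine M.sumFacets_congr fun i j hij => surfInt_congr (M.measurableSet_facet i j) ?_
    filter_upwards [hfac] with y hy hF
    obtain ⟨hn, -, ht⟩ := hy i j hij hF
    simp only [up, jump, hb₄, ht, ite_self, Pi.smul_apply, smul_eq_mul]
    rw [Finset.mul_sum, Finset.mul_sum, ← Finset.sum_add_distrib]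
    exact Finset.sum_congr rfl fun k _ => by ring
  have T₅ : M.sumFacets (fun i j => surfInt (M.facet i j) fun y =>
      ∑ k : Fin d,
        (-(avg (M.trD i (sp k) u) (M.trD j (sp k) u) y *
            M.jump i j (sp k) (M.tr i v) (M.tr j v) y)
          + avg (M.trD i (sp k) v) (M.trD j (sp k) v) y *
            M.jump i j (sp k) (M.tr i u) (M.tr j u) y))
      = -M.sumFacets (fun i j => surfInt (M.facet i j) fun y => b₂ i y + b₂ j y) := by
    rw [← sumFacets_neg]
    refine M.sumFacets_congr fun i j hij => ?_
    rw [← surfInt_neg]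
    refine surfInt_congr (M.measurableSet_facet i j) ?_
    filter_upwards [hfac] with y hy hF
    obtain ⟨hn, ht, htD⟩ := hy i j hij hF
    simp only [avg, jump, hb₂, ht, htD, hn, PiLp.neg_apply]
    rw [← Finset.sum_add_distrib, ← Finset.sum_neg_distrib]
    exact Finset.sum_congr rfl fun k _ => by ring
  have T₆ : M.sumFacets (fun i j => surfInt (M.facet i j) fun y =>
      ∑ k : Fin d,
        (-(avg (M.trD i (sp k) u) (M.trD j (sp k) u) y *
            M.jump i j (sp k) (τ i • M.trD i (tm d) v) (τ j • M.trD j (tm d) v) y)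
          + τ i * (avg (M.trD i (sp k) v) (M.trD j (sp k) v) y *
            M.jump i j (sp k) (M.trD i (tm d) u) (M.trD j (tm d) u) y)))
      = -M.sumFacets (fun i j => surfInt (M.facet i j) fun y => b₃ i y + b₃ j y) := by
    rw [← sumFacets_neg]
    refine M.sumFacets_congr fun i j hij => ?_
    rw [← surfInt_neg]
    refine surfInt_congr (M.measurableSet_facet i j) ?_
    filter_upwards [hfac] with y hy hF
    obtain ⟨hn, ht, htD⟩ := hy i j hij hF
    simp only [avg, jump, hb₃, htD, hn, PiLp.neg_apply, Pi.smul_apply, smul_eq_mul]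
    rw [Finset.mul_sum, Finset.mul_sum, ← Finset.sum_add_distrib, ← Finset.sum_neg_distrib]
    exact Finset.sum_congr rfl fun k _ => by ring
  have T₇ : M.sumFacets (fun i j => surfInt (M.facet i j) fun y =>
      ∑ k : Fin d,
        (δ₁ / M.h i * (M.jump i j (sp k) (M.tr i u) (M.tr j u) y *
            M.jump i j (sp k) (M.tr i v) (M.tr j v) y)
          + δ₂ * τ i * (M.jump i j (sp k) (M.trD i (tm d) u) (M.trD j (tm d) u) y *
            M.jump i j (sp k) (M.trD i (tm d) v) (M.trD j (tm d) v) y))) = 0 := by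
    refine Finset.sum_eq_zero fun i _ => Finset.sum_eq_zero fun j hj => ?_
    refine (surfInt_congr (g' := fun _ => 0) (M.measurableSet_facet i j) ?_).trans
      (by simp [surfInt])
    filter_upwards [hfac] with y hy hF
    obtain ⟨hn, ht, htD⟩ := hy i j (Finset.mem_Ioi.1 hj).ne hF
    refine Finset.sum_eq_zero fun k _ => ?_
    simp only [jump, ht, htD, hn, PiLp.neg_apply]
    ring
  -- top
  have htop : ∀ i, ∀ᵐ y ∂(Measure.euclideanHausdorffMeasure d : Measure (E d)),
      y ∈ M.topFacet i → M.nrm i y (tm d) = 1 ∧ ∀ k : Fin d, M.nrm i y (sp k) = 0 := fun i => by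
    filter_upwards [M.ae_isRegularPoint] with y hy hyt
    rw [hy.nrm_top hyt]
    refine ⟨by simp, fun k => ?_⟩
    simp [(Fin.castSucc_lt_last k).ne]
  have P₁ : ∀ i, surfInt (M.topFacet i) (b₁ i)
      = surfInt (M.topFacet i) fun y => M.tr i u y * M.tr i v y := fun i =>
    surfInt_congr (M.measurableSet_topFacet i) (by
      filter_upwards [htop i] with y hy hF
      simp only [hb₁, (hy hF).1, mul_one])
  have P₂ : ∀ i, surfInt (M.topFacet i) (b₂ i) = 0 := fun i =>
    (surfInt_congr (g' := fun _ => 0) (M.measurableSet_topFacet i) (by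
      filter_upwards [htop i] with y hy hF
      simp [hb₂, (hy hF).2])).trans (by simp [surfInt])
  have P₃ : ∀ i, surfInt (M.topFacet i) (b₃ i) = 0 := fun i =>
    (surfInt_congr (g' := fun _ => 0) (M.measurableSet_topFacet i) (by
      filter_upwards [htop i] with y hy hF
      simp [hb₃, (hy hF).2])).trans (by simp [surfInt])
  have P₄ : ∀ i, surfInt (M.topFacet i) (b₄ i) = τ i * surfInt (M.topFacet i) fun y =>
      ∑ k : Fin d, M.trD i (sp k) u y * M.trD i (sp k) v y := fun i => by
    rw [surfInt, surfInt, ← integral_const_mul]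
    exact surfInt_congr (M.measurableSet_topFacet i) (by
      filter_upwards [htop i] with y hy hF
      simp only [hb₄, (hy hF).1, mul_one])
  -- lateral boundary and bottom
  have hR := D.measurableSet_lateral_union_bottom
  have R₁ : ∀ i, ∫ y in D.lateral ∪ D.bottom, b₁ i y ∂(surf (M.dom i)) = 0 := fun i => by
    refine integral_eq_zero_of_ae ((ae_restrict_iff' hR).2 ?_)
    filter_upwards [hv.ae_boundary i] with y hy hyR
    simp [hb₁, (hy hyR).1]
  have R₂ : ∀ i, ∫ y in D.lateral ∪ D.bottom, b₂ i y ∂(surf (M.dom i)) = 0 := fun i => by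
    refine integral_eq_zero_of_ae ((ae_restrict_iff' hR).2 ?_)
    filter_upwards [hv.ae_boundary i] with y hy hyR
    simp [hb₂, (hy hyR).1]
  -- Neither integral need vanish alone. They agree because `v = 0` there forces its gradient to be
  -- normal, so `∂_t v n_k = ∂_k v n_t`; they enter with opposite signs and cancel.
  have R₃ : ∀ i, ∫ y in D.lateral ∪ D.bottom, b₃ i y ∂(surf (M.dom i))
      = ∫ y in D.lateral ∪ D.bottom, b₄ i y ∂(surf (M.dom i)) := fun i => by
    refine integral_congr_ae ((ae_restrict_iff' hR).2 ?_)
    filter_upwards [hv.ae_boundary i] with y hy hyR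
    simp only [hb₃, hb₄, (hy hyR).2 (tm d)]
  have S₁ := M.sum_integral_surf I₁
  have S₂ := M.sum_integral_surf I₂
  have S₃ := M.sum_integral_surf I₃
  have S₄ := M.sum_integral_surf I₄
  simp only [P₁, R₁, Finset.sum_const_zero, add_zero] at S₁
  simp only [P₂, R₂, Finset.sum_const_zero, add_zero] at S₂
  simp only [P₃, R₃, Finset.sum_const_zero, add_zero] at S₃
  simp only [P₄] at S₄
  rw [T₀, T₁, T₄, T₅, T₆, T₇, S₁, S₂, S₃, S₄]
  ring

end Multipatch

end SpaceTimeDG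

end

theorem theorem1 {d : ℕ} (hd : 1 ≤ d)
    (D : SpaceTimeDG.SpaceTimeDomain d) (M : SpaceTimeDG.Multipatch D)
    (θ : Fin M.N → ℝ) (hθ : ∀ i, 0 < θ i)
    (δ₁ δ₂ : ℝ) (hδ₁ : 0 < δ₁) (hδ₂ : 0 < δ₂)
    (f : SpaceTimeDG.E d → ℝ) (hf : MemLp f 2 (volume.restrict D.Q))
    (u : SpaceTimeDG.E d → ℝ) (hu : D.IsWeakSolution f u) (hu2 : SpaceTimeDG.MemH2 D.Q u) :
    ∀ v : SpaceTimeDG.E d → ℝ, M.MemV0h v → M.dgForm θ δ₁ δ₂ u v = M.dgRhs θ f v :=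
  fun _ hv => M.consistency δ₁ δ₂ (fun i => θ i * M.h i) hu2 (hu.ae_eq hf hu2) hv
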